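/- Let $K$ be a field, let $Q$ be a finite acyclic quiver with vertex set $Q_0$, $n=|Q_0|$, and let $A=KQ/I$ with $I$ an admissible ideal. Paths are composed from left to right, $e_a$ denotes the idempotent of the trivial path at a vertex $a$, and modules are right modules. Put $P(a)=e_aA$ and $I(a)=D(Ae_a)$ with $D=\operatorname{Hom}_K(-,K)$. The algebra $A$ is called Auslander regular if it has finite global dimension, $A_A$ has finite injective dimension, and the terms of the minimal injective coresolution $0\to A_A\to I^0\to I^1\to\cdots$ satisfy $\operatorname{pdim} I^i\le i$ for all $i\ge 0$. For such an $A$, the Auslander–Reiten (AR) permutation $\hat\psi$ of $Q_0$ is determined by $\Omega^{d}(I(a))\cong P(\hat\psi(a))$, where $d=\operatorname{pdim} I(a)$ and $\Omega$ denotes the syzygy with respect to projective covers. A natural labelling is a bijection $\ell:Q_0\to\{1,\dots,n\}$ such that $\ell(a)<\ell(b)$ whenever $a\ne b$ and there is an oriented path from $a$ to $b$. With respect to $\ell$ (write $e_i$ for the idempotent of the vertex labelled $i$), the Cartan matrix is $\omega=(\dim_K e_jAe_i)_{i,j}$ and the Coxeter matrix is $C=-\omega^T\omega^{-1}$. Write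 $C=U_1PU_2$ with $U_1,U_2$ real upper triangular matrices and $P$ a permutation matrix (a Bruhat decomposition; $P$ is uniquely determined by $C$). The Coxeter permutation with respect to $\ell$ is the permutation $p_\ell$ of $\{1,\dots,n\}$ such that the nonzero entry of the $i$-th column of $P$ lies in row $p_\ell(i)$. The algebra $A$ is Coxeter-independent if the permutation $\ell^{-1}\circ p_\ell\circ\ell$ of $Q_0$ is the same for all natural labellings $\ell$. **Theorem.** If $A$ is Auslander regular, then $A$ is Coxeter-independent, and its Coxeter permutation coincides with the Auslander–Reiten permutation: the AR permutation $\hat\psi$ is well defined, and $\ell^{-1}\circ p_\ell\circ\ell=\hat\psi$ for every natural labelling $\ell$. -/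

import Mathlib

open CategoryTheory

universe u v w

noncomputable section

namespace QuiverAlg

/-! # Path algebras and admissible ideals -/

section PathAlgebra

/-- The type of all oriented paths (including the trivial ones) of a quiver. -/
abbrev AllPaths (V : Type v) [Quiver.{w} V] : Type (max v w) :=
  Σ a b : V, Quiver.Path a b

/-- The underlying vector space of the path algebra `K Q`: the paths form a basis. -/
def PathAlgebra (K : Type u) [Field K] (V : Type v) [Quiver.{w} V] : Type (max u v w) :=
  AllPaths V →₀ K

variable (K : Type u) [Field K] {V : Type v} [Quiver.{w} V]

instance : AddCommGroup (PathAlgebra K V) := inferInstanceAs (AddCommGroup (AllPaths V →₀ K))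
instance : Module K (PathAlgebra K V) := inferInstanceAs (Module K (AllPaths V →₀ K))

/-- The basis element of the path algebra given by a path. -/
def ofPath (p : AllPaths V) : PathAlgebra K V := Finsupp.single p (1 : K)

open Classical in
/-- The product of two paths: first `p`, then `q` if the end of `p` is the start of `q`,
and `0` otherwise. -/
def pathMul (p q : AllPaths V) : PathAlgebra K V :=
  if h : p.2.1 = q.1 then ofPath K ⟨p.1, q.2.1, p.2.2.comp (q.2.2.cast h.symm rfl)⟩ else 0

/-- The bilinear multiplication of the path algebra. -/
def mulHom : PathAlgebra K V →ₗ[K] PathAlgebra K V →ₗ[K] PathAlgebra K V :=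
  Finsupp.linearCombination K
    (fun p : AllPaths V => (Finsupp.linearCombination K (pathMul K p) :
      (AllPaths V →₀ K) →ₗ[K] PathAlgebra K V))

instance : Mul (PathAlgebra K V) := ⟨fun x y => mulHom K x y⟩

/-- The unit of the path algebra is the sum of the trivial paths. -/
instance [Fintype V] : One (PathAlgebra K V) :=
  ⟨∑ a : V, ofPath K ⟨a, a, Quiver.Path.nil⟩⟩

variable {K}

theorem mul_eq_mulHom (x y : PathAlgebra K V) : x * y = mulHom K x y := rfl

theorem one_eq_sum [Fintype V] :
    (1 : PathAlgebra K V) = ∑ a : V, ofPath K ⟨a, a, Quiver.Path.nil⟩ := rfl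

theorem mulHom_ofPath (p q : AllPaths V) : mulHom K (ofPath K p) (ofPath K q) = pathMul K p q := by
  unfold mulHom ofPath
  erw [Finsupp.linearCombination_single, one_smul, Finsupp.linearCombination_single, one_smul]

theorem ofPath_mul_ofPath {a b c : V} (p : Quiver.Path a b) (q : Quiver.Path b c) :
    ofPath K ⟨a, b, p⟩ * ofPath K ⟨b, c, q⟩ = ofPath K ⟨a, c, p.comp q⟩ := by
  rw [mul_eq_mulHom, mulHom_ofPath]
  simp [pathMul]

theorem ofPath_mul_ofPath_of_ne {p q : AllPaths V} (h : p.2.1 ≠ q.1) :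
    ofPath K p * ofPath K q = 0 := by
  rw [mul_eq_mulHom, mulHom_ofPath]
  simp [pathMul, h]

@[elab_as_elim]
theorem induction_on {C : PathAlgebra K V → Prop} (x : PathAlgebra K V) (h0 : C 0)
    (hadd : ∀ x y, C x → C y → C (x + y)) (hsmul : ∀ (k : K) p, C (k • ofPath K p)) : C x := by
  refine Finsupp.induction_linear (motive := C) x h0 hadd (fun p k => ?_)
  have h := hsmul k p
  have e : k • ofPath K p = (Finsupp.single p k : AllPaths V →₀ K) := by
    unfold ofPath
    erw [Finsupp.smul_single, smul_eq_mul, mul_one]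
  rwa [e] at h

theorem add_mul' (x y z : PathAlgebra K V) : (x + y) * z = x * z + y * z := by
  simp [mul_eq_mulHom]

theorem mul_add' (x y z : PathAlgebra K V) : x * (y + z) = x * y + x * z := by
  simp [mul_eq_mulHom]

theorem zero_mul' (x : PathAlgebra K V) : 0 * x = 0 := by simp [mul_eq_mulHom]

theorem mul_zero' (x : PathAlgebra K V) : x * 0 = 0 := by simp [mul_eq_mulHom]

theorem smul_mul' (k : K) (x y : PathAlgebra K V) : (k • x) * y = k • (x * y) := by
  simp [mul_eq_mulHom]

theorem mul_smul' (k : K) (x y : PathAlgebra K V) : x * (k • y) = k • (x * y) := by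
  simp [mul_eq_mulHom]

theorem ofPath_mul_assoc (p q r : AllPaths V) :
    ofPath K p * ofPath K q * ofPath K r = ofPath K p * (ofPath K q * ofPath K r) := by
  obtain ⟨a, b, p⟩ := p
  obtain ⟨b', c, q⟩ := q
  obtain ⟨c', d, r⟩ := r
  by_cases h1 : b = b'
  · subst h1
    by_cases h2 : c = c'
    · subst h2
      simp only [ofPath_mul_ofPath, Quiver.Path.comp_assoc]
    · rw [ofPath_mul_ofPath, ofPath_mul_ofPath_of_ne (by simpa using h2),
        ofPath_mul_ofPath_of_ne (by simpa using h2), mul_zero']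
  · rw [ofPath_mul_ofPath_of_ne (by simpa using h1), zero_mul']
    by_cases h2 : c = c'
    · subst h2
      rw [ofPath_mul_ofPath, ofPath_mul_ofPath_of_ne (by simpa using h1)]
    · rw [ofPath_mul_ofPath_of_ne (p := ⟨b', c, q⟩) (by simpa using h2), mul_zero']

theorem mul_assoc' (x y z : PathAlgebra K V) : x * y * z = x * (y * z) := by
  refine induction_on x ?_ ?_ ?_
  · simp only [zero_mul']
  · intro a b ha hb
    simp only [add_mul', ha, hb]
  intro k p
  refine induction_on y ?_ ?_ ?_
  · simp only [zero_mul', mul_zero']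
  · intro a b ha hb
    simp only [add_mul', mul_add', ha, hb]
  intro l q
  refine induction_on z ?_ ?_ ?_
  · simp only [mul_zero']
  · intro a b ha hb
    simp only [mul_add', ha, hb]
  intro m r
  simp only [smul_mul', mul_smul', ofPath_mul_assoc]

theorem one_mul' [Fintype V] (x : PathAlgebra K V) : 1 * x = x := by
  refine induction_on x (mul_zero' _) ?_ ?_
  · intro a b ha hb
    rw [mul_add', ha, hb]
  rintro k ⟨a, b, p⟩
  rw [mul_smul', one_eq_sum, mul_eq_mulHom, map_sum, LinearMap.sum_apply,
    Finset.sum_eq_single a]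
  · rw [← mul_eq_mulHom, ofPath_mul_ofPath, Quiver.Path.nil_comp]
  · intro c _ hc
    rw [← mul_eq_mulHom, ofPath_mul_ofPath_of_ne (by simpa using hc)]
  · simp

theorem mul_one' [Fintype V] (x : PathAlgebra K V) : x * 1 = x := by
  refine induction_on x (zero_mul' _) ?_ ?_
  · intro a b ha hb
    rw [add_mul', ha, hb]
  rintro k ⟨a, b, p⟩
  rw [smul_mul', one_eq_sum, mul_eq_mulHom, map_sum, Finset.sum_eq_single b]
  · rw [← mul_eq_mulHom, ofPath_mul_ofPath, Quiver.Path.comp_nil]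
  · intro c _ hc
    rw [← mul_eq_mulHom, ofPath_mul_ofPath_of_ne (by simpa using hc.symm)]
  · simp

/-- The path algebra of a quiver with finitely many vertices, as a unital ring. -/
instance [Fintype V] : Ring (PathAlgebra K V) where
  __ := (inferInstance : AddCommGroup (PathAlgebra K V))
  left_distrib := mul_add'
  right_distrib := add_mul'
  zero_mul := zero_mul'
  mul_zero := mul_zero'
  mul_assoc := mul_assoc'
  one_mul := one_mul'
  mul_one := mul_one'

instance [Fintype V] : Algebra K (PathAlgebra K V) :=
  Algebra.ofModule smul_mul' mul_smul'

/-- A quiver is acyclic if it has no oriented cycles (in particular no loops). -/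
def IsAcyclic (V : Type v) [Quiver.{w} V] : Prop :=
  ∀ (a : V) (p : Quiver.Path a a), p.length = 0

variable (K V) in
/-- The arrow ideal `R`; it is spanned by the paths of length at least one. -/
def arrowIdeal : Submodule K (PathAlgebra K V) :=
  Submodule.span K {x | ∃ p : AllPaths V, 1 ≤ p.2.2.length ∧ x = ofPath K p}

variable [Fintype V]

/-- An ideal `I` of `K Q` is admissible if `R ^ m ⊆ I ⊆ R ^ 2` for some `m ≥ 2`, where `R` is
the arrow ideal. -/
def IsAdmissible (I : Ideal (PathAlgebra K V)) : Prop :=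
  (∃ m : ℕ, 2 ≤ m ∧ arrowIdeal K V ^ m ≤ I.restrictScalars K) ∧
    I.restrictScalars K ≤ arrowIdeal K V ^ 2

/-- The idempotent `e_a` of `K Q / I` given by the trivial path at the vertex `a`. -/
def vertexIdem (I : Ideal (PathAlgebra K V)) [I.IsTwoSided] (a : V) : PathAlgebra K V ⧸ I :=
  Ideal.Quotient.mk I (ofPath K ⟨a, a, Quiver.Path.nil⟩)

end PathAlgebra

/-! # Homological algebra of right modules

A right module over `A` is a module over `Aᵐᵒᵖ`. -/

section Homological

/-- A submodule `N` of `M` is essential if it meets every nonzero submodule. -/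
def IsEssential {R M : Type*} [Ring R] [AddCommGroup M] [Module R M] (N : Submodule R M) : Prop :=
  ∀ L : Submodule R M, N ⊓ L = ⊥ → L = ⊥

/-- A submodule `N` of `M` is superfluous if `N + L = M` forces `L = M`. -/
def IsSuperfluous {R M : Type*} [Ring R] [AddCommGroup M] [Module R M]
    (N : Submodule R M) : Prop :=
  ∀ L : Submodule R M, N ⊔ L = ⊤ → L = ⊤

/-- An injective coresolution `0 → M → I⁰ → I¹ → ⋯` is minimal if the kernel of
`Iⁿ → Iⁿ⁺¹` is essential in `Iⁿ` for all `n`, that is, if `M → I⁰` and all the maps from the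
cosyzygies to the next term are injective envelopes. -/
def IsMinimalCoresolution {R : Type u} [Ring R] {M : ModuleCat.{u} R}
    (J : InjectiveResolution M) : Prop :=
  ∀ n : ℕ, IsEssential (LinearMap.ker (J.cocomplex.d n (n + 1)).hom)

/-- `IsSyzygy n M N` means `N ≅ Ωⁿ(M)`, where `Ω(M)` is the kernel of a projective cover
of `M`. -/
def IsSyzygy {R : Type u} [Ring R] : ℕ → ModuleCat.{u} R → ModuleCat.{u} R → Prop
  | 0, M, N => Nonempty (M ≅ N)
  | n + 1, M, N => ∃ (P : ModuleCat.{u} R) (f : P ⟶ M), Projective P ∧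
      Function.Surjective f.hom ∧ IsSuperfluous (LinearMap.ker f.hom) ∧
      IsSyzygy n (ModuleCat.of R (LinearMap.ker f.hom)) N

/-- `A` is Auslander-Gorenstein: `A` has finite injective dimension as a right module, and the
terms of its minimal injective coresolution satisfy `pdim Iⁱ ≤ i` for all `i`. -/
def IsAuslanderGorenstein (A : Type u) [Ring A] : Prop :=
  (∃ d : ℕ, HasInjectiveDimensionLE (ModuleCat.of Aᵐᵒᵖ A) d) ∧
    ∃ J : InjectiveResolution (ModuleCat.of Aᵐᵒᵖ A), IsMinimalCoresolution J ∧
      ∀ i : ℕ, HasProjectiveDimensionLE (J.cocomplex.X i) i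

/-- Finite global dimension, on finitely generated right modules. -/
def HasFiniteGlobalDimension (A : Type u) [Ring A] : Prop :=
  ∃ d : ℕ, ∀ M : ModuleCat.{u} Aᵐᵒᵖ, Module.Finite Aᵐᵒᵖ M → HasProjectiveDimensionLE M d

/-- Auslander regular: Auslander-Gorenstein and of finite global dimension. -/
def IsAuslanderRegular (A : Type u) [Ring A] : Prop :=
  IsAuslanderGorenstein A ∧ HasFiniteGlobalDimension A

/-- The `K`-dual `D M = Hom_K(M, K)`. -/
def KDual (K M : Type*) [Field K] [AddCommGroup M] [Module K M] : Type _ := M →ₗ[K] K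

instance (K M : Type*) [Field K] [AddCommGroup M] [Module K M] : AddCommGroup (KDual K M) :=
  inferInstanceAs (AddCommGroup (M →ₗ[K] K))

/-- The right action of `A` on the dual of a left module: `(f a)(x) = f (a x)`. -/
def KDual.act {K A M : Type*} [Field K] [Ring A] [Algebra K A] [AddCommGroup M] [Module K M]
    [Module A M] [IsScalarTower K A M] (a : A) (f : M →ₗ[K] K) : M →ₗ[K] K where
  toFun x := f (a • x)
  map_add' x y := by rw [smul_add, map_add]
  map_smul' k x := by rw [smul_algebra_smul_comm, map_smul, RingHom.id_apply]

/-- The dual of a left module is a right module. -/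
instance (K A M : Type*) [Field K] [Ring A] [Algebra K A] [AddCommGroup M] [Module K M]
    [Module A M] [IsScalarTower K A M] : Module Aᵐᵒᵖ (KDual K M) where
  smul a f := KDual.act a.unop f
  one_smul f := LinearMap.ext fun x => congrArg (DFunLike.coe (F := M →ₗ[K] K) f) (one_smul A x)
  mul_smul a b f := LinearMap.ext fun x =>
    congrArg (DFunLike.coe (F := M →ₗ[K] K) f) (mul_smul b.unop a.unop x)
  smul_zero _ := rfl
  smul_add _ _ _ := rfl
  add_smul a b f := LinearMap.ext fun x =>
    (congrArg (DFunLike.coe (F := M →ₗ[K] K) f) (add_smul a.unop b.unop x)).trans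
      (LinearMap.map_add f _ _)
  zero_smul f := LinearMap.ext fun x =>
    (congrArg (DFunLike.coe (F := M →ₗ[K] K) f) (zero_smul A x)).trans (LinearMap.map_zero f)

/-- The right module `P = e A`. -/
def projModule {A : Type u} [Ring A] (e : A) : ModuleCat.{u} Aᵐᵒᵖ :=
  ModuleCat.of Aᵐᵒᵖ (Submodule.span Aᵐᵒᵖ ({e} : Set A))

/-- The right module `I = D(A e)`. The universe of `A` is large enough to hold the dual. -/
def injModule (K : Type u) {A : Type (max u v)} [Field K] [Ring A] [Algebra K A] (e : A) :
    ModuleCat.{max u v} Aᵐᵒᵖ :=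
  ModuleCat.of Aᵐᵒᵖ (KDual K (Submodule.span A ({e} : Set A)))

/-- `φ` is the map of Auslander and Reiten on the index set of the idempotents:
`Ωᵈ(I(i)) ≅ P(φ i)` with `d = pdim I(i)`. -/
def IsAuslanderReitenMap (K : Type u) {A : Type (max u v)} [Field K] [Ring A] [Algebra K A]
    {V : Type*} (e : V → A) (φ : V → V) : Prop :=
  ∀ i : V, ∃ d : ℕ, projectiveDimension (injModule.{u, v} K (e i)) = d ∧
    IsSyzygy d (injModule.{u, v} K (e i)) (projModule (e (φ i)))

end Homological

/-! # Cartan matrix, Coxeter matrix and Coxeter permutation -/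

section Coxeter

/-- The column-permutation of a Bruhat decomposition: `M = U₁ P U₂` with `U₁`, `U₂` upper
triangular and `P` the permutation matrix whose nonzero entry in column `j` is in row `p j`. -/
def IsBruhatPermutation {n : ℕ} (M : Matrix (Fin n) (Fin n) ℝ) (p : Equiv.Perm (Fin n)) : Prop :=
  ∃ U₁ U₂ : Matrix (Fin n) (Fin n) ℝ, U₁.BlockTriangular id ∧ U₂.BlockTriangular id ∧
    M = U₁ * (Matrix.of fun i j => if i = p j then (1 : ℝ) else 0) * U₂

variable (K : Type*) [Field K] {A : Type*} [Ring A] [Algebra K A] {n : ℕ}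

/-- The Cartan matrix with respect to idempotents `e 0, …, e (n - 1)`: its `(i, j)` entry is the
dimension of `e j * A * e i`. -/
def cartanMatrix (e : Fin n → A) : Matrix (Fin n) (Fin n) ℝ :=
  Matrix.of fun i j =>
    (Module.finrank K (LinearMap.range (LinearMap.mulLeftRight K (e j, e i))) : ℝ)

/-- The Coxeter matrix `C = - ωᵀ ω⁻¹`, where `ω` is the Cartan matrix. -/
def coxeterMatrix (e : Fin n → A) : Matrix (Fin n) (Fin n) ℝ :=
  -((cartanMatrix K e).transpose * (cartanMatrix K e)⁻¹)

/-- A natural labelling of the vertices by `Fin n`, where `n` is the number of vertices. -/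
def IsNaturalLabelling {V : Type*} [Quiver V] [Fintype V] (l : V ≃ Fin (Fintype.card V)) : Prop :=
  ∀ a b : V, a ≠ b → Nonempty (Quiver.Path a b) → l a < l b

/-- `p` is the Coxeter permutation, on the labels, with respect to the labelling `l`. -/
def IsCoxeterPermutation {V : Type*} [Fintype V] (e : V → A) (l : V ≃ Fin (Fintype.card V))
    (p : Equiv.Perm (Fin (Fintype.card V))) : Prop :=
  IsBruhatPermutation (coxeterMatrix K (fun i => e (l.symm i))) p

/-- Coxeter-independence: there is one permutation `π` of the vertices such that, for every
natural labelling `l`, the Coxeter permutation with respect to `l` exists, is unique, and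
becomes `π` when the labels are replaced by the vertices that carry them. -/
def IsCoxeterIndependent {V : Type*} [Quiver V] [Fintype V] (e : V → A) : Prop :=
  ∃ π : Equiv.Perm V, ∀ l : V ≃ Fin (Fintype.card V), IsNaturalLabelling l →
    ∀ p : Equiv.Perm (Fin (Fintype.card V)),
      IsCoxeterPermutation K e l p ↔ l.symm.permCongr p = π

end Coxeter

end QuiverAlg

end

/-! ### Triangular algebras and their vertex idempotents. -/

namespace QuiverAlg

open MulOpposite

/-! All arguments use only orthogonal idempotents with corners `K` and a direction among them
(`IsTriangular`). Write S(a) for the simple module at `a`, and `rad` for the radical.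

Linear algebra. The columns of ω are the dimension vectors of the P(b), those of ωᵀ the dimension
vectors of the I(r). If dim I(r) = ∑ N b r · dim P(b), then ωᵀ = ωN and C = -ωᵀ N (ωᵀ)⁻¹. As ωᵀ is
upper triangular, the Bruhat permutation of C is ψ as soon as N b r = 0 for every b labelled after
ψ(r) (`isBruhatPermutation_of_transpose_eq`). Such an N is read off from minimal projective
resolutions, so it suffices that Extⁱ(I(r), S(b)) ≠ 0 forces b to be labelled no later than ψ(r).
This is `height_le_of_ext_ne_zero`: the last term P(ψ r) of the resolution carries the largest
label.

The bijection. The Auslander condition yields: Extⁱ(S(k), A) ≠ 0 implies pdim I(k) ≤ i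
(`gradeCondition`). Hence the i-th cosyzygy M of P(a) has pdim M ≤ i, and it carries a class in
Extⁱ(M, P(a)) from which all of Extⁱ(M, -) is obtained (`exists_isCosyzygy`). For n = injdim P(a)
this cosyzygy is injective, and P(a) is the n-th syzygy of each of its summands I(k). Since k
determines a, matching a with k is injective, hence a bijection, and ψ is its inverse
(`exists_bijection`).

The inequality. The Nakayama functor ν = D Hom(-, A) sends P(c) to I(c). If pdim I(k) > j, then
Extⁱ(S(k), A) = 0 for i ≤ j, so ν sends rad P(k) → P(k) to an isomorphism (for j = 0 an epimorphism)
onto I(k). This trades I(k) for modules I(c) with c above k, and in the end classes in Extʲ(I(k), Y)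
are detected by the I(r) with pdim I(r) ≤ j, provided that lower Ext groups from injectives to Y
vanish (`ext_injModule_eq_zero`). Take Y = S(ψ q) and n = pdim I(q). Then Extʲ(I(r), Y) = 0 for all
j < n, and maps I(r) → I(q) with r ≠ q act as zero on Extⁿ(I(q), Y). A counterexample b = ψ q of
largest label lifts to a class in Extⁱ(I(r), P(b)). This forces i = n, so the class comes from a map
of I(r) into the injective cosyzygy, a module built from I(q) alone, and its image in Extⁿ(I(r),
S(b)) is zero. -/

/-- A finite-dimensional algebra with a complete set of orthogonal idempotents whose corner rings
are the base field and which are directed: `e a * x * e b ≠ 0` only if `a = b` or `a` precedes `b`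
with respect to some height function. -/
structure IsTriangular (K : Type*) [Field K] {A : Type*} [Ring A] [Algebra K A] {V : Type*}
    [Fintype V] (e : V → A) : Prop where
  finite : Module.Finite K A
  ne_zero : ∀ a, e a ≠ 0
  idem : ∀ a, e a * e a = e a
  orth : ∀ a b, a ≠ b → e a * e b = 0
  sum_eq_one : ∑ a, e a = 1
  corner : ∀ a x, ∃ c : K, e a * x * e a = c • e a
  exists_height : ∃ h : V → ℕ, ∀ a b x, e a * x * e b ≠ 0 → a = b ∨ h a < h b

/-- `l` is strictly increasing along the nonzero elements of `e a * A * e b` for `a ≠ b`. -/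
def IsHeight {A : Type*} [Ring A] {V : Type*} (e : V → A) (l : V → ℕ) : Prop :=
  ∀ a b x, e a * x * e b ≠ 0 → a = b ∨ l a < l b

section Basic

variable {K : Type*} [Field K] {A : Type*} [Ring A] [Algebra K A] {V : Type*} [Fintype V]
  {e : V → A}

theorem IsTriangular.antisymm (H : IsTriangular K e) {a b : V} (hab : a ≠ b) (x y : A) :
    e a * x * e b * y * e a = 0 := by
  obtain ⟨h, hh⟩ := H.exists_height
  by_cases h1 : e a * x * e b = 0
  · simp [h1]
  by_cases h2 : e b * y * e a = 0
  · rw [show e a * x * e b * y * e a = e a * x * (e b * y * e a) by simp only [mul_assoc], h2,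
      mul_zero]
  rcases hh _ _ _ h1 with h3 | h3
  · exact absurd h3 hab
  rcases hh _ _ _ h2 with h4 | h4
  · exact absurd h4.symm hab
  omega

/-- Insert 1 = ∑ e b between x and y: by directedness only b = a survives. So compression to the
corner at a is multiplicative, which makes its kernel a right ideal and S(a) one-dimensional. -/
theorem IsTriangular.corner_mul (H : IsTriangular K e) (a : V) (x y : A) :
    e a * (x * y) * e a = e a * x * e a * y * e a := by
  classical
  have : x * y = ∑ b, x * e b * y := by
    rw [← Finset.sum_mul, ← Finset.mul_sum, H.sum_eq_one, mul_one]
  rw [this, Finset.mul_sum, Finset.sum_mul, Finset.sum_eq_single a]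
  · simp only [mul_assoc]
  · intro b _ hb
    rw [← H.antisymm hb.symm x y]
    simp only [mul_assoc]
  · simp

theorem op_mul_smul {X : Type*} [AddCommGroup X] [Module Aᵐᵒᵖ X] (x y : A) (m : X) :
    op (x * y) • m = op y • op x • m := by
  rw [op_mul, mul_smul]

theorem IsTriangular.sum_op_smul (H : IsTriangular K e) {X : Type*} [AddCommGroup X]
    [Module Aᵐᵒᵖ X] (m : X) : ∑ a, op (e a) • m = m := by
  rw [← Finset.sum_smul, ← Finset.op_sum, H.sum_eq_one, op_one, one_smul]

theorem IsTriangular.exists_op_smul_ne (H : IsTriangular K e) {X : Type*} [AddCommGroup X]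
    [Module Aᵐᵒᵖ X] {m : X} (hm : m ≠ 0) : ∃ a, op (e a) • m ≠ 0 := by
  by_contra! h
  exact hm (by rw [← H.sum_op_smul m]; exact Finset.sum_eq_zero fun a _ => h a)

theorem IsTriangular.isNoetherian (H : IsTriangular K e) : IsNoetherianRing Aᵐᵒᵖ := by
  have := H.finite
  have : Module.Finite K Aᵐᵒᵖ := Module.Finite.equiv (opLinearEquiv K (M := A))
  exact IsNoetherianRing.of_finite K Aᵐᵒᵖ

theorem IsTriangular.isArtinian (H : IsTriangular K e) : IsArtinianRing Aᵐᵒᵖ := by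
  have := H.finite
  have : Module.Finite K Aᵐᵒᵖ := Module.Finite.equiv (opLinearEquiv K (M := A))
  exact IsArtinianRing.of_finite K Aᵐᵒᵖ

end Basic

/-! ### The indecomposable projective modules -/

section Proj

variable {A : Type u} [Ring A] {X : Type*} [AddCommGroup X] [Module Aᵐᵒᵖ X]

/-- The generator of `e A`. -/
def projGen (e : A) : projModule e := ⟨e, Submodule.subset_span rfl⟩

theorem mul_projModule {e : A} (he : e * e = e) (x : projModule e) : e * x.1 = x.1 := by
  obtain ⟨x, hx⟩ := x
  obtain ⟨c, rfl⟩ := Submodule.mem_span_singleton.1 hx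
  change e * (e * c.unop) = e * c.unop
  rw [← mul_assoc, he]

theorem op_smul_projGen {e : A} (he : e * e = e) (x : projModule e) : op x.1 • projGen e = x :=
  Subtype.ext (mul_projModule he x)

/-- The homomorphism from `e A` that sends `e` to `m e`. -/
def projLift (e : A) (m : X) : projModule e →ₗ[Aᵐᵒᵖ] X where
  toFun x := op x.1 • m
  map_add' x y := by rw [← add_smul]; rfl
  map_smul' c x := by
    change op (x.1 * c.unop) • m = c • op x.1 • m
    rw [op_mul_smul]; rfl

theorem projLift_gen (e : A) (m : X) : projLift e m (projGen e) = op e • m := rfl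

theorem op_smul_map_projGen {e : A} (he : e * e = e) (f : projModule e →ₗ[Aᵐᵒᵖ] X) :
    op e • f (projGen e) = f (projGen e) := by
  rw [← map_smul, show op e • projGen e = projGen e from op_smul_projGen he (projGen e)]

theorem projHom_apply {e : A} (he : e * e = e) (f : projModule e →ₗ[Aᵐᵒᵖ] X) (x : projModule e) :
    f x = op x.1 • f (projGen e) := by
  rw [← map_smul, op_smul_projGen he]

theorem projHom_ext {e : A} (he : e * e = e) {f g : projModule e →ₗ[Aᵐᵒᵖ] X}
    (h : f (projGen e) = g (projGen e)) : f = g := by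
  ext x
  rw [projHom_apply he f, projHom_apply he g, h]

theorem projHom_ne_zero {e : A} (he : e * e = e) {f : projModule e →ₗ[Aᵐᵒᵖ] X} (h : f ≠ 0) :
    f (projGen e) ≠ 0 := fun h0 => h (projHom_ext he (by simpa using h0))

/-- The projection of `A` onto `e A`. -/
def projProj (e : A) : A →ₗ[Aᵐᵒᵖ] projModule e where
  toFun x := ⟨e * x, Submodule.mem_span_singleton.2 ⟨op x, rfl⟩⟩
  map_add' x y := Subtype.ext (mul_add e x y)
  map_smul' c x := Subtype.ext (mul_assoc e x c.unop).symm

/-- The module `e A` is a direct summand of `A`. -/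
def projRetract {e : A} (he : e * e = e) : Retract (projModule e) (ModuleCat.of Aᵐᵒᵖ A) where
  i := ModuleCat.ofHom (Submodule.subtype _)
  r := ModuleCat.ofHom (projProj e)
  retract := by
    ext x
    exact Subtype.ext (mul_projModule he x)

theorem projective_projModule {e : A} (he : e * e = e) : Projective (projModule e) := by
  refine ⟨fun {E X} f g hg => ?_⟩
  have hs := (ModuleCat.epi_iff_surjective g).1 hg
  obtain ⟨m, hm⟩ := hs (f.hom (projGen e))
  refine ⟨ModuleCat.ofHom (projLift e m), ?_⟩
  apply ModuleCat.hom_ext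
  refine projHom_ext he ?_
  change g.hom (op e • m) = _
  rw [map_smul, hm]
  exact op_smul_map_projGen he f.hom

instance (e : A) : Module.Finite Aᵐᵒᵖ (projModule e) :=
  inferInstanceAs (Module.Finite Aᵐᵒᵖ (Submodule.span Aᵐᵒᵖ ({e} : Set A)))

end Proj

/-! ### The simple modules -/

section Simple

variable {K : Type*} [Field K] {A : Type u} [Ring A] [Algebra K A] {V : Type*} [Fintype V]
  {e : V → A} {X : Type*} [AddCommGroup X] [Module Aᵐᵒᵖ X]

/-- The maximal right ideal belonging to the vertex `a`. -/
def IsTriangular.maxIdeal (H : IsTriangular K e) (a : V) : Submodule Aᵐᵒᵖ A where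
  carrier := {x | e a * x * e a = 0}
  add_mem' {x y} hx hy := by
    change e a * (x + y) * e a = 0
    rw [mul_add, add_mul, show e a * x * e a = 0 from hx, show e a * y * e a = 0 from hy, add_zero]
  zero_mem' := by simp
  smul_mem' c x hx := by
    change e a * (x * c.unop) * e a = 0
    rw [H.corner_mul, show e a * x * e a = 0 from hx]
    simp

theorem IsTriangular.mem_maxIdeal (H : IsTriangular K e) {a : V} {x : A} :
    x ∈ H.maxIdeal a ↔ e a * x * e a = 0 := Iff.rfl

/-- The simple right module at the vertex `a`. -/
abbrev IsTriangular.simple (H : IsTriangular K e) (a : V) : ModuleCat.{u} Aᵐᵒᵖ :=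
  ModuleCat.of Aᵐᵒᵖ (A ⧸ H.maxIdeal a)

/-- The generator of the simple module. -/
def IsTriangular.simpleGen (H : IsTriangular K e) (a : V) : H.simple a :=
  (H.maxIdeal a).mkQ (1 : A)

theorem IsTriangular.mkQ_eq (H : IsTriangular K e) (a : V) (x : A) :
    (H.maxIdeal a).mkQ x = op x • H.simpleGen a := by
  unfold IsTriangular.simpleGen
  rw [← map_smul]
  congr 1
  exact (one_mul x).symm

theorem IsTriangular.op_smul_simpleGen_eq_zero (H : IsTriangular K e) {a : V} {x : A} :
    op x • H.simpleGen a = 0 ↔ e a * x * e a = 0 := by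
  rw [← H.mkQ_eq]
  exact Submodule.Quotient.mk_eq_zero _

theorem IsTriangular.simpleGen_ne_zero (H : IsTriangular K e) (a : V) : H.simpleGen a ≠ 0 := by
  intro h
  have := H.op_smul_simpleGen_eq_zero (a := a) (x := 1)
  rw [op_one, one_smul, mul_one, H.idem] at this
  exact H.ne_zero a (this.1 h)

theorem IsTriangular.exists_smul_simpleGen (H : IsTriangular K e) {a : V} (s : H.simple a) :
    ∃ c : K, s = op (algebraMap K A c) • H.simpleGen a := by
  obtain ⟨x, rfl⟩ := (H.maxIdeal a).mkQ_surjective s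
  obtain ⟨c, hc⟩ := H.corner a x
  refine ⟨c, ?_⟩
  rw [← H.mkQ_eq]
  refine (Submodule.Quotient.eq _).2 ?_
  rw [H.mem_maxIdeal, mul_sub, sub_mul, hc, ← Algebra.commutes, mul_assoc, H.idem,
    Algebra.smul_def, sub_self]

theorem IsTriangular.op_smul_simpleGen_self (H : IsTriangular K e) (a : V) :
    op (e a) • H.simpleGen a = H.simpleGen a := by
  rw [← sub_eq_zero]
  have : op (e a) • H.simpleGen a - H.simpleGen a = op (e a - 1) • H.simpleGen a := by
    rw [MulOpposite.op_sub, sub_smul, op_one, one_smul]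
  rw [this, H.op_smul_simpleGen_eq_zero, mul_sub, sub_mul, mul_one, H.idem, H.idem, sub_self]

theorem IsTriangular.op_smul_simple_of_ne (H : IsTriangular K e) {a b : V} (hab : a ≠ b)
    (s : H.simple a) : op (e b) • s = 0 := by
  obtain ⟨c, rfl⟩ := H.exists_smul_simpleGen s
  rw [← op_mul_smul, Algebra.commutes, op_mul_smul,
    (H.op_smul_simpleGen_eq_zero (a := a)).2 (by rw [H.orth _ _ hab, zero_mul]), smul_zero]

theorem IsTriangular.simpleHom_ext (H : IsTriangular K e) {a : V}
    {f g : H.simple a →ₗ[Aᵐᵒᵖ] X} (h : f (H.simpleGen a) = g (H.simpleGen a)) : f = g := by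
  refine LinearMap.ext fun s => ?_
  obtain ⟨c, hc⟩ := H.exists_smul_simpleGen s
  rw [hc, map_smul, map_smul, h]

theorem IsTriangular.simpleHom_ne_zero (H : IsTriangular K e) {a : V}
    {f : H.simple a →ₗ[Aᵐᵒᵖ] X} (h : f ≠ 0) : f (H.simpleGen a) ≠ 0 :=
  fun h0 => h (H.simpleHom_ext (by simpa using h0))

theorem IsTriangular.simpleHom_injective (H : IsTriangular K e) {a : V}
    {f : H.simple a →ₗ[Aᵐᵒᵖ] X} (h : f ≠ 0) : Function.Injective f := by
  rw [injective_iff_map_eq_zero]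
  intro s hs
  obtain ⟨c, rfl⟩ := H.exists_smul_simpleGen s
  by_cases hc : c = 0
  · rw [hc, map_zero, op_zero, zero_smul]
  · exfalso
    apply H.simpleHom_ne_zero h
    rw [map_smul] at hs
    have h2 := congrArg (fun x => op (algebraMap K A c⁻¹) • x) hs
    simp only [← op_mul_smul, ← map_mul, mul_inv_cancel₀ hc, map_one, op_one, one_smul,
      smul_zero] at h2
    exact h2

/-- A homomorphism from the simple module at `a`, given by an element annihilated by the maximal
right ideal. -/
def IsTriangular.simpleLift (H : IsTriangular K e) (a : V) (m : X)
    (hm : ∀ x, e a * x * e a = 0 → op x • m = 0) : H.simple a →ₗ[Aᵐᵒᵖ] X :=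
  (H.maxIdeal a).liftQ
    { toFun := fun x => op x • m
      map_add' := fun x y => by rw [← add_smul]; rfl
      map_smul' := fun c x => by
        change op (x * c.unop) • m = c • op x • m
        rw [op_mul_smul]; rfl } (fun x hx => hm x hx)

theorem IsTriangular.simpleLift_gen (H : IsTriangular K e) (a : V) (m : X)
    (hm : ∀ x, e a * x * e a = 0 → op x • m = 0) :
    H.simpleLift a m hm (H.simpleGen a) = m := by
  change op (1 : A) • m = m
  rw [op_one, one_smul]

theorem IsTriangular.op_algebraMap_comm (c : K) (x : A) (m : X) :
    op x • op (algebraMap K A c) • m = op (algebraMap K A c) • op x • m := by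
  rw [← op_mul_smul, ← op_mul_smul, Algebra.commutes]

/-- Multiplication by a scalar on the simple module at `a`. -/
def IsTriangular.scale (H : IsTriangular K e) (a : V) (c : K) : H.simple a →ₗ[Aᵐᵒᵖ] H.simple a :=
  H.simpleLift a (op (algebraMap K A c) • H.simpleGen a) fun x hx => by
    rw [IsTriangular.op_algebraMap_comm, H.op_smul_simpleGen_eq_zero.2 hx, smul_zero]

theorem IsTriangular.scale_apply (H : IsTriangular K e) (a : V) (c : K) (s : H.simple a) :
    H.scale a c s = op (algebraMap K A c) • s := by
  obtain ⟨d, rfl⟩ := H.exists_smul_simpleGen s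
  rw [map_smul, IsTriangular.scale, H.simpleLift_gen, IsTriangular.op_algebraMap_comm]

/-- Every nonzero module contains a simple one. -/
theorem IsTriangular.exists_simple_hom_ne_zero (H : IsTriangular K e) [Nontrivial X] :
    ∃ (a : V) (f : H.simple a →ₗ[Aᵐᵒᵖ] X), f ≠ 0 := by
  classical
  obtain ⟨h, hh⟩ := H.exists_height
  obtain ⟨m, hm⟩ := exists_ne (0 : X)
  let T : Finset V := Finset.univ.filter fun a => ∃ x : X, op (e a) • x ≠ 0
  have hT : T.Nonempty := by
    obtain ⟨a, ha⟩ := H.exists_op_smul_ne hm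
    exact ⟨a, by simp only [T, Finset.mem_filter, Finset.mem_univ, true_and]; exact ⟨m, ha⟩⟩
  -- Multiplication only moves upwards, so at a highest vertex of the support the element x e_a is
  -- killed by the maximal right ideal at a.
  obtain ⟨a, haT, hmax⟩ := T.exists_max_image h hT
  obtain ⟨x, hx⟩ := (Finset.mem_filter.1 haT).2
  have key : ∀ y, e a * y * e a = 0 → op y • op (e a) • x = 0 := fun y hy => by
    rw [← H.sum_op_smul (op y • op (e a) • x)]
    refine Finset.sum_eq_zero fun b _ => ?_
    by_contra hne
    have hb : b ∈ T := Finset.mem_filter.2 ⟨Finset.mem_univ _, _, hne⟩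
    rw [← op_mul_smul, ← op_mul_smul, ← mul_assoc] at hne
    have h1 : e a * y * e b ≠ 0 := fun h0 => hne (by rw [h0, op_zero, zero_smul])
    rcases hh _ _ _ h1 with rfl | h2
    · exact h1 hy
    · exact absurd (hmax b hb) (by omega)
  refine ⟨a, H.simpleLift a (op (e a) • x) key, fun h0 => hx ?_⟩
  rw [← H.simpleLift_gen a (op (e a) • x) key, h0]
  rfl

/-- Every nonzero finitely generated module has a simple quotient. -/
theorem IsTriangular.exists_hom_simple_ne_zero (H : IsTriangular K e) [Module.Finite Aᵐᵒᵖ X]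
    [Nontrivial X] : ∃ (a : V) (f : X →ₗ[Aᵐᵒᵖ] H.simple a), f ≠ 0 := by
  obtain ⟨N, hN, -⟩ := (eq_top_or_exists_le_coatom (⊥ : Submodule Aᵐᵒᵖ X)).resolve_left bot_ne_top
  have hs : IsSimpleModule Aᵐᵒᵖ (X ⧸ N) := isSimpleModule_iff_isCoatom.2 hN
  have := IsSimpleModule.nontrivial Aᵐᵒᵖ (X ⧸ N)
  obtain ⟨a, f, hf⟩ := H.exists_simple_hom_ne_zero (X := X ⧸ N)
  have hb : Function.Bijective f :=
    ⟨H.simpleHom_injective hf, LinearMap.surjective_of_ne_zero hf⟩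
  let E := LinearEquiv.ofBijective f hb
  refine ⟨a, E.symm.toLinearMap ∘ₗ N.mkQ, fun h0 => H.simpleGen_ne_zero a ?_⟩
  obtain ⟨x, hx⟩ := N.mkQ_surjective (E (H.simpleGen a))
  have := LinearMap.congr_fun h0 x
  simpa [hx] using! this

end Simple

end QuiverAlg

namespace QuiverAlg

open MulOpposite

/-! ### The indecomposable injective modules -/

section Inj

variable {K : Type u} [Field K] {A : Type (max u v)} [Ring A] [Algebra K A]
  {X : Type*} [AddCommGroup X] [Module Aᵐᵒᵖ X]

/-- Evaluation at the generator of `A e`. -/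
def injEval (e : A) : injModule.{u, v} K e →+ K where
  toFun f := (show Submodule.span A ({e} : Set A) →ₗ[K] K from f) ⟨e, Submodule.subset_span rfl⟩
  map_zero' := rfl
  map_add' _ _ := rfl

/-- The value of an element of `D (A e)` at `y e`. -/
theorem injModule_apply {e : A} (he : e * e = e) (f : injModule.{u, v} K e)
    (y : Submodule.span A ({e} : Set A)) :
    (show Submodule.span A ({e} : Set A) →ₗ[K] K from f) y = injEval e (op y.1 • f) := by
  change _ = (show Submodule.span A ({e} : Set A) →ₗ[K] K from f) (y.1 • _)
  congr 1
  obtain ⟨y, hy⟩ := y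
  obtain ⟨c, rfl⟩ := Submodule.mem_span_singleton.1 hy
  refine Subtype.ext ?_
  change c * e = c * e * e
  rw [mul_assoc, he]

theorem injModule_ext {e : A} (he : e * e = e) {f g : injModule.{u, v} K e}
    (h : ∀ x : A, injEval e (op x • f) = injEval e (op x • g)) : f = g :=
  LinearMap.ext (M := Submodule.span A ({e} : Set A)) fun y => by
    have h1 := injModule_apply he f y
    have h2 := injModule_apply he g y
    rw [h] at h1
    exact h1.trans h2.symm

theorem injEval_op_smul {e : A} (he : e * e = e) (f : injModule.{u, v} K e) :
    injEval e (op e • f) = injEval e f := by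
  change (show Submodule.span A ({e} : Set A) →ₗ[K] K from f) (e • _) =
    (show Submodule.span A ({e} : Set A) →ₗ[K] K from f) _
  congr 1
  exact Subtype.ext he

theorem injEval_algebraMap (e : A) (c : K) (f : injModule.{u, v} K e) :
    injEval e (op (algebraMap K A c) • f) = c * injEval e f := by
  change (show Submodule.span A ({e} : Set A) →ₗ[K] K from f) (algebraMap K A c • _) =
    c • (show Submodule.span A ({e} : Set A) →ₗ[K] K from f) _
  rw [← map_smul, algebraMap_smul]

/-- Homomorphisms X → D(A e) correspond to functionals on X e, through evaluation at the generator
of A e. -/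
theorem injHom_ext {e : A} (he : e * e = e) {f g : X →ₗ[Aᵐᵒᵖ] injModule.{u, v} K e}
    (h : ∀ x, injEval e (f x) = injEval e (g x)) : f = g :=
  LinearMap.ext fun x => injModule_ext he fun c => by rw [← map_smul, ← map_smul, h]

/-- The homomorphism to `D (A e)` given by a linear functional. -/
def injLift (e : A) (l : X →+ K) (hl : ∀ (c : K) x, l (op (algebraMap K A c) • x) = c * l x) :
    X →ₗ[Aᵐᵒᵖ] injModule.{u, v} K e where
  toFun x := (show Submodule.span A ({e} : Set A) →ₗ[K] K from
    { toFun := fun y => l (op y.1 • x)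
      map_add' := fun y z => by
        rw [← map_add, ← add_smul]; rfl
      map_smul' := fun c y => by
        rw [RingHom.id_apply, smul_eq_mul, ← hl, ← op_mul_smul, ← Algebra.commutes,
          ← Algebra.smul_def]; rfl })
  map_add' x y := LinearMap.ext (M := Submodule.span A ({e} : Set A)) fun z => by
    change l (op z.1 • (x + y)) = l (op z.1 • x) + l (op z.1 • y)
    rw [smul_add, map_add]
  map_smul' c x := LinearMap.ext (M := Submodule.span A ({e} : Set A)) fun z => by
    change l (op z.1 • c • x) = l (op (c.unop * z.1) • x)
    rw [op_mul_smul]; rfl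

/-- A homomorphism to D(A e) amounts to a functional, and functionals extend because a submodule is
a direct summand over `K`; `injLift` turns the extension back into a homomorphism. -/
theorem injective_injModule {e : A} (he : e * e = e) : Injective (injModule.{u, v} K e) := by
  refine ⟨fun {X Y} g f hf => ?_⟩
  have hi := (ModuleCat.mono_iff_injective f).1 hf
  let : Module K X := Module.compHom X (algebraMap K Aᵐᵒᵖ)
  let : Module K Y := Module.compHom Y (algebraMap K Aᵐᵒᵖ)
  let l : X →ₗ[K] K :=
    { toFun := fun x => injEval e (g.hom x)
      map_add' := fun x y => by rw [map_add, map_add]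
      map_smul' := fun c x => by
        change injEval e (g.hom (op (algebraMap K A c) • x)) = c * _
        rw [map_smul, injEval_algebraMap] }
  let f' : X →ₗ[K] Y :=
    { toFun := f.hom
      map_add' := map_add _
      map_smul' := fun c x => by
        change f.hom (op (algebraMap K A c) • x) = op (algebraMap K A c) • _
        rw [map_smul] }
  obtain ⟨r, hr⟩ := f'.exists_leftInverse_of_injective (LinearMap.ker_eq_bot.2 hi)
  have hr' : ∀ x, r (f.hom x) = x := fun x => LinearMap.congr_fun hr x
  refine ⟨ModuleCat.ofHom (injLift e ((l ∘ₗ r).toAddMonoidHom) fun c y => ?_), ?_⟩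
  · exact map_smul (l ∘ₗ r) c y
  · apply ModuleCat.hom_ext
    refine injHom_ext he fun x => ?_
    change injEval e (g.hom (r (op e • f.hom x))) = _
    rw [← map_smul, hr', map_smul, injEval_op_smul he]

instance [Module.Finite K A] (e : A) : Module.Finite Aᵐᵒᵖ (injModule.{u, v} K e) := by
  let J := Submodule.span A ({e} : Set A)
  have : Module.Finite K J :=
    Module.Finite.of_injective (J.subtype.restrictScalars K) Subtype.val_injective
  obtain ⟨s, hs⟩ := Module.Finite.fg_top (R := K) (M := J →ₗ[K] K)
  let t : Finset (injModule.{u, v} K e) := s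
  let N : Submodule Aᵐᵒᵖ (injModule.{u, v} K e) := Submodule.span Aᵐᵒᵖ t
  let N' : Submodule K (J →ₗ[K] K) :=
    { carrier := (N : Set (injModule.{u, v} K e))
      add_mem' := N.add_mem
      zero_mem' := N.zero_mem
      smul_mem' := fun c x hx => by
        have h := N.smul_mem (op (algebraMap K A c)) hx
        refine (congrArg (· ∈ (N : Set (injModule.{u, v} K e))) ?_).mp h
        refine LinearMap.ext (M := J) fun y => ?_
        change (x : J →ₗ[K] K) (algebraMap K A c • y) = c • x y
        rw [algebraMap_smul, map_smul] }
  have h : Submodule.span K s ≤ N' :=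
    Submodule.span_le.2 (Submodule.subset_span (R := Aᵐᵒᵖ) (s := (t : Set (injModule.{u, v} K e))))
  rw [hs] at h
  exact ⟨t, top_unique fun f _ => h (Submodule.mem_top (x := (show J →ₗ[K] K from f)))⟩

variable {V : Type*} [Fintype V] {e : V → A}

theorem IsTriangular.simple_injModule_of_ne (H : IsTriangular K e) {a b : V} (hab : a ≠ b)
    (f : H.simple a →ₗ[Aᵐᵒᵖ] injModule.{u, v} K (e b)) : f = 0 := by
  refine injHom_ext (H.idem b) fun x => ?_
  rw [← injEval_op_smul (H.idem b), ← map_smul, H.op_smul_simple_of_ne hab, map_zero]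
  rfl

theorem nontrivial_injModule (H : IsTriangular K e) (a : V) :
    Nontrivial (injModule.{u, v} K (e a)) := by
  let J := Submodule.span A ({e a} : Set A)
  have : Nontrivial J := ⟨⟨e a, Submodule.subset_span rfl⟩, 0, fun h =>
    H.ne_zero a (congrArg Subtype.val h)⟩
  exact inferInstanceAs (Nontrivial (Module.Dual K J))

theorem IsTriangular.exists_simple_injModule (H : IsTriangular K e) (a : V) :
    ∃ f : H.simple a →ₗ[Aᵐᵒᵖ] injModule.{u, v} K (e a), f ≠ 0 := by
  have := nontrivial_injModule H a
  obtain ⟨b, f, hf⟩ := H.exists_simple_hom_ne_zero (X := injModule.{u, v} K (e a))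
  by_cases hab : b = a
  · subst hab; exact ⟨f, hf⟩
  · exact absurd (H.simple_injModule_of_ne hab f) hf

/-- The inclusion of the simple module at `a` as the socle of `I(a)`. -/
noncomputable def IsTriangular.socle (H : IsTriangular K e) (a : V) :
    H.simple a →ₗ[Aᵐᵒᵖ] injModule.{u, v} K (e a) := (H.exists_simple_injModule a).choose

theorem IsTriangular.socle_ne_zero (H : IsTriangular K e) (a : V) : H.socle a ≠ 0 :=
  (H.exists_simple_injModule a).choose_spec

theorem IsTriangular.injEval_simple (H : IsTriangular K e) {a : V}
    (f : H.simple a →ₗ[Aᵐᵒᵖ] injModule.{u, v} K (e a)) (h : injEval _ (f (H.simpleGen a)) = 0) :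
    f = 0 := by
  refine injHom_ext (H.idem a) fun x => ?_
  obtain ⟨c, rfl⟩ := H.exists_smul_simpleGen x
  rw [map_smul, injEval_algebraMap, h, mul_zero]
  rfl

/-- Hom(S(a), I(a)) is at most one-dimensional, since S(a) is a line and the value of the functional
on its generator decides everything. This makes the socle of I(a) simple. -/
theorem IsTriangular.simple_injModule_unique (H : IsTriangular K e) {a : V}
    {f : H.simple a →ₗ[Aᵐᵒᵖ] injModule.{u, v} K (e a)} (hf : f ≠ 0)
    (g : H.simple a →ₗ[Aᵐᵒᵖ] injModule.{u, v} K (e a)) : ∃ c : K, g = f ∘ₗ H.scale a c := by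
  have h0 : injEval _ (f (H.simpleGen a)) ≠ 0 := fun h => hf (H.injEval_simple f h)
  refine ⟨injEval _ (g (H.simpleGen a)) / injEval _ (f (H.simpleGen a)), ?_⟩
  refine sub_eq_zero.1 (H.injEval_simple _ ?_)
  rw [LinearMap.sub_apply, map_sub, LinearMap.comp_apply, H.scale_apply, map_smul,
    injEval_algebraMap, div_mul_cancel₀ _ h0, sub_self]

/-- `I(a)` is an essential extension of its socle. -/
theorem IsTriangular.injective_of_comp_socle (H : IsTriangular K e) {a : V}
    {g : injModule.{u, v} K (e a) →ₗ[Aᵐᵒᵖ] X} (hg : g ∘ₗ H.socle a ≠ 0) :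
    Function.Injective g := by
  rw [← LinearMap.ker_eq_bot]
  by_contra hk
  have : Nontrivial (LinearMap.ker g) := Submodule.nontrivial_iff_ne_bot.2 hk
  obtain ⟨b, f, hf⟩ := H.exists_simple_hom_ne_zero (X := LinearMap.ker g)
  have hf' : (LinearMap.ker g).subtype ∘ₗ f ≠ 0 := fun h0 => hf <| LinearMap.ext fun x =>
    Subtype.ext (LinearMap.congr_fun h0 x)
  by_cases hab : b = a
  · subst hab
    obtain ⟨c, hc⟩ := H.simple_injModule_unique hf' (H.socle b)
    refine hg (LinearMap.ext fun x => ?_)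
    rw [hc]
    exact (f (H.scale b c x)).2
  · exact hf' (H.simple_injModule_of_ne hab _)

/-- A nonzero homomorphism `I(a) → I(b)` comes from a nonzero element of `e b * A * e a`. -/
theorem IsTriangular.exists_of_injHom_ne_zero (H : IsTriangular K e) {a b : V}
    {f : injModule.{u, v} K (e a) →ₗ[Aᵐᵒᵖ] injModule.{u, v} K (e b)} (hf : f ≠ 0) :
    ∃ x, e b * x * e a ≠ 0 := by
  by_contra! h
  refine hf (injHom_ext (H.idem b) fun x => ?_)
  rw [← injEval_op_smul (H.idem b), ← map_smul]
  have : op (e b) • x = 0 := injModule_ext (H.idem a) fun c => by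
    rw [← op_mul_smul, ← injEval_op_smul (H.idem a), ← op_mul_smul, h, op_zero, zero_smul,
      smul_zero]
  rw [this, map_zero]
  rfl

end Inj

end QuiverAlg

namespace QuiverAlg

open MulOpposite

/-! ### Composition series and tops of projective modules. -/

section Filtration

variable {K : Type*} [Field K] {A : Type u} [Ring A] [Algebra K A] {V : Type*} [Fintype V]
  {e : V → A} {X : Type*} [AddCommGroup X] [Module Aᵐᵒᵖ X]

/-- Induction along a composition series. -/
theorem IsTriangular.composition_induction (H : IsTriangular K e) [Module.Finite Aᵐᵒᵖ X]
    (p : Submodule Aᵐᵒᵖ X → Prop) (h0 : p ⊥)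
    (hs : ∀ (N N' : Submodule Aᵐᵒᵖ X) (hle : N ≤ N') (a : V) (g : N' →ₗ[Aᵐᵒᵖ] H.simple a),
      Function.Surjective g → Function.Exact (Submodule.inclusion hle) g →
      (∃ x : X, op (e a) • x ≠ 0) → p N → p N') : p ⊤ := by
  have := H.isNoetherian
  -- Take a largest submodule with the property; if it were proper, a simple submodule of the
  -- quotient would enlarge it.
  obtain ⟨N, hN, hmax⟩ := WellFounded.has_min (wellFounded_gt (α := Submodule Aᵐᵒᵖ X)) {N | p N}
    ⟨⊥, h0⟩
  by_cases hT : N = ⊤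
  · exact hT ▸ hN
  exfalso
  have : Nontrivial (X ⧸ N) := Submodule.Quotient.nontrivial_iff.2 hT
  obtain ⟨a, f, hf⟩ := H.exists_simple_hom_ne_zero (X := X ⧸ N)
  have hinj := H.simpleHom_injective hf
  let E := LinearEquiv.ofInjective f hinj
  let N' := (LinearMap.range f).comap N.mkQ
  have hle : N ≤ N' := fun x hx => by
    refine ⟨0, ?_⟩
    rw [map_zero]
    exact ((Submodule.Quotient.mk_eq_zero N).2 hx).symm
  let q : N' →ₗ[Aᵐᵒᵖ] LinearMap.range f := (N.mkQ.restrict (p := N') fun x hx => hx)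
  have hq : ∀ x : N', (q x).1 = N.mkQ x.1 := fun x => rfl
  have hqs : Function.Surjective q := fun ⟨y, hy⟩ => by
    obtain ⟨x, rfl⟩ := N.mkQ_surjective y
    exact ⟨⟨x, hy⟩, rfl⟩
  -- This lift of the generator shows both that the vertex a occurs in X and that N' is strictly
  -- larger than N.
  obtain ⟨x, hx⟩ := N.mkQ_surjective (f (H.simpleGen a))
  have hx' : op (e a) • x ∉ N := fun h => by
    have h2 := (Submodule.Quotient.mk_eq_zero N).2 h
    change N.mkQ (op (e a) • x) = 0 at h2
    rw [map_smul, hx, ← map_smul, H.op_smul_simpleGen_self] at h2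
    exact H.simpleHom_ne_zero hf h2
  refine hmax N' (hs N N' hle a (E.symm.toLinearMap ∘ₗ q) (E.symm.surjective.comp hqs) ?_
    ⟨x, fun h => hx' (h ▸ N.zero_mem)⟩ hN) ?_
  · intro y
    rw [LinearMap.comp_apply, LinearEquiv.coe_coe, map_eq_zero_iff _ E.symm.injective]
    constructor
    · intro h
      have : N.mkQ y.1 = 0 := by rw [← hq, h]; rfl
      exact ⟨⟨y.1, (Submodule.Quotient.mk_eq_zero N).1 this⟩, rfl⟩
    · rintro ⟨z, rfl⟩
      exact Subtype.ext ((Submodule.Quotient.mk_eq_zero N).2 z.2)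
  · refine lt_of_le_of_ne hle fun h => hx' ?_
    rw [h]
    refine N'.smul_mem _ ?_
    exact ⟨H.simpleGen a, hx.symm⟩

theorem IsTriangular.projHom_simple_of_ne (H : IsTriangular K e) {a b : V} (hab : a ≠ b)
    (f : projModule (e b) →ₗ[Aᵐᵒᵖ] H.simple a) : f = 0 := by
  refine projHom_ext (H.idem b) ?_
  rw [← op_smul_map_projGen (H.idem b) f, H.op_smul_simple_of_ne hab]
  rfl

theorem IsTriangular.projHom_simple_unique (H : IsTriangular K e) {a : V}
    {f : projModule (e a) →ₗ[Aᵐᵒᵖ] H.simple a} (hf : f ≠ 0)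
    (g : projModule (e a) →ₗ[Aᵐᵒᵖ] H.simple a) : ∃ c : K, g = H.scale a c ∘ₗ f := by
  obtain ⟨c, hc⟩ := H.exists_smul_simpleGen (f (projGen (e a)))
  obtain ⟨d, hd⟩ := H.exists_smul_simpleGen (g (projGen (e a)))
  have h0 : c ≠ 0 := fun h => projHom_ne_zero (H.idem a) hf (by rw [hc, h]; simp)
  refine ⟨d / c, projHom_ext (H.idem a) ?_⟩
  rw [LinearMap.comp_apply, H.scale_apply, hc, hd, ← op_mul_smul, ← map_mul, mul_div_cancel₀ _ h0]

/-- The top of `P(a)`. -/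
noncomputable def IsTriangular.top (H : IsTriangular K e) (a : V) :
    projModule (e a) →ₗ[Aᵐᵒᵖ] H.simple a := projLift (e a) (H.simpleGen a)

theorem IsTriangular.top_gen (H : IsTriangular K e) (a : V) :
    H.top a (projGen (e a)) = H.simpleGen a := by
  rw [IsTriangular.top, projLift_gen, H.op_smul_simpleGen_self]

theorem IsTriangular.top_surjective (H : IsTriangular K e) (a : V) :
    Function.Surjective (H.top a) := fun s => by
  obtain ⟨c, rfl⟩ := H.exists_smul_simpleGen s
  exact ⟨op (algebraMap K A c) • projGen (e a), by rw [map_smul, H.top_gen]⟩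

theorem IsTriangular.top_ne_zero (H : IsTriangular K e) (a : V) : H.top a ≠ 0 := fun h =>
  H.simpleGen_ne_zero a (by rw [← H.top_gen, h]; rfl)

/-- The composition factors of the radical of `P(a)` are above `a`. -/
theorem IsTriangular.height_lt_of_ker_top (H : IsTriangular K e) {l : V → ℕ} (hl : IsHeight e l)
    {a b : V} {x : LinearMap.ker (H.top a)} (hx : op (e b) • x ≠ 0) : l a < l b := by
  have h1 := mul_projModule (H.idem a) x.1
  have h2 : e a * x.1.1 * e b ≠ 0 := fun h => hx (Subtype.ext (Subtype.ext (by
    rw [h1] at h; exact h)))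
  rcases hl _ _ _ h2 with rfl | h
  · exfalso
    have h3 : op x.1.1 • H.simpleGen a = 0 := x.2
    exact h2 (H.op_smul_simpleGen_eq_zero.1 h3)
  · exact h

end Filtration

/-! ### Projective covers and injective envelopes -/

section Cover

variable {K : Type u} [Field K] {A : Type (max u v)} [Ring A] [Algebra K A] {V : Type*} [Fintype V]
  {e : V → A} {X : Type (max u v)} [AddCommGroup X] [Module Aᵐᵒᵖ X]

/-- N contains some S(a), and the embedding of S(a) into I(a) extends to X by injectivity. -/
theorem IsTriangular.exists_injHom_ne_zero (H : IsTriangular K e) (N : Submodule Aᵐᵒᵖ X)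
    (hN : N ≠ ⊥) : ∃ (a : V) (f : H.simple a →ₗ[Aᵐᵒᵖ] X)
      (g : X →ₗ[Aᵐᵒᵖ] injModule.{u, v} K (e a)), (∀ s, f s ∈ N) ∧ g ∘ₗ f ≠ 0 := by
  have : Nontrivial N := Submodule.nontrivial_iff_ne_bot.2 hN
  obtain ⟨a, f, hf⟩ := H.exists_simple_hom_ne_zero (X := N)
  have hinj : Function.Injective (N.subtype ∘ₗ f) :=
    Subtype.val_injective.comp (H.simpleHom_injective hf)
  have hm : Mono (ModuleCat.ofHom (N.subtype ∘ₗ f)) := (ModuleCat.mono_iff_injective _).2 hinj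
  have hI : Injective (injModule.{u, v} K (e a)) := injective_injModule (H.idem a)
  obtain ⟨g, hg⟩ := hI.factors (ModuleCat.ofHom (H.socle a)) (ModuleCat.ofHom (N.subtype ∘ₗ f))
  refine ⟨a, N.subtype ∘ₗ f, g.hom, fun s => (f s).2, ?_⟩
  have h1 : g.hom ∘ₗ (N.subtype ∘ₗ f) = H.socle a := congrArg ModuleCat.Hom.hom hg
  rw [h1]
  exact H.socle_ne_zero a

/-- Among the finite intersections of kernels of maps to the I(a) there is a minimal one; if it were
nonzero, a further map would cut it down. -/
theorem IsTriangular.exists_injHom_family (H : IsTriangular K e) [Module.Finite Aᵐᵒᵖ X] :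
    ∃ (ι : Type) (_ : Fintype ι) (k : ι → V)
      (F : (t : ι) → X →ₗ[Aᵐᵒᵖ] injModule.{u, v} K (e (k t))), ⨅ t, LinearMap.ker (F t) = ⊥ := by
  have := H.isArtinian
  obtain ⟨N, ⟨ι, hι, k, F, rfl⟩, hmin⟩ := WellFounded.has_min
    (wellFounded_lt (α := Submodule Aᵐᵒᵖ X))
    {N | ∃ (ι : Type) (_ : Fintype ι) (k : ι → V)
      (F : (t : ι) → X →ₗ[Aᵐᵒᵖ] injModule.{u, v} K (e (k t))), N = ⨅ t, LinearMap.ker (F t)}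
    ⟨_, Empty, inferInstance, fun t => t.elim, fun t => t.elim, rfl⟩
  refine ⟨ι, hι, k, F, ?_⟩
  by_contra hN
  obtain ⟨a, f, g, hf, hg⟩ := H.exists_injHom_ne_zero _ hN
  let k' : Option ι → V := fun o => o.elim a k
  let F' : (o : Option ι) → X →ₗ[Aᵐᵒᵖ] injModule.{u, v} K (e (k' o)) := fun o =>
    match o with
    | none => g
    | some t => F t
  refine hmin (⨅ t, LinearMap.ker (F' t)) ⟨Option ι, inferInstance, k', F', rfl⟩ ?_
  refine lt_of_le_of_ne (le_iInf fun t => iInf_le (fun o => LinearMap.ker (F' o)) (some t))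
    fun h => hg (LinearMap.ext fun s => ?_)
  have h1 := hf s
  rw [← h] at h1
  exact (iInf_le (fun o => LinearMap.ker (F' o)) none) h1

/-- A finitely generated module embeds into a finite product of modules `I(k t)` with the
same socle. -/
theorem IsTriangular.exists_envelope (H : IsTriangular K e) [Module.Finite Aᵐᵒᵖ X] :
    ∃ (ι : Type) (_ : Fintype ι) (k : ι → V)
      (F : X →ₗ[Aᵐᵒᵖ] ((t : ι) → injModule.{u, v} K (e (k t)))),
      Function.Injective F ∧ (∀ t, ∃ f : H.simple (k t) →ₗ[Aᵐᵒᵖ] X, f ≠ 0) ∧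
      ∀ (a : V) (g : H.simple a →ₗ[Aᵐᵒᵖ] ((t : ι) → injModule.{u, v} K (e (k t)))),
        ∃ f : H.simple a →ₗ[Aᵐᵒᵖ] X, g = F ∘ₗ f := by
  classical
  have hex : ∃ n : ℕ, ∃ (ι : Type) (_ : Fintype ι) (k : ι → V)
      (F : (t : ι) → X →ₗ[Aᵐᵒᵖ] injModule.{u, v} K (e (k t))),
      Fintype.card ι = n ∧ ⨅ t, LinearMap.ker (F t) = ⊥ := by
    obtain ⟨ι, hι, k, F, h⟩ := H.exists_injHom_family (X := X)
    exact ⟨_, ι, hι, k, F, rfl, h⟩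
  -- A family of least cardinality gives an envelope with no superfluous summand: dropping t leaves
  -- a simple in the common kernel of the others, and F t must embed it into the socle of I(k t).
  obtain ⟨ι, hι, k, F, hcard, hF⟩ := Nat.find_spec hex
  have hmin : ∀ t, ∃ f : H.simple (k t) →ₗ[Aᵐᵒᵖ] X, (∀ s, s ≠ t → F s ∘ₗ f = 0) ∧
      F t ∘ₗ f ≠ 0 := by
    intro t
    have hlt : Fintype.card {s // s ≠ t} < Nat.find hex := by
      rw [← hcard]
      exact Fintype.card_subtype_lt (x := t) (by simp)
    have hne : ⨅ s : {s // s ≠ t}, LinearMap.ker (F s.1) ≠ ⊥ := fun h0 =>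
      Nat.find_min hex hlt ⟨{s // s ≠ t}, inferInstance, fun s => k s.1, fun s => F s.1, rfl, h0⟩
    obtain ⟨a, f, g, hf, hg⟩ := H.exists_injHom_ne_zero _ hne
    have hf' : ∀ s, s ≠ t → F s ∘ₗ f = 0 := fun s hs => LinearMap.ext fun x =>
      (iInf_le (fun s : {s // s ≠ t} => LinearMap.ker (F s.1)) ⟨s, hs⟩) (hf x)
    have hft : F t ∘ₗ f ≠ 0 := fun h0 => hg <| by
      have : f = 0 := LinearMap.ext fun x => by
        have h1 : f x ∈ ⨅ t, LinearMap.ker (F t) := by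
          rw [Submodule.mem_iInf]
          intro s
          by_cases hs : s = t
          · subst hs; exact LinearMap.congr_fun h0 x
          · exact LinearMap.congr_fun (hf' s hs) x
        rw [hF] at h1
        exact h1
      rw [this, LinearMap.comp_zero]
    have hat : a = k t := by
      by_contra hat
      exact hft (H.simple_injModule_of_ne hat _)
    subst hat
    exact ⟨f, hf', hft⟩
  refine ⟨ι, hι, k, LinearMap.pi F, ?_, ?_, ?_⟩
  · rw [← LinearMap.ker_eq_bot, LinearMap.ker_pi, hF]
  · intro t
    obtain ⟨f, -, hf⟩ := hmin t
    exact ⟨f, fun h => hf (by rw [h, LinearMap.comp_zero])⟩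
  · intro a g
    -- Each component of g lifts separately, as a scalar multiple of the simple found for t; the
    -- lifts do not interfere and can be added.
    have hu : ∀ t, ∃ f : H.simple a →ₗ[Aᵐᵒᵖ] X, (∀ s, s ≠ t → F s ∘ₗ f = 0) ∧
        F t ∘ₗ f = LinearMap.proj t ∘ₗ g := by
      intro t
      by_cases hat : a = k t
      · subst hat
        obtain ⟨f, hf1, hf2⟩ := hmin t
        obtain ⟨c, hc⟩ := H.simple_injModule_unique hf2 (LinearMap.proj t ∘ₗ g)
        exact ⟨f ∘ₗ H.scale _ c, fun s hs => by
          rw [← LinearMap.comp_assoc, hf1 s hs, LinearMap.zero_comp], hc.symm⟩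
      · exact ⟨0, fun s _ => LinearMap.comp_zero _, by
          rw [LinearMap.comp_zero, H.simple_injModule_of_ne hat (LinearMap.proj t ∘ₗ g)]⟩
    choose f hf1 hf2 using hu
    refine ⟨∑ t, f t, LinearMap.ext fun x => funext fun s => ?_⟩
    have h1 : (∑ t, F s ∘ₗ f t) x = g x s := by
      rw [Finset.sum_eq_single s, hf2]
      · rfl
      · exact fun t _ ht => hf1 t s ht.symm
      · simp
    rw [← h1]
    simp

theorem IsTriangular.exists_projHom_family (H : IsTriangular K e) [Module.Finite Aᵐᵒᵖ X] :
    ∃ (ι : Type) (_ : Fintype ι) (k : ι → V)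
      (F : (t : ι) → projModule (e (k t)) →ₗ[Aᵐᵒᵖ] X), ⨆ t, LinearMap.range (F t) = ⊤ := by
  have := H.isNoetherian
  obtain ⟨N, ⟨ι, hι, k, F, rfl⟩, hmax⟩ := WellFounded.has_min
    (wellFounded_gt (α := Submodule Aᵐᵒᵖ X))
    {N | ∃ (ι : Type) (_ : Fintype ι) (k : ι → V)
      (F : (t : ι) → projModule (e (k t)) →ₗ[Aᵐᵒᵖ] X), N = ⨆ t, LinearMap.range (F t)}
    ⟨_, Empty, inferInstance, fun t => t.elim, fun t => t.elim, rfl⟩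
  refine ⟨ι, hι, k, F, ?_⟩
  by_contra hN
  obtain ⟨x, hx⟩ := SetLike.exists_not_mem_of_ne_top _ hN rfl
  obtain ⟨a, ha⟩ : ∃ a, op (e a) • x ∉ ⨆ t, LinearMap.range (F t) := by
    by_contra! h
    exact hx (by rw [← H.sum_op_smul x]; exact Submodule.sum_mem _ fun a _ => h a)
  let k' : Option ι → V := fun o => o.elim a k
  let F' : (o : Option ι) → projModule (e (k' o)) →ₗ[Aᵐᵒᵖ] X := fun o =>
    match o with
    | none => projLift (e a) x
    | some t => F t
  refine hmax (⨆ t, LinearMap.range (F' t)) ⟨Option ι, inferInstance, k', F', rfl⟩ ?_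
  refine lt_of_le_of_ne (iSup_le fun t => le_iSup (fun o => LinearMap.range (F' o)) (some t))
    fun h => ha ?_
  rw [h]
  exact (le_iSup (fun o => LinearMap.range (F' o)) none) ⟨projGen (e a), rfl⟩

/-- A finitely generated module is a quotient of a finite product of modules `P(k t)` with the
same top. -/
theorem IsTriangular.exists_cover (H : IsTriangular K e) [Module.Finite Aᵐᵒᵖ X] :
    ∃ (ι : Type) (_ : Fintype ι) (k : ι → V)
      (F : ((t : ι) → projModule (e (k t))) →ₗ[Aᵐᵒᵖ] X),
      Function.Surjective F ∧ (∀ t, ∃ f : X →ₗ[Aᵐᵒᵖ] H.simple (k t), f ≠ 0) ∧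
      ∀ (a : V) (g : ((t : ι) → projModule (e (k t))) →ₗ[Aᵐᵒᵖ] H.simple a),
        ∃ f : X →ₗ[Aᵐᵒᵖ] H.simple a, g = f ∘ₗ F := by
  classical
  have hex : ∃ n : ℕ, ∃ (ι : Type) (_ : Fintype ι) (k : ι → V)
      (F : (t : ι) → projModule (e (k t)) →ₗ[Aᵐᵒᵖ] X),
      Fintype.card ι = n ∧ ⨆ t, LinearMap.range (F t) = ⊤ := by
    obtain ⟨ι, hι, k, F, h⟩ := H.exists_projHom_family (X := X)
    exact ⟨_, ι, hι, k, F, rfl, h⟩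
  -- Dually, least cardinality makes every summand necessary: without t the images do not span, and
  -- a simple quotient of the cokernel is hit by F t alone.
  obtain ⟨ι, hι, k, F, hcard, hF⟩ := Nat.find_spec hex
  have hmin : ∀ t, ∃ f : X →ₗ[Aᵐᵒᵖ] H.simple (k t), (∀ s, s ≠ t → f ∘ₗ F s = 0) ∧
      f ∘ₗ F t ≠ 0 := by
    intro t
    have hlt : Fintype.card {s // s ≠ t} < Nat.find hex := by
      rw [← hcard]
      exact Fintype.card_subtype_lt (x := t) (by simp)
    have hne : ⨆ s : {s // s ≠ t}, LinearMap.range (F s.1) ≠ ⊤ := fun h0 =>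
      Nat.find_min hex hlt ⟨{s // s ≠ t}, inferInstance, fun s => k s.1, fun s => F s.1, rfl, h0⟩
    have : Nontrivial (X ⧸ ⨆ s : {s // s ≠ t}, LinearMap.range (F s.1)) :=
      Submodule.Quotient.nontrivial_iff.2 hne
    obtain ⟨a, f, hf⟩ := H.exists_hom_simple_ne_zero
      (X := X ⧸ ⨆ s : {s // s ≠ t}, LinearMap.range (F s.1))
    let f' := f ∘ₗ (⨆ s : {s // s ≠ t}, LinearMap.range (F s.1)).mkQ
    have hf' : ∀ s, s ≠ t → f' ∘ₗ F s = 0 := fun s hs => LinearMap.ext fun x => by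
      have : F s x ∈ ⨆ s : {s // s ≠ t}, LinearMap.range (F s.1) :=
        (le_iSup (fun s : {s // s ≠ t} => LinearMap.range (F s.1)) ⟨s, hs⟩) ⟨x, rfl⟩
      have h2 := (Submodule.Quotient.mk_eq_zero _).2 this
      change f (Submodule.Quotient.mk _) = 0
      rw [h2, map_zero]
    have hft : f' ∘ₗ F t ≠ 0 := fun h0 => hf <| by
      have h1 : ⨆ t, LinearMap.range (F t) ≤ LinearMap.ker f' := iSup_le fun s => by
        rintro _ ⟨x, rfl⟩
        by_cases hs : s = t
        · subst hs; exact LinearMap.congr_fun h0 x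
        · exact LinearMap.congr_fun (hf' s hs) x
      rw [hF] at h1
      refine LinearMap.ext fun y => ?_
      obtain ⟨x, rfl⟩ := Submodule.mkQ_surjective _ y
      exact h1 (Submodule.mem_top (x := x))
    have hat : a = k t := by
      by_contra hat
      exact hft (H.projHom_simple_of_ne hat _)
    subst hat
    exact ⟨f', hf', hft⟩
  have hsum : ∀ t x, (∑ s, F s ∘ₗ LinearMap.proj s) (Pi.single t x) = F t x := by
    intro t x
    rw [LinearMap.sum_apply, Finset.sum_eq_single t]
    · simp
    · intro s _ hs
      simp [Pi.single_eq_of_ne hs]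
    · simp
  refine ⟨ι, hι, k, ∑ t, F t ∘ₗ LinearMap.proj t, ?_, ?_, ?_⟩
  · rw [← LinearMap.range_eq_top, eq_top_iff, ← hF]
    refine iSup_le fun t => ?_
    rintro _ ⟨x, rfl⟩
    exact ⟨Pi.single t x, hsum t x⟩
  · intro t
    obtain ⟨f, -, hf⟩ := hmin t
    exact ⟨f, fun h => hf (by rw [h, LinearMap.zero_comp])⟩
  · intro a g
    have hu : ∀ t, ∃ f : X →ₗ[Aᵐᵒᵖ] H.simple a, (∀ s, s ≠ t → f ∘ₗ F s = 0) ∧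
        f ∘ₗ F t = g ∘ₗ LinearMap.single Aᵐᵒᵖ (fun t => projModule (e (k t))) t := by
      intro t
      by_cases hat : a = k t
      · subst hat
        obtain ⟨f, hf1, hf2⟩ := hmin t
        obtain ⟨c, hc⟩ := H.projHom_simple_unique hf2 (g ∘ₗ LinearMap.single Aᵐᵒᵖ (fun t => projModule (e (k t))) t)
        exact ⟨H.scale _ c ∘ₗ f, fun s hs => by
          rw [LinearMap.comp_assoc, hf1 s hs, LinearMap.comp_zero], hc.symm⟩
      · exact ⟨0, fun s _ => LinearMap.zero_comp _, by
          rw [LinearMap.zero_comp, H.projHom_simple_of_ne hat (g ∘ₗ LinearMap.single Aᵐᵒᵖ (fun t => projModule (e (k t))) t)]⟩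
    choose f hf1 hf2 using hu
    refine ⟨∑ t, f t, LinearMap.pi_ext fun s x => ?_⟩
    have h1 : (∑ t, f t ∘ₗ F s) x = g (Pi.single s x) := by
      rw [Finset.sum_eq_single s, hf2]
      · rfl
      · exact fun t _ ht => hf1 t s ht.symm
      · simp
    rw [← h1, LinearMap.comp_apply, hsum]
    simp

end Cover

end QuiverAlg

namespace QuiverAlg

open MulOpposite Abelian

/-! ### The Nakayama functor -/

section KDualMap

variable {K A M N L : Type*} [Field K] [Ring A] [Algebra K A]
  [AddCommGroup M] [Module K M] [Module A M] [IsScalarTower K A M]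
  [AddCommGroup N] [Module K N] [Module A N] [IsScalarTower K A N]
  [AddCommGroup L] [Module K L] [Module A L] [IsScalarTower K A L]

/-- The dual of a homomorphism of left modules. -/
def kdualMap (t : M →ₗ[A] N) : KDual K N →ₗ[Aᵐᵒᵖ] KDual K M where
  toFun f := (show N →ₗ[K] K from f) ∘ₗ t.restrictScalars K
  map_add' _ _ := rfl
  map_smul' c f := LinearMap.ext (M := M) fun x => by
    change (show N →ₗ[K] K from f) (c.unop • t x) = (show N →ₗ[K] K from f) (t (c.unop • x))
    rw [LinearMap.map_smul t]

theorem kdualMap_exact {t : M →ₗ[A] N} {s : N →ₗ[A] L} (h : Function.Exact t s) :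
    Function.Exact (kdualMap (K := K) s) (kdualMap (K := K) t) := by
  intro f
  constructor
  · intro hf
    have h1 : LinearMap.ker (s.restrictScalars K) ≤ LinearMap.ker (show N →ₗ[K] K from f) := by
      intro x hx
      obtain ⟨y, rfl⟩ := (h x).1 hx
      exact LinearMap.congr_fun (show (show N →ₗ[K] K from f) ∘ₗ t.restrictScalars K = 0 from hf) y
    -- The functional f descends to the image of s, and then extends to L because `K` is a field.
    obtain ⟨g, hg⟩ := LinearMap.exists_extend
      ((LinearMap.ker (s.restrictScalars K)).liftQ (show N →ₗ[K] K from f) h1 ∘ₗ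
        (s.restrictScalars K).quotKerEquivRange.symm.toLinearMap)
    refine ⟨g, LinearMap.ext (M := N) fun x => ?_⟩
    have h2 := LinearMap.congr_fun hg ((s.restrictScalars K).quotKerEquivRange
      (Submodule.Quotient.mk x))
    simp only [LinearMap.comp_apply, LinearEquiv.coe_coe, LinearEquiv.symm_apply_apply] at h2
    exact h2
  · rintro ⟨g, rfl⟩
    refine LinearMap.ext (M := M) fun x => ?_
    change (show L →ₗ[K] K from g) (s (t x)) = 0
    rw [h.apply_apply_eq_zero, map_zero]

theorem kdualMap_injective {t : M →ₗ[A] N} (h : Function.Surjective t) :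
    Function.Injective (kdualMap (K := K) t) := by
  rw [injective_iff_map_eq_zero]
  intro f hf
  refine LinearMap.ext (M := N) fun x => ?_
  obtain ⟨y, rfl⟩ := h x
  exact LinearMap.congr_fun (show (show N →ₗ[K] K from f) ∘ₗ t.restrictScalars K = 0 from hf) y

theorem kdualMap_surjective {t : M →ₗ[A] N} (h : Function.Injective t) :
    Function.Surjective (kdualMap (K := K) t) := by
  intro f
  obtain ⟨r, hr⟩ := (t.restrictScalars K).exists_leftInverse_of_injective (LinearMap.ker_eq_bot.2 h)
  refine ⟨(show M →ₗ[K] K from f) ∘ₗ r, LinearMap.ext (M := M) fun x => ?_⟩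
  change (show M →ₗ[K] K from f) (r (t x)) = _
  rw [show r (t x) = x from LinearMap.congr_fun hr x]

theorem kdualMap_comp (t : M →ₗ[A] N) (s : N →ₗ[A] L) :
    kdualMap (K := K) (s ∘ₗ t) = kdualMap t ∘ₗ kdualMap s := rfl

/-- The dual of an isomorphism of left modules. -/
def kdualEquiv (t : M ≃ₗ[A] N) : KDual K N ≃ₗ[Aᵐᵒᵖ] KDual K M :=
  LinearEquiv.ofLinearMap (kdualMap t.toLinearMap) (kdualMap t.symm.toLinearMap)
    (by rw [← kdualMap_comp, LinearEquiv.symm_comp]; rfl)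
    (by rw [← kdualMap_comp, LinearEquiv.comp_symm]; rfl)

end KDualMap

section Precomp

variable {A : Type*} [Ring A] {M N L : Type*} [AddCommGroup M] [Module Aᵐᵒᵖ M]
  [AddCommGroup N] [Module Aᵐᵒᵖ N] [AddCommGroup L] [Module Aᵐᵒᵖ L]

/-- The homomorphism of left modules `Hom(N, A) → Hom(M, A)` induced by `M → N`. -/
def precompA (h : M →ₗ[Aᵐᵒᵖ] N) : (N →ₗ[Aᵐᵒᵖ] A) →ₗ[A] (M →ₗ[Aᵐᵒᵖ] A) where
  toFun g := g ∘ₗ h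
  map_add' _ _ := rfl
  map_smul' _ _ := rfl

theorem precompA_exact {f : M →ₗ[Aᵐᵒᵖ] N} {g : N →ₗ[Aᵐᵒᵖ] L} (h : Function.Exact f g)
    (hg : Function.Surjective g) : Function.Exact (precompA g) (precompA f) := by
  intro r
  constructor
  · intro hr
    have h1 : LinearMap.ker g ≤ LinearMap.ker r := by
      intro x hx
      obtain ⟨y, rfl⟩ := (h x).1 hx
      exact LinearMap.congr_fun hr y
    refine ⟨(LinearMap.ker g).liftQ r h1 ∘ₗ (g.quotKerEquivOfSurjective hg).symm.toLinearMap,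
      LinearMap.ext fun x => ?_⟩
    have : (g.quotKerEquivOfSurjective hg).symm (g x) = Submodule.Quotient.mk x := by
      rw [LinearEquiv.symm_apply_eq]; rfl
    change (LinearMap.ker g).liftQ r h1 ((g.quotKerEquivOfSurjective hg).symm (g x)) = r x
    rw [this]; rfl
  · rintro ⟨r, rfl⟩
    refine LinearMap.ext fun x => ?_
    change r (g (f x)) = 0
    rw [h.apply_apply_eq_zero, map_zero]

theorem precompA_injective {g : N →ₗ[Aᵐᵒᵖ] L} (hg : Function.Surjective g) :
    Function.Injective (precompA g) := by
  intro r s hrs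
  refine LinearMap.ext fun x => ?_
  obtain ⟨y, rfl⟩ := hg x
  exact LinearMap.congr_fun hrs y

end Precomp

section ProjDual

variable {A : Type u} [Ring A]

/-- `Hom(e A, A)` is `A e`. -/
def projDual {e : A} (he : e * e = e) :
    Submodule.span A ({e} : Set A) ≃ₗ[A] (projModule e →ₗ[Aᵐᵒᵖ] A) where
  toFun y :=
    { toFun := fun x => y.1 * x.1
      map_add' := fun _ _ => mul_add _ _ _
      map_smul' := fun c x => (mul_assoc y.1 x.1 c.unop).symm }
  map_add' y z := LinearMap.ext fun x => add_mul y.1 z.1 x.1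
  map_smul' c y := LinearMap.ext fun x => mul_assoc c y.1 x.1
  invFun f := ⟨f (projGen e), Submodule.mem_span_singleton.2 ⟨f (projGen e),
    op_smul_map_projGen he f⟩⟩
  left_inv y := by
    obtain ⟨y, hy⟩ := y
    obtain ⟨c, rfl⟩ := Submodule.mem_span_singleton.1 hy
    refine Subtype.ext ?_
    change c * e * e = c * e
    rw [mul_assoc, he]
  right_inv f := by
    refine projHom_ext he ?_
    exact op_smul_map_projGen he f

end ProjDual

section Nu

variable (K : Type u) [Field K] {A : Type (max u v)} [Ring A] [Algebra K A]

/-- The Nakayama functor `D Hom(-, A)` on objects. -/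
def nuObj (M : ModuleCat.{max u v} Aᵐᵒᵖ) : ModuleCat.{max u v} Aᵐᵒᵖ :=
  ModuleCat.of Aᵐᵒᵖ (KDual K (M →ₗ[Aᵐᵒᵖ] A))

/-- The Nakayama functor `D Hom(-, A)`. -/
def nu : ModuleCat.{max u v} Aᵐᵒᵖ ⥤ ModuleCat.{max u v} Aᵐᵒᵖ where
  obj M := nuObj K M
  map h := ModuleCat.ofHom (kdualMap (precompA h.hom))
  map_id _ := rfl
  map_comp _ _ := rfl

instance : (nu.{u, v} K (A := A)).Additive where
  map_add {M N f g} := ModuleCat.hom_ext <| LinearMap.ext fun r =>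
    LinearMap.ext (M := N →ₗ[Aᵐᵒᵖ] A) fun x => by
      change (show (M →ₗ[Aᵐᵒᵖ] A) →ₗ[K] K from r) (x ∘ₗ (f.hom + g.hom)) =
        (show (M →ₗ[Aᵐᵒᵖ] A) →ₗ[K] K from r) (x ∘ₗ f.hom) +
        (show (M →ₗ[Aᵐᵒᵖ] A) →ₗ[K] K from r) (x ∘ₗ g.hom)
      rw [← map_add, LinearMap.comp_add]

variable {K}

theorem nu_map_surjective {M N : ModuleCat.{max u v} Aᵐᵒᵖ} {f : M ⟶ N}
    (h : Function.Injective (precompA f.hom)) :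
    Function.Surjective ((nu.{u, v} K).map f).hom := kdualMap_surjective h

theorem nu_map_injective {M N : ModuleCat.{max u v} Aᵐᵒᵖ} {f : M ⟶ N}
    (h : Function.Surjective (precompA f.hom)) :
    Function.Injective ((nu.{u, v} K).map f).hom := kdualMap_injective h

/-- Right exactness of ν: Hom(-, A) is left exact and the duality is exact. -/
theorem nu_map_exact {S : ShortComplex (ModuleCat.{max u v} Aᵐᵒᵖ)} (hS : S.ShortExact) :
    Function.Exact ((nu.{u, v} K).map S.f).hom ((nu.{u, v} K).map S.g).hom :=
  kdualMap_exact (precompA_exact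
    ((ShortComplex.ShortExact.moduleCat_exact_iff_function_exact S).1 hS.exact)
    hS.moduleCat_surjective_g)

/-- The Nakayama functor sends `e A` to `D (A e)`. -/
def nuProj (K : Type u) [Field K] {A : Type (max u v)} [Ring A] [Algebra K A]
    {e : A} (he : e * e = e) : (nu.{u, v} K).obj (projModule e) ≅ injModule.{u, v} K e :=
  (kdualEquiv (K := K) (projDual he)).toModuleIso

end Nu

/-! ### Finite decompositions of the identity -/

section Add

open Limits

variable {C : Type*} [Category* C] [Preadditive C]

/-- The identity of `X` is a finite sum of morphisms that factor through objects `F k`, `k : V`. -/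
def InAdd {V : Type*} (F : V → C) (p : V → Prop) (X : C) : Prop :=
  ∃ (ι : Type) (_ : Fintype ι) (k : ι → V) (f : (t : ι) → X ⟶ F (k t))
    (g : (t : ι) → F (k t) ⟶ X), (∀ t, p (k t)) ∧ ∑ t, f t ≫ g t = 𝟙 X

theorem InAdd.map {D : Type*} [Category* D] [Preadditive D] {V : Type*} {F : V → C}
    {p : V → Prop} {X : C} (h : InAdd F p X) (G : C ⥤ D) [G.Additive] :
    InAdd (fun k => G.obj (F k)) p (G.obj X) := by
  obtain ⟨ι, hι, k, f, g, hp, hfg⟩ := h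
  refine ⟨ι, hι, k, fun t => G.map (f t), fun t => G.map (g t), hp, ?_⟩
  simp_rw [← G.map_comp]
  rw [← G.map_sum, hfg, G.map_id]

theorem InAdd.of_iso {V : Type*} {F F' : V → C} {p : V → Prop} {X : C} (h : InAdd F p X)
    (E : ∀ k, F k ≅ F' k) : InAdd F' p X := by
  obtain ⟨ι, hι, k, f, g, hp, hfg⟩ := h
  refine ⟨ι, hι, k, fun t => f t ≫ (E _).hom, fun t => (E _).inv ≫ g t, hp, ?_⟩
  simpa using hfg

theorem inAdd_pi {R : Type u} [Ring R] {V : Type*} (F : V → ModuleCat.{u} R) (p : V → Prop)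
    {ι : Type} [Fintype ι] (k : ι → V) (hp : ∀ t, p (k t)) :
    InAdd F p (ModuleCat.of R ((t : ι) → F (k t))) := by
  classical
  refine ⟨ι, inferInstance, k, fun t => ModuleCat.ofHom (LinearMap.proj t),
    fun t => ModuleCat.ofHom (LinearMap.single R (fun t => F (k t)) t), hp, ?_⟩
  apply ModuleCat.hom_ext
  rw [ModuleCat.hom_sum]
  refine LinearMap.ext fun x => ?_
  rw [LinearMap.sum_apply]
  exact Finset.univ_sum_single x

variable {C : Type*} [Category.{v} C] [Abelian C] [HasExt.{w} C] {V : Type*} {F : V → C}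
  {p : V → Prop}

/-- Write x as the identity followed by x and expand the identity: a class is detected on the
objects F k. -/
theorem InAdd.ext_eq_zero {X Y : C} (h : InAdd F p X) {n : ℕ} (x : Ext X Y n)
    (hx : ∀ k, p k → ∀ g : F k ⟶ X, (Ext.mk₀ g).comp x (zero_add n) = 0) : x = 0 := by
  obtain ⟨ι, hι, k, f, g, hp, hfg⟩ := h
  rw [← x.mk₀_id_comp, ← hfg, Ext.mk₀_sum, Ext.sum_comp]
  refine Finset.sum_eq_zero fun t _ => ?_
  rw [← Ext.mk₀_comp_mk₀, Ext.comp_assoc_of_second_deg_zero, hx _ (hp t), Ext.comp_zero]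

theorem InAdd.hasProjectiveDimensionLT {X : C} (h : InAdd F p X) (n : ℕ)
    (hF : ∀ k, p k → HasProjectiveDimensionLT (F k) n) : HasProjectiveDimensionLT X n := by
  rw [hasProjectiveDimensionLT_iff]
  intro i hi Y x
  refine h.ext_eq_zero x fun k hk g => ?_
  have := hF k hk
  exact Ext.eq_zero_of_hasProjectiveDimensionLT _ n hi

theorem InAdd.projective {X : C} (h : InAdd F p X) (hF : ∀ k, p k → Projective (F k)) :
    Projective X := by
  refine projective_iff_hasProjectiveDimensionLT_one.2 (h.hasProjectiveDimensionLT 1 fun k hk => ?_)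
  exact projective_iff_hasProjectiveDimensionLT_one.1 (hF k hk)

theorem InAdd.injective {X : C} (h : InAdd F p X) (hF : ∀ k, p k → Injective (F k)) :
    Injective X := by
  rw [injective_iff_hasInjectiveDimensionLT_one, hasInjectiveDimensionLT_iff]
  intro i hi Y x
  obtain ⟨ι, hι, k, f, g, hp, hfg⟩ := h
  rw [← x.comp_mk₀_id, ← hfg, Ext.mk₀_sum, Ext.comp_sum]
  refine Finset.sum_eq_zero fun t _ => ?_
  have := hF _ (hp t)
  rw [← Ext.mk₀_comp_mk₀, ← Ext.comp_assoc_of_third_deg_zero,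
    Ext.eq_zero_of_hasInjectiveDimensionLT (x.comp (Ext.mk₀ (f t)) (add_zero i)) 1 hi,
    Ext.zero_comp]

end Add

end QuiverAlg

namespace QuiverAlg

open MulOpposite Abelian

/-! ### Detecting Ext from injective modules by those of small projective dimension. -/

section ExtBasic

variable {C : Type*} [Category.{v} C] [Abelian C] [HasExt.{w} C]

theorem ext_eq_zero_of_isIso_comp {X X' Y : C} (f : X' ⟶ X) [IsIso f] {n : ℕ} (x : Ext X Y n)
    (h : (Ext.mk₀ f).comp x (zero_add n) = 0) : x = 0 := by
  rw [← x.mk₀_id_comp, ← IsIso.inv_hom_id f, ← Ext.mk₀_comp_mk₀, Ext.comp_assoc_of_second_deg_zero,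
    h, Ext.comp_zero]

theorem ext_zero_eq_zero_of_epi {X X' Y : C} (f : X' ⟶ X) [Epi f] (x : Ext X Y 0)
    (h : (Ext.mk₀ f).comp x (zero_add 0) = 0) : x = 0 :=
  Ext.precomp_mk₀_injective_of_epi Y f (h.trans (map_zero _).symm)

/-- Dimension shift along a short exact sequence with projective middle term. -/
theorem ext_X₁_eq_zero {S : ShortComplex C} (hS : S.ShortExact) [Projective S.X₂] {Y : C} {n : ℕ}
    (hn : 1 ≤ n) (h : ∀ x : Ext S.X₃ Y (n + 1), x = 0) (x : Ext S.X₁ Y n) : x = 0 := by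
  obtain ⟨y, rfl⟩ := Ext.contravariant_sequence_exact₁ hS Y x (add_comm 1 n) (h _)
  rw [y.eq_zero_of_hasProjectiveDimensionLT 1 hn, Ext.comp_zero]

/-- The obstruction to extending a homomorphism from the submodule to A lies in Ext¹ of the
quotient. After dualizing, ν becomes injective on the inclusion. -/
theorem precompA_surjective_of_ext {A : Type u} [Ring A] {S : ShortComplex (ModuleCat.{u} Aᵐᵒᵖ)}
    (hS : S.ShortExact) (h : ∀ x : Ext S.X₃ (ModuleCat.of Aᵐᵒᵖ A) 1, x = 0) :
    Function.Surjective (precompA S.f.hom) := by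
  intro r
  obtain ⟨y, hy⟩ := Ext.contravariant_sequence_exact₁ hS (ModuleCat.of Aᵐᵒᵖ A)
    (Ext.mk₀ (ModuleCat.ofHom r)) (add_comm 1 0) (h _)
  obtain ⟨g, rfl⟩ := (Ext.mk₀_bijective _ _).2 y
  rw [Ext.mk₀_comp_mk₀] at hy
  exact ⟨g.hom, congrArg ModuleCat.Hom.hom ((Ext.mk₀_bijective _ _).1 hy)⟩

end ExtBasic

section

variable {K : Type u} [Field K] {A : Type (max u v)} [Ring A] [Algebra K A] {V : Type*} [Fintype V]
  {e : V → A}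

theorem IsTriangular.op_smul_simple_self (H : IsTriangular K e) {a : V} (s : H.simple a) :
    op (e a) • s = s := by
  obtain ⟨c, rfl⟩ := H.exists_smul_simpleGen s
  rw [IsTriangular.op_algebraMap_comm, H.op_smul_simpleGen_self]

theorem IsTriangular.exists_op_smul_ne_of_hom (H : IsTriangular K e) {X : Type*} [AddCommGroup X]
    [Module Aᵐᵒᵖ X] {a : V} {f : X →ₗ[Aᵐᵒᵖ] H.simple a} (hf : f ≠ 0) :
    ∃ x : X, op (e a) • x ≠ 0 := by
  by_contra! h
  refine hf (LinearMap.ext fun x => ?_)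
  rw [← H.op_smul_simple_self (f x), ← map_smul, h, map_zero]
  rfl

/-- A finitely generated module is a quotient of a finitely generated projective one. -/
theorem IsTriangular.exists_cover' (H : IsTriangular K e) (M : ModuleCat.{max u v} Aᵐᵒᵖ)
    [Module.Finite Aᵐᵒᵖ M] : ∃ (Q : ModuleCat.{max u v} Aᵐᵒᵖ) (π : Q ⟶ M),
      Module.Finite Aᵐᵒᵖ Q ∧ Function.Surjective π.hom ∧
      InAdd (fun k => projModule (e k)) (fun k => ∃ f : M →ₗ[Aᵐᵒᵖ] H.simple k, f ≠ 0) Q ∧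
      ∀ (a : V) (g : Q ⟶ H.simple a), ∃ f : M ⟶ H.simple a, g = π ≫ f := by
  obtain ⟨ι, hι, k, F, hF, hk, hfac⟩ := H.exists_cover (X := M)
  refine ⟨ModuleCat.of Aᵐᵒᵖ ((t : ι) → projModule (e (k t))), ModuleCat.ofHom F,
    inferInstanceAs (Module.Finite Aᵐᵒᵖ ((t : ι) → projModule (e (k t)))), hF,
    inAdd_pi _ _ k hk, fun a g => ?_⟩
  obtain ⟨f, hf⟩ := hfac a g.hom
  exact ⟨ModuleCat.ofHom f, ModuleCat.hom_ext hf⟩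

theorem IsTriangular.finite_ker (H : IsTriangular K e) {M N : ModuleCat.{max u v} Aᵐᵒᵖ}
    [Module.Finite Aᵐᵒᵖ M] (f : M →ₗ[Aᵐᵒᵖ] N) : Module.Finite Aᵐᵒᵖ (LinearMap.ker f) := by
  have := H.isNoetherian
  infer_instance

/-- Dimension shift along a projective resolution of M. A class that dies on νQ comes from Ext^(i-1)
of the kernel of νπ. That kernel is ν(ΩM) when i ≥ 2, as Ext¹(M, A) = 0, and a quotient of it when i
= 1. A cover of ΩM then has image in add of the I(k) under ν, where Ext^(i-1) to Y vanishes. -/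
theorem IsTriangular.nu_ext_eq_zero (H : IsTriangular K e) (Y : ModuleCat.{max u v} Aᵐᵒᵖ) (i : ℕ) :
    (∀ j < i, ∀ (k : V) (x : Ext (injModule.{u, v} K (e k)) Y j), x = 0) →
    ∀ (M : ModuleCat.{max u v} Aᵐᵒᵖ) [Module.Finite Aᵐᵒᵖ M],
      (∀ t, 1 ≤ t → t < i → ∀ x : Ext M (ModuleCat.of Aᵐᵒᵖ A) t, x = 0) →
    ∀ (Q : ModuleCat.{max u v} Aᵐᵒᵖ) [Module.Finite Aᵐᵒᵖ Q] [Projective Q] (π : Q ⟶ M),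
      Function.Surjective π.hom →
    ∀ x : Ext ((nu.{u, v} K).obj M) Y i,
      (Ext.mk₀ ((nu.{u, v} K).map π)).comp x (zero_add i) = 0 → x = 0 := by
  induction i with
  | zero =>
    intro _ M _ _ Q _ _ π hπ x hx
    have : Epi ((nu.{u, v} K).map π) := (ModuleCat.epi_iff_surjective _).2
      (nu_map_surjective (precompA_injective hπ))
    exact ext_zero_eq_zero_of_epi _ x hx
  | succ n ih =>
    intro hY M _ hM Q _ _ π hπ x hx
    have hS := LinearMap.shortExact_shortComplexKer hπ
    have hT := LinearMap.shortExact_shortComplexKer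
      (nu_map_surjective (K := K) (precompA_injective hπ))
    obtain ⟨y, rfl⟩ := Ext.contravariant_sequence_exact₃ hT Y x hx (add_comm 1 n)
    have hfin := H.finite_ker π.hom
    let S := π.hom.shortComplexKer
    have hP : Projective S.X₂ := inferInstanceAs (Projective Q)
    have hex := nu_map_exact (K := K) hS
    let α : (nu.{u, v} K).obj S.X₁ ⟶ ModuleCat.of Aᵐᵒᵖ
        (LinearMap.ker ((nu.{u, v} K).map π).hom) :=
      ModuleCat.ofHom (((nu.{u, v} K).map S.f).hom.codRestrict _ fun z => hex.apply_apply_eq_zero z)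
    have hα : Function.Surjective α.hom := fun ⟨z, hz⟩ => by
      obtain ⟨w, hw⟩ := (hex z).1 hz
      exact ⟨w, Subtype.ext hw⟩
    have hy : (Ext.mk₀ α).comp y (zero_add n) = 0 := by
      obtain ⟨Q', π', hQ', hπ', hadd, -⟩ := H.exists_cover' S.X₁
      have hproj := hadd.projective fun k _ => projective_projModule (H.idem k)
      refine ih (fun j hj => hY j (by omega)) S.X₁
        (fun t h1 h2 => ext_X₁_eq_zero hS h1 (hM (t + 1) (by omega) (by omega))) Q' π' hπ' _ ?_
      refine ((hadd.map (nu.{u, v} K)).of_iso fun k => nuProj K (H.idem k)).ext_eq_zero _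
        fun k _ g => hY n (by omega) k _
    have hy0 : y = 0 := by
      have hep : Epi α := (ModuleCat.epi_iff_surjective _).2 hα
      -- In degree 0 an epimorphism already detects classes; in positive degree Ext¹(M, A) = 0 is
      -- available and α is an isomorphism.
      rcases Nat.eq_zero_or_pos n with rfl | hn
      · exact ext_zero_eq_zero_of_epi α y hy
      · have hmono : Mono α := by
          rw [ModuleCat.mono_iff_injective]
          intro z w hzw
          refine nu_map_injective (K := K) (precompA_surjective_of_ext hS
            (hM 1 le_rfl (by omega))) ?_
          exact congrArg Subtype.val hzw
        have : IsIso α := isIso_of_mono_of_epi α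
        exact ext_eq_zero_of_isIso_comp α y hy
    rw [hy0, Ext.comp_zero]

/-- An element of `Ext^j(I(k), Y)` vanishes if it is annihilated by all homomorphisms from
those indecomposable injective modules that have projective dimension at most `j`. -/
theorem IsTriangular.ext_injModule_eq_zero (H : IsTriangular K e) (Y : ModuleCat.{max u v} Aᵐᵒᵖ)
    (j : ℕ) (hY : ∀ i < j, ∀ (k : V) (x : Ext (injModule.{u, v} K (e k)) Y i), x = 0)
    (hA : ∀ k, ¬ HasProjectiveDimensionLE (injModule.{u, v} K (e k)) j → ∀ i ≤ j,
      ∀ x : Ext (H.simple k) (ModuleCat.of Aᵐᵒᵖ A) i, x = 0)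
    (k : V) (x : Ext (injModule.{u, v} K (e k)) Y j)
    (hx : ∀ r, HasProjectiveDimensionLE (injModule.{u, v} K (e r)) j →
      ∀ g : injModule.{u, v} K (e r) ⟶ injModule.{u, v} K (e k),
        (Ext.mk₀ g).comp x (zero_add j) = 0) : x = 0 := by
  obtain ⟨h, hh⟩ := H.exists_height
  -- The induction descends from the highest vertices: the claim for k uses the vertices above k.
  have hwf : WellFounded (fun a b : V => h b < h a) := by
    have : IsTrans V (fun a b : V => h b < h a) := ⟨fun a b c h1 h2 => lt_trans h2 h1⟩
    have : Std.Irrefl (fun a b : V => h b < h a) := ⟨fun a => lt_irrefl _⟩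
    exact Finite.wellFounded_of_trans_of_irrefl _
  induction k using hwf.induction with
  | _ k ih =>
  by_cases hk : HasProjectiveDimensionLE (injModule.{u, v} K (e k)) j
  · rw [← x.mk₀_id_comp]
    exact hx k hk _
  -- Apply ν to rad P(k) → P(k). The cokernel is S(k), whose Ext groups to A vanish up to degree j,
  -- so the result maps onto ν P(k) = I(k), bijectively if j ≥ 1.
  have hS := LinearMap.shortExact_shortComplexKer (H.top_surjective k)
  let S := (H.top k).shortComplexKer
  have hP : Projective S.X₂ := projective_projModule (H.idem k)
  have hA' := hA k hk
  have hfin : Module.Finite Aᵐᵒᵖ S.X₁ :=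
    H.finite_ker (M := projModule (e k)) (N := H.simple k) (H.top k)
  have hsurj : Function.Surjective ((nu.{u, v} K).map S.f).hom := by
    refine nu_map_surjective ((injective_iff_map_eq_zero _).2 fun r hr => ?_)
    obtain ⟨s, rfl⟩ := (precompA_exact
      ((ShortComplex.ShortExact.moduleCat_exact_iff_function_exact S).1 hS.exact)
      hS.moduleCat_surjective_g r).1 hr
    have hs : ModuleCat.ofHom s = 0 := (Ext.mk₀_eq_zero_iff _).1 (hA' 0 (Nat.zero_le _) _)
    have hs' : s = 0 := congrArg ModuleCat.Hom.hom hs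
    rw [hs', map_zero]
  have hep : Epi ((nu.{u, v} K).map S.f) := (ModuleCat.epi_iff_surjective _).2 hsurj
  let φ : (nu.{u, v} K).obj S.X₂ ≅ injModule.{u, v} K (e k) := nuProj K (H.idem k)
  refine ext_eq_zero_of_isIso_comp φ.hom x ?_
  have key : (Ext.mk₀ ((nu.{u, v} K).map S.f)).comp
      ((Ext.mk₀ φ.hom).comp x (zero_add j)) (zero_add j) = 0 := by
    obtain ⟨Q, π, hQ, hπ, hadd, -⟩ := H.exists_cover' S.X₁
    have hproj := hadd.projective fun k _ => projective_projModule (H.idem k)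
    refine H.nu_ext_eq_zero Y j hY S.X₁
      (fun t h1 h2 => ext_X₁_eq_zero hS h1 (hA' (t + 1) (by omega))) Q π hπ _ ?_
    refine ((hadd.map (nu.{u, v} K)).of_iso fun k => nuProj K (H.idem k)).ext_eq_zero _ ?_
    -- The cover of rad P(k) involves only P(c) with c above k, so the induction hypothesis applies
    -- to I(c).
    rintro c ⟨f, hf⟩ g
    obtain ⟨y, hy⟩ := H.exists_op_smul_ne_of_hom hf
    have hlt := H.height_lt_of_ker_top hh hy
    refine ih c hlt _ fun r hr g' => ?_
    simp only [Ext.mk₀_comp_mk₀_assoc]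
    exact hx r hr _
  rcases Nat.eq_zero_or_pos j with rfl | hj
  · exact ext_zero_eq_zero_of_epi _ _ key
  · have hmono : Mono ((nu.{u, v} K).map S.f) := (ModuleCat.mono_iff_injective _).2
      (nu_map_injective (precompA_surjective_of_ext hS (hA' 1 hj)))
    have := isIso_of_mono_of_epi ((nu.{u, v} K).map S.f)
    exact ext_eq_zero_of_isIso_comp _ _ key

end

end QuiverAlg

namespace QuiverAlg

open MulOpposite Abelian

/-! ### Vanishing of Ext along composition series. -/

section ExtFiltration

variable {K : Type*} [Field K] {A : Type u} [Ring A] [Algebra K A] {V : Type*} [Fintype V]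
  {e : V → A}

/-- Half-exactness of Ext along a composition series; only simples at vertices in the support of X
occur as factors. -/
theorem IsTriangular.ext_eq_zero_of_simple_left (H : IsTriangular K e) {X Y : ModuleCat.{u} Aᵐᵒᵖ}
    [Module.Finite Aᵐᵒᵖ X] {i : ℕ}
    (h : ∀ k, (∃ x : X, op (e k) • x ≠ 0) → ∀ x : Ext (H.simple k) Y i, x = 0) (x : Ext X Y i) :
    x = 0 := by
  let ι : ModuleCat.of Aᵐᵒᵖ (⊤ : Submodule Aᵐᵒᵖ X) ≅ X := Submodule.topEquiv.toModuleIso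
  refine ext_eq_zero_of_isIso_comp ι.hom x ?_
  refine H.composition_induction
    (fun N => ∀ x : Ext (ModuleCat.of Aᵐᵒᵖ N) Y i, x = 0) ?_ ?_ _
  · intro x
    rw [← x.mk₀_id_comp, show 𝟙 (ModuleCat.of Aᵐᵒᵖ (⊥ : Submodule Aᵐᵒᵖ X)) = 0 from
      ModuleCat.hom_ext (LinearMap.ext fun x => Subsingleton.elim _ _), Ext.mk₀_zero, Ext.zero_comp]
  · intro N N' hle a g hg hex hx hN x
    have hS : (ModuleCat.shortComplexOfCompEqZero (Submodule.inclusion hle) g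
        hex.linearMap_comp_eq_zero).ShortExact :=
      ModuleCat.shortComplex_shortExact _ hex (Submodule.inclusion_injective hle) hg
    obtain ⟨y, rfl⟩ := Ext.contravariant_sequence_exact₂ hS Y x (hN _)
    rw [h a hx y, Ext.comp_zero]

theorem IsTriangular.ext_eq_zero_of_simple_right (H : IsTriangular K e) {X Y : ModuleCat.{u} Aᵐᵒᵖ}
    [Module.Finite Aᵐᵒᵖ Y] {i : ℕ}
    (h : ∀ k, (∃ x : Y, op (e k) • x ≠ 0) → ∀ x : Ext X (H.simple k) i, x = 0) (x : Ext X Y i) :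
    x = 0 := by
  let ι : ModuleCat.of Aᵐᵒᵖ (⊤ : Submodule Aᵐᵒᵖ Y) ≅ Y := Submodule.topEquiv.toModuleIso
  have key : x.comp (Ext.mk₀ ι.inv) (add_zero i) = 0 := by
    refine H.composition_induction
      (fun N => ∀ x : Ext X (ModuleCat.of Aᵐᵒᵖ N) i, x = 0) ?_ ?_ _
    · intro x
      rw [← x.comp_mk₀_id, show 𝟙 (ModuleCat.of Aᵐᵒᵖ (⊥ : Submodule Aᵐᵒᵖ Y)) = 0 from
        ModuleCat.hom_ext (LinearMap.ext fun x => Subsingleton.elim _ _), Ext.mk₀_zero,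
        Ext.comp_zero]
    · intro N N' hle a g hg hex hx hN x
      have hS : (ModuleCat.shortComplexOfCompEqZero (Submodule.inclusion hle) g
          hex.linearMap_comp_eq_zero).ShortExact :=
        ModuleCat.shortComplex_shortExact _ hex (Submodule.inclusion_injective hle) hg
      obtain ⟨y, rfl⟩ := Ext.covariant_sequence_exact₂ X hS x (h a hx _)
      rw [hN y, Ext.zero_comp]
  rw [← x.comp_mk₀_id, ← ι.inv_hom_id, ← Ext.mk₀_comp_mk₀, ← Ext.comp_assoc_of_third_deg_zero, key,
    Ext.zero_comp]

end ExtFiltration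

section

variable {C : Type*} [Category* C] [Preadditive C] {V : Type*} {F : V → C} {p : V → Prop}

/-- Closure under retracts comes for free, so no Krull–Schmidt decomposition of summands is needed.
-/
theorem InAdd.of_retract {X Y : C} (h : InAdd F p Y) (r : Retract X Y) : InAdd F p X := by
  obtain ⟨ι, hι, k, f, g, hp, hfg⟩ := h
  refine ⟨ι, hι, k, fun t => r.i ≫ f t, fun t => g t ≫ r.r, hp, ?_⟩
  have h1 : ∑ t, (r.i ≫ f t) ≫ g t ≫ r.r = r.i ≫ (∑ t, f t ≫ g t) ≫ r.r := by
    simp only [Preadditive.sum_comp, Preadditive.comp_sum, Category.assoc]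
  rw [h1, hfg, Category.id_comp, r.retract]

theorem InAdd.mono {X : C} {q : V → Prop} (h : InAdd F p X) (hpq : ∀ k, p k → q k) :
    InAdd F q X := by
  obtain ⟨ι, hι, k, f, g, hp, hfg⟩ := h
  exact ⟨ι, hι, k, f, g, fun t => hpq _ (hp t), hfg⟩

end

/-! ### Cosyzygies of projective modules under the grade condition. -/

section Cosyzygy

variable {K : Type u} [Field K] {A : Type (max u v)} [Ring A] [Algebra K A] {V : Type*} [Fintype V]
  {e : V → A}

theorem IsTriangular.exists_envelope' (H : IsTriangular K e) (M : ModuleCat.{max u v} Aᵐᵒᵖ)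
    [Module.Finite Aᵐᵒᵖ M] : ∃ (E : ModuleCat.{max u v} Aᵐᵒᵖ) (j : M ⟶ E),
      Module.Finite Aᵐᵒᵖ E ∧ Function.Injective j.hom ∧
      InAdd (fun k => injModule.{u, v} K (e k)) (fun k => ∃ f : H.simple k ⟶ M, f ≠ 0) E ∧
      ∀ (a : V) (g : H.simple a ⟶ E), ∃ f : H.simple a ⟶ M, g = f ≫ j := by
  obtain ⟨ι, hι, k, F, hF, hk, hfac⟩ := H.exists_envelope (X := M)
  have := H.finite
  refine ⟨ModuleCat.of Aᵐᵒᵖ ((t : ι) → injModule.{u, v} K (e (k t))), ModuleCat.ofHom F,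
    inferInstanceAs (Module.Finite Aᵐᵒᵖ ((t : ι) → injModule.{u, v} K (e (k t)))), hF,
    inAdd_pi _ _ k fun t => ?_, fun a g => ?_⟩
  · obtain ⟨f, hf⟩ := hk t
    exact ⟨ModuleCat.ofHom f, fun h => hf (congrArg ModuleCat.Hom.hom h)⟩
  · obtain ⟨f, hf⟩ := hfac a g.hom
    exact ⟨ModuleCat.ofHom f, ModuleCat.hom_ext hf⟩

/-- The short exact sequence given by an injective homomorphism. -/
theorem shortExact_mkQ {R : Type u} [Ring R] {M E : ModuleCat.{v} R} {j : M ⟶ E}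
    (hj : Function.Injective j.hom) :
    (ModuleCat.shortComplexOfCompEqZero j.hom (LinearMap.range j.hom).mkQ
      (LinearMap.range_mkQ_comp _)).ShortExact :=
  ModuleCat.shortComplex_shortExact _ (LinearMap.exact_map_mkQ_range _) hj
    (Submodule.mkQ_surjective _)

/-- `M` together with `ε ∈ Extⁱ(M, P(a))` behaves like the `i`-th cosyzygy of `P(a)`. -/
structure IsTriangular.IsCosyzygy (H : IsTriangular K e) (a : V) (i : ℕ)
    (M : ModuleCat.{max u v} Aᵐᵒᵖ) (ε : Ext M (projModule (e a)) i) : Prop where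
  finite : Module.Finite Aᵐᵒᵖ M
  pd : HasProjectiveDimensionLE M i
  left : ∀ (Y : ModuleCat.{max u v} Aᵐᵒᵖ) (y : Ext M Y i), ∃ h : projModule (e a) ⟶ Y,
    y = ε.comp (Ext.mk₀ h) (add_zero i)
  right : ∀ (X : ModuleCat.{max u v} Aᵐᵒᵖ) (t n : ℕ) (hn : t + i = n)
    (x : Ext X (projModule (e a)) n), ∃ x' : Ext X M t, x = x'.comp ε hn
  inj : ∀ (X : ModuleCat.{max u v} Aᵐᵒᵖ) (t n : ℕ) (hn : t + i = n), 1 ≤ t → ∀ y : Ext X M t,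
    y.comp ε hn = 0 → y = 0
  inj_simple : ∀ (k : V) (f : H.simple k ⟶ M), (Ext.mk₀ f).comp ε (zero_add i) = 0 → f = 0

/-- The Auslander condition in terms of the simple modules: `pdim I(k)` is at most the grade
of `S(k)`. -/
def IsTriangular.GradeCondition (H : IsTriangular K e) : Prop :=
  ∀ (k : V) (i : ℕ) (x : Ext (H.simple k) (ModuleCat.of Aᵐᵒᵖ A) i), x ≠ 0 →
    HasProjectiveDimensionLE (injModule.{u, v} K (e k)) i

theorem IsTriangular.GradeCondition.proj {H : IsTriangular K e} (hgr : H.GradeCondition)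
    {k a : V} {i : ℕ} {x : Ext (H.simple k) (projModule (e a)) i} (hx : x ≠ 0) :
    HasProjectiveDimensionLE (injModule.{u, v} K (e k)) i := by
  refine hgr k i (x.comp (Ext.mk₀ (projRetract (H.idem a)).i) (add_zero i)) fun h => hx ?_
  rw [← x.comp_mk₀_id, ← (projRetract (H.idem a)).retract, ← Ext.mk₀_comp_mk₀,
    ← Ext.comp_assoc_of_third_deg_zero, h, Ext.zero_comp]

theorem IsTriangular.isCosyzygy_zero (H : IsTriangular K e) (a : V) :
    H.IsCosyzygy a 0 (projModule (e a)) (Ext.mk₀ (𝟙 _)) where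
  finite := inferInstance
  pd := by
    have := projective_projModule (H.idem a)
    exact (projective_iff_hasProjectiveDimensionLE_zero _).1 this
  left Y y := by
    obtain ⟨h, rfl⟩ := (Ext.mk₀_bijective _ _).2 y
    exact ⟨h, by rw [Ext.mk₀_id_comp]⟩
  right X t n hn x := by
    obtain rfl : t = n := by omega
    exact ⟨x, by rw [Ext.comp_mk₀_id]⟩
  inj X t n hn _ y hy := by
    obtain rfl : t = n := by omega
    rwa [Ext.comp_mk₀_id] at hy
  inj_simple k f hf := by
    rw [Ext.comp_mk₀_id] at hf
    exact (Ext.mk₀_eq_zero_iff f).1 hf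

/-- The next cosyzygy is the cokernel of an envelope M → E, with the extension class composed with
ε. A summand I(k) of E comes from a nonzero S(k) → M, which ε turns into a nonzero class in
Extⁱ(S(k), P(a)). The grade condition gives pdim I(k) ≤ i, so pdim E ≤ i and the cokernel has pdim ≤
i + 1. -/
theorem IsTriangular.exists_isCosyzygy (H : IsTriangular K e) (hgr : H.GradeCondition) (a : V)
    (i : ℕ) : ∃ (M : ModuleCat.{max u v} Aᵐᵒᵖ) (ε : Ext M (projModule (e a)) i),
      H.IsCosyzygy a i M ε := by
  induction i with
  | zero => exact ⟨_, _, H.isCosyzygy_zero a⟩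
  | succ i ih =>
    obtain ⟨M, ε, hM⟩ := ih
    have := hM.finite
    obtain ⟨E, j, hE, hj, hadd, hfac⟩ := H.exists_envelope' M
    have hS := shortExact_mkQ hj
    have hinj : Injective E := hadd.injective fun k _ => injective_injModule (H.idem k)
    have hpd : HasProjectiveDimensionLE E i := hadd.hasProjectiveDimensionLT _ fun k ⟨f, hf⟩ =>
      hgr.proj (x := (Ext.mk₀ f).comp ε (zero_add i)) fun h => hf (hM.inj_simple k f h)
    have hi : 1 + i = i + 1 := add_comm _ _
    -- The connecting map raises the degree by one, so composition with ε is injective here even for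
    -- t = 0.
    have hinj0 : ∀ (X : ModuleCat.{max u v} Aᵐᵒᵖ) (t n : ℕ) (hn : t + (i + 1) = n)
        (y : Ext X (ModuleCat.of Aᵐᵒᵖ (E ⧸ LinearMap.range j.hom)) t),
        y.comp (hS.extClass.comp ε hi) hn = 0 → y.comp hS.extClass rfl = 0 := by
      intro X t n hn y hy
      refine hM.inj X (t + 1) n (by omega) (by omega) _ ?_
      rw [Ext.comp_assoc (a₂₃ := i + 1)]
      · exact hy
      · omega
    refine ⟨ModuleCat.of Aᵐᵒᵖ (E ⧸ LinearMap.range j.hom), hS.extClass.comp ε hi,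
      inferInstanceAs (Module.Finite Aᵐᵒᵖ (E ⧸ LinearMap.range j.hom)), ?_, ?_, ?_, ?_, ?_⟩
    · have h2 := hM.pd
      exact hS.hasProjectiveDimensionLT_X₃ (i + 1) h2 (hasProjectiveDimensionLT_of_ge E (i + 1) _
        (Nat.le_succ _))
    · intro Y y
      obtain ⟨y1, rfl⟩ := Ext.contravariant_sequence_exact₃ hS Y y
        (Ext.eq_zero_of_hasProjectiveDimensionLT (X := E) _ (i + 1) le_rfl) hi
      obtain ⟨h, rfl⟩ := hM.left Y y1
      exact ⟨h, (Ext.comp_assoc_of_third_deg_zero _ _ _ _).symm⟩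
    · intro X t n hn x
      obtain ⟨x', rfl⟩ := hM.right X (t + 1) n (by omega) x
      obtain ⟨x'', rfl⟩ := Ext.covariant_sequence_exact₁ X hS x'
        (Ext.eq_zero_of_injective (I := E) _) rfl
      exact ⟨x'', Ext.comp_assoc _ _ _ _ _ (by omega)⟩
    · intro X t n hn ht y hy
      obtain ⟨y2, rfl⟩ := Ext.covariant_sequence_exact₃ X hS y rfl (hinj0 X t n hn y hy)
      obtain ⟨t, rfl⟩ : ∃ s, t = s + 1 := ⟨t - 1, by omega⟩
      rw [Ext.eq_zero_of_injective (I := E) y2, Ext.zero_comp]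
    · intro k f hf
      obtain ⟨y2, hy2⟩ := Ext.covariant_sequence_exact₃ _ hS (Ext.mk₀ f) rfl (hinj0 _ 0 _ _ _ hf)
      obtain ⟨f2, rfl⟩ := (Ext.mk₀_bijective _ _).2 y2
      obtain ⟨f3, rfl⟩ := hfac k f2
      rw [Ext.mk₀_comp_mk₀] at hy2
      rw [← (Ext.mk₀_bijective _ _).1 hy2, Category.assoc]
      exact (congrArg (f3 ≫ ·) (ModuleCat.shortComplexOfCompEqZero j.hom
        (LinearMap.range j.hom).mkQ (LinearMap.range_mkQ_comp _)).zero).trans Limits.comp_zero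

end Cosyzygy

end QuiverAlg

namespace QuiverAlg

open MulOpposite Abelian

/-! ### The Auslander–Reiten bijection and the label inequality. -/

section AR

variable {K : Type u} [Field K] {A : Type (max u v)} [Ring A] [Algebra K A] {V : Type*} [Fintype V]
  {e : V → A}

theorem IsTriangular.nontrivial_projModule (H : IsTriangular K e) (a : V) :
    Nontrivial (projModule (e a)) :=
  ⟨projGen (e a), 0, fun h => H.ne_zero a (congrArg Subtype.val h)⟩

/-- The injective dimension of `P(a)`, on finitely generated modules. -/
theorem IsTriangular.exists_top_degree (H : IsTriangular K e) {d : ℕ}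
    (hd : HasInjectiveDimensionLE (ModuleCat.of Aᵐᵒᵖ A) d) (a : V) :
    ∃ n : ℕ, (∃ (k : V) (x : Ext (H.simple k) (projModule (e a)) n), x ≠ 0) ∧
      ∀ m, n < m → ∀ (X : ModuleCat.{max u v} Aᵐᵒᵖ), Module.Finite Aᵐᵒᵖ X →
        ∀ x : Ext X (projModule (e a)) m, x = 0 := by
  classical
  let p : ℕ → Prop := fun n => ∃ (k : V) (x : Ext (H.simple k) (projModule (e a)) n), x ≠ 0
  have hb : ∀ m, d < m → ¬ p m := by
    rintro m hm ⟨k, x, hx⟩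
    have : HasInjectiveDimensionLT (projModule (e a)) (d + 1) :=
      (projRetract (H.idem a)).hasInjectiveDimensionLT _
    exact hx (Ext.eq_zero_of_hasInjectiveDimensionLT x (d + 1) hm)
  have h0 : p 0 := by
    have := H.nontrivial_projModule a
    obtain ⟨k, f, hf⟩ := H.exists_simple_hom_ne_zero (X := projModule (e a))
    exact ⟨k, Ext.mk₀ (ModuleCat.ofHom f), fun h =>
      hf (congrArg ModuleCat.Hom.hom ((Ext.mk₀_eq_zero_iff _).1 h))⟩
  -- The largest degree in which some Ext from a simple to P(a) is nonzero; degree 0 always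
  -- qualifies, since P(a) has a nonzero socle.
  refine ⟨Nat.findGreatest p d, Nat.findGreatest_spec (Nat.zero_le d) h0, ?_⟩
  intro m hm X hX
  refine H.ext_eq_zero_of_simple_left fun k _ x => ?_
  by_contra hx
  rcases Nat.lt_or_ge d m with h | h
  · exact hb m h ⟨k, x, hx⟩
  · exact Nat.findGreatest_is_greatest hm h ⟨k, x, hx⟩

/-- In the top degree the cosyzygy is injective. -/
theorem IsTriangular.IsCosyzygy.inAdd {H : IsTriangular K e} {a : V} {n : ℕ}
    {M : ModuleCat.{max u v} Aᵐᵒᵖ} {ε : Ext M (projModule (e a)) n} (hM : H.IsCosyzygy a n M ε)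
    (hn : ∀ m, n < m → ∀ (X : ModuleCat.{max u v} Aᵐᵒᵖ), Module.Finite Aᵐᵒᵖ X →
        ∀ x : Ext X (projModule (e a)) m, x = 0) :
    InAdd (fun k => injModule.{u, v} K (e k))
      (fun k => ∃ x : Ext (H.simple k) (projModule (e a)) n, x ≠ 0) M := by
  have := hM.finite
  obtain ⟨E, j, hE, hj, hadd, -⟩ := H.exists_envelope' M
  have hS := shortExact_mkQ hj
  have hfin : Module.Finite Aᵐᵒᵖ (ModuleCat.of Aᵐᵒᵖ (E ⧸ LinearMap.range j.hom)) :=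
    inferInstanceAs (Module.Finite Aᵐᵒᵖ (E ⧸ LinearMap.range j.hom))
  -- Ext¹(E/M, M) embeds via ε into Ext^(1+n)(E/M, P(a)) = 0, so the identity of M extends to E and
  -- M is a summand of E.
  obtain ⟨y, hy⟩ := Ext.contravariant_sequence_exact₁ hS M (Ext.mk₀ (𝟙 M)) (add_comm 1 0)
    (hM.inj _ 1 (1 + n) rfl le_rfl _ (hn _ (by omega) _ hfin _))
  obtain ⟨r, rfl⟩ := (Ext.mk₀_bijective _ _).2 y
  rw [Ext.mk₀_comp_mk₀] at hy
  refine (hadd.of_retract ⟨j, r, (Ext.mk₀_bijective _ _).1 hy⟩).mono fun k ⟨f, hf⟩ => ?_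
  exact ⟨(Ext.mk₀ f).comp ε (zero_add n), fun h => hf (hM.inj_simple k f h)⟩

/-- A nonzero class on S(k) is f followed by ε, with f : S(k) → M. In the top degree f extends to
I(k), the extension is injective by essentiality of the socle, and it splits. So I(k) is a summand
of M and inherits the generating property of ε. -/
theorem IsTriangular.IsCosyzygy.exists_generator {H : IsTriangular K e} {a : V} {n : ℕ}
    {M : ModuleCat.{max u v} Aᵐᵒᵖ} {ε : Ext M (projModule (e a)) n} (hM : H.IsCosyzygy a n M ε)
    (hn : ∀ m, n < m → ∀ (X : ModuleCat.{max u v} Aᵐᵒᵖ), Module.Finite Aᵐᵒᵖ X →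
        ∀ x : Ext X (projModule (e a)) m, x = 0) {k : V}
    (hk : ∃ x : Ext (H.simple k) (projModule (e a)) n, x ≠ 0) :
    ∃ ε' : Ext (injModule.{u, v} K (e k)) (projModule (e a)) n, ε' ≠ 0 ∧
      ∀ (Y : ModuleCat.{max u v} Aᵐᵒᵖ) (y : Ext (injModule.{u, v} K (e k)) Y n),
        ∃ h : projModule (e a) ⟶ Y, y = ε'.comp (Ext.mk₀ h) (add_zero n) := by
  obtain ⟨x, hx⟩ := hk
  obtain ⟨x', rfl⟩ := hM.right _ 0 n (zero_add n) x
  obtain ⟨f, rfl⟩ := (Ext.mk₀_bijective _ _).2 x'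
  have hfd := H.finite
  have hj : Function.Injective (ModuleCat.ofHom (H.socle k)).hom :=
    H.simpleHom_injective (H.socle_ne_zero k)
  have hS := shortExact_mkQ hj
  have hfin : Module.Finite Aᵐᵒᵖ (ModuleCat.of Aᵐᵒᵖ (injModule.{u, v} K (e k) ⧸
      LinearMap.range (ModuleCat.ofHom (H.socle k)).hom)) :=
    inferInstanceAs (Module.Finite Aᵐᵒᵖ (injModule.{u, v} K (e k) ⧸ _))
  obtain ⟨y, hy⟩ := Ext.contravariant_sequence_exact₁ hS M (Ext.mk₀ f) (add_comm 1 0)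
    (hM.inj _ 1 (1 + n) rfl le_rfl _ (hn _ (by omega) _ hfin _))
  obtain ⟨F, rfl⟩ := (Ext.mk₀_bijective _ _).2 y
  rw [Ext.mk₀_comp_mk₀] at hy
  have hF := (Ext.mk₀_bijective _ _).1 hy
  have hFinj : Function.Injective F.hom := H.injective_of_comp_socle (g := F.hom) fun h0 => hx <| by
    have h1 : f = 0 := hF.symm.trans (ModuleCat.hom_ext h0)
    rw [h1, Ext.mk₀_zero, Ext.zero_comp]
  have hmono : Mono F := (ModuleCat.mono_iff_injective _).2 hFinj
  obtain ⟨r, hr⟩ := (injective_injModule.{u, v} (K := K) (H.idem k)).factors (𝟙 _) F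
  refine ⟨(Ext.mk₀ F).comp ε (zero_add n), fun h0 => hx ?_, fun Y y => ?_⟩
  · rw [← hF, ← Ext.mk₀_comp_mk₀, Ext.comp_assoc_of_second_deg_zero, h0, Ext.comp_zero]
  · obtain ⟨h, hh⟩ := hM.left Y ((Ext.mk₀ r).comp y (zero_add n))
    refine ⟨h, ?_⟩
    rw [Ext.comp_assoc_of_third_deg_zero, ← hh, Ext.mk₀_comp_mk₀_assoc, hr, Ext.mk₀_id_comp]

/-- The vertices `k` and `a` correspond to each other under the Auslander–Reiten bijection, in
degree `n`. -/
structure IsTriangular.IsARPair (H : IsTriangular K e) (k a : V) (n : ℕ) : Prop where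
  pd : HasProjectiveDimensionLE (injModule.{u, v} K (e k)) n
  generator : ∃ ε : Ext (injModule.{u, v} K (e k)) (projModule (e a)) n, ε ≠ 0 ∧
      ∀ (Y : ModuleCat.{max u v} Aᵐᵒᵖ) (y : Ext (injModule.{u, v} K (e k)) Y n),
        ∃ h : projModule (e a) ⟶ Y, y = ε.comp (Ext.mk₀ h) (add_zero n)

theorem IsTriangular.IsARPair.ext_simple_of_ne {H : IsTriangular K e} {k a : V} {n : ℕ}
    (h : H.IsARPair k a n) {b : V} (hb : b ≠ a)
    (x : Ext (injModule.{u, v} K (e k)) (H.simple b) n) : x = 0 := by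
  obtain ⟨ε, -, hε⟩ := h.generator
  obtain ⟨f, rfl⟩ := hε _ x
  rw [show f = 0 from ModuleCat.hom_ext (H.projHom_simple_of_ne hb f.hom), Ext.mk₀_zero,
    Ext.comp_zero]

/-- If Extⁿ(I(k), -) vanished on every simple, it would vanish on P(a) and kill the generator.
Simples other than S(a) receive no map from P(a), hence no class. -/
theorem IsTriangular.IsARPair.exists_ext_simple {H : IsTriangular K e} {k a : V} {n : ℕ}
    (h : H.IsARPair k a n) : ∃ x : Ext (injModule.{u, v} K (e k)) (H.simple a) n, x ≠ 0 := by
  by_contra! h0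
  obtain ⟨ε, hε, -⟩ := h.generator
  refine hε (H.ext_eq_zero_of_simple_right (fun b _ x => ?_) ε)
  by_cases hb : b = a
  · subst hb; exact h0 x
  · exact h.ext_simple_of_ne hb x

theorem IsTriangular.IsARPair.le_of_pd {H : IsTriangular K e} {k a : V} {n m : ℕ}
    (h : H.IsARPair k a n) (hm : HasProjectiveDimensionLE (injModule.{u, v} K (e k)) m) :
    n ≤ m := by
  by_contra! hlt
  obtain ⟨ε, hε, -⟩ := h.generator
  exact hε (Ext.eq_zero_of_hasProjectiveDimensionLT ε (m + 1) hlt)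

/-- Both data are read off from I(k): n is its projective dimension, and a is the only vertex with
Extⁿ(I(k), S(a)) ≠ 0. -/
theorem IsTriangular.IsARPair.unique {H : IsTriangular K e} {k a a' : V} {n n' : ℕ}
    (h : H.IsARPair k a n) (h' : H.IsARPair k a' n') : n = n' ∧ a = a' := by
  have hn : n = n' := le_antisymm (h.le_of_pd h'.pd) (h'.le_of_pd h.pd)
  subst hn
  refine ⟨rfl, ?_⟩
  by_contra hne
  obtain ⟨x, hx⟩ := h.exists_ext_simple
  exact hx (h'.ext_simple_of_ne hne x)

/-- The Auslander–Reiten bijection. -/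
theorem IsTriangular.exists_bijection (H : IsTriangular K e) (hgr : H.GradeCondition) {d : ℕ}
    (hd : HasInjectiveDimensionLE (ModuleCat.of Aᵐᵒᵖ A) d) :
    ∃ (ψ : Equiv.Perm V) (n : V → ℕ), (∀ k, H.IsARPair k (ψ k) (n k)) ∧
      (∀ k m, n k < m → ∀ (X : ModuleCat.{max u v} Aᵐᵒᵖ), Module.Finite Aᵐᵒᵖ X →
        ∀ x : Ext X (projModule (e (ψ k))) m, x = 0) ∧
      ∀ k, ∃ (M : ModuleCat.{max u v} Aᵐᵒᵖ) (ε : Ext M (projModule (e (ψ k))) (n k)),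
        InAdd (fun k => injModule.{u, v} K (e k)) (fun r => r = k) M ∧
        ∀ (X : ModuleCat.{max u v} Aᵐᵒᵖ) (x : Ext X (projModule (e (ψ k))) (n k)),
          ∃ f : X ⟶ M, x = (Ext.mk₀ f).comp ε (zero_add _) := by
  choose n hn hn' using H.exists_top_degree hd
  choose M ε hM using fun a => H.exists_isCosyzygy hgr a (n a)
  have hpair : ∀ a k, (∃ x : Ext (H.simple k) (projModule (e a)) (n a), x ≠ 0) →
      H.IsARPair k a (n a) := fun a k ⟨x, hx⟩ =>
    ⟨hgr.proj hx, (hM a).exists_generator (hn' a) ⟨x, hx⟩⟩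
  choose φ hφ using hn
  -- Choosing k for each a is injective because I(k) determines a; ψ is the inverse of the resulting
  -- bijection.
  have hφi : Function.Injective φ := fun a b hab => by
    have h1 := hpair a _ (hφ a)
    rw [hab] at h1
    exact (h1.unique (hpair b _ (hφ b))).2
  let Φ : Equiv.Perm V := Equiv.ofBijective φ (Finite.injective_iff_bijective.1 hφi)
  have hΦ : ∀ k, φ (Φ.symm k) = k := Φ.apply_symm_apply
  refine ⟨Φ.symm, fun k => n (Φ.symm k), fun k => ?_, fun k => hn' _, fun k => ?_⟩
  · have := hpair _ _ (hφ (Φ.symm k))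
    rwa [hΦ] at this
  · refine ⟨M _, ε _, ((hM _).inAdd (hn' _)).mono fun r hr => ?_, fun X x => ?_⟩
    · have h1 := hpair _ r hr
      have h2 := hpair _ _ (hφ (Φ.symm r))
      rw [hΦ] at h2
      exact Φ.symm.injective (h1.unique h2).2.symm
    · obtain ⟨x', rfl⟩ := (hM _).right X 0 _ (zero_add _) x
      obtain ⟨f, rfl⟩ := (Ext.mk₀_bijective _ _).2 x'
      exact ⟨f, rfl⟩

/-- All projective modules other than the last one in a minimal projective resolution of `I(r)`
come before the last one, in any natural labelling. -/
theorem IsTriangular.height_le_of_ext_ne_zero (H : IsTriangular K e) (hgr : H.GradeCondition)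
    {ψ : Equiv.Perm V} {n : V → ℕ} (hψ : ∀ k, H.IsARPair k (ψ k) (n k))
    (hn : ∀ k m, n k < m → ∀ (X : ModuleCat.{max u v} Aᵐᵒᵖ), Module.Finite Aᵐᵒᵖ X →
        ∀ x : Ext X (projModule (e (ψ k))) m, x = 0)
    (hM : ∀ k, ∃ (M : ModuleCat.{max u v} Aᵐᵒᵖ) (ε : Ext M (projModule (e (ψ k))) (n k)),
        InAdd (fun k => injModule.{u, v} K (e k)) (fun r => r = k) M ∧
        ∀ (X : ModuleCat.{max u v} Aᵐᵒᵖ) (x : Ext X (projModule (e (ψ k))) (n k)),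
          ∃ f : X ⟶ M, x = (Ext.mk₀ f).comp ε (zero_add _))
    {l : V → ℕ} (hl : IsHeight e l) (r b : V) (i : ℕ)
    (x : Ext (injModule.{u, v} K (e r)) (H.simple b) i) (hx : x ≠ 0) : l b ≤ l (ψ r) := by
  have hfd := H.finite
  -- the grade condition for modules of large projective dimension
  have hA : ∀ j k, ¬ HasProjectiveDimensionLE (injModule.{u, v} K (e k)) j → ∀ i ≤ j,
      ∀ x : Ext (H.simple k) (ModuleCat.of Aᵐᵒᵖ A) i, x = 0 := by
    intro j k hk i hi x
    by_contra hx
    have := hgr k i x hx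
    exact hk (hasProjectiveDimensionLT_of_ge _ (i + 1) _ (by omega))
  -- `Ext` in degree at least the projective dimension
  have htop : ∀ (q r : V) (j : ℕ), j ≤ n q →
      HasProjectiveDimensionLE (injModule.{u, v} K (e r)) j →
      (j = n q → r ≠ q) → ∀ x : Ext (injModule.{u, v} K (e r)) (H.simple (ψ q)) j, x = 0 := by
    intro q r j hj hpd hne x
    have h1 := (hψ r).le_of_pd hpd
    rcases Nat.lt_or_ge (n r) j with h2 | h2
    · have := (hψ r).pd
      exact Ext.eq_zero_of_hasProjectiveDimensionLT x (n r + 1) h2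
    · obtain rfl : n r = j := le_antisymm h1 h2
      by_cases hrq : r = q
      · subst hrq; exact absurd rfl (hne rfl)
      · exact (hψ r).ext_simple_of_ne (fun h => hrq (ψ.injective h).symm) x
  -- By detection only r' with n r' ≤ j matter. Either n r' < j and Ext vanishes for dimension
  -- reasons, or n r' = j < n q, so r' ≠ q and the class lives at another simple.
  have claim1 : ∀ (q : V) (j : ℕ), j < n q →
      ∀ (r : V) (x : Ext (injModule.{u, v} K (e r)) (H.simple (ψ q)) j), x = 0 := by
    intro q j
    induction j using Nat.strong_induction_on with
    | _ j ih =>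
      intro hj r x
      refine H.ext_injModule_eq_zero _ j (fun i hi => ih i hi (by omega)) (hA j) r x ?_
      intro r' hr' g
      exact htop q r' j hj.le hr' (fun h => by omega) _
  -- Detection again: the only possible contribution is from I(q) itself, and a composite I(q) →
  -- I(r) → I(q) vanishes by directedness.
  have claim2 : ∀ (q r : V), r ≠ q →
      ∀ (f : injModule.{u, v} K (e r) ⟶ injModule.{u, v} K (e q))
        (x : Ext (injModule.{u, v} K (e q)) (H.simple (ψ q)) (n q)),
        (Ext.mk₀ f).comp x (zero_add _) = 0 := by
    intro q r hrq f x
    refine H.ext_injModule_eq_zero _ (n q) (fun i hi => claim1 q i hi) (hA _) r _ ?_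
    intro r' hr' g
    by_cases hr'q : r' = q
    · subst hr'q
      have hgf : g ≫ f = 0 := by
        by_contra hne
        have hg : g.hom ≠ 0 := fun h => hne (by
          rw [show g = 0 from ModuleCat.hom_ext h, Limits.zero_comp])
        have hf : f.hom ≠ 0 := fun h => hne (by
          rw [show f = 0 from ModuleCat.hom_ext h, Limits.comp_zero])
        obtain ⟨y, hy⟩ := H.exists_of_injHom_ne_zero hg
        obtain ⟨z, hz⟩ := H.exists_of_injHom_ne_zero hf
        obtain ⟨h, hh⟩ := H.exists_height
        rcases hh _ _ _ hy with h1 | h1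
        · exact hrq h1
        rcases hh _ _ _ hz with h2 | h2
        · exact hrq h2.symm
        omega
      rw [Ext.mk₀_comp_mk₀_assoc, hgf, Ext.mk₀_zero, Ext.zero_comp]
    · exact htop q r' _ le_rfl hr' (fun _ => hr'q) _
  by_contra hlt
  -- choose a counterexample with maximal label
  classical
  let T : Finset V := Finset.univ.filter fun b => l (ψ r) < l b ∧
    ∃ (i : ℕ) (x : Ext (injModule.{u, v} K (e r)) (H.simple b) i), x ≠ 0
  have hT : T.Nonempty := ⟨b, Finset.mem_filter.2 ⟨Finset.mem_univ _, by omega, i, x, hx⟩⟩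
  obtain ⟨b, hbT, hmax⟩ := T.exists_max_image l hT
  obtain ⟨-, hlb, i, x, hx⟩ := Finset.mem_filter.1 hbT
  obtain ⟨q, rfl⟩ := ψ.surjective b
  have hS := LinearMap.shortExact_shortComplexKer (H.top_surjective (ψ q))
  let S := (H.top (ψ q)).shortComplexKer
  have hfin : Module.Finite Aᵐᵒᵖ S.X₁ :=
    H.finite_ker (M := projModule (e (ψ q))) (N := H.simple (ψ q)) (H.top (ψ q))
  -- The obstruction to lifting x to P(b) lies in Ext^(i+1)(I(r), rad P(b)). The composition factors
  -- of rad P(b) have larger labels than b, so it vanishes by the maximal choice of b.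
  obtain ⟨y, hy⟩ := Ext.covariant_sequence_exact₃ _ hS x rfl <| by
    refine H.ext_eq_zero_of_simple_right (Y := S.X₁) (fun c ⟨z, hz⟩ w => ?_) _
    by_contra hw
    have h1 := H.height_lt_of_ker_top hl hz
    have hc : c ∈ T := Finset.mem_filter.2 ⟨Finset.mem_univ _, by omega, _, w, hw⟩
    exact absurd (hmax c hc) (by omega)
  -- Ext into P(ψ q) stops after degree n q, and `claim1` excludes smaller degrees.
  have hi1 : i ≤ n q := by
    by_contra! h
    refine hx ?_
    rw [← hy, hn q i h _ inferInstance y, Ext.zero_comp]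
  have hi2 : n q ≤ i := by
    by_contra! h
    exact hx (claim1 q i h r x)
  obtain rfl : i = n q := le_antisymm hi1 hi2
  have hrq : r ≠ q := fun h => by subst h; omega
  -- The lift y is a map I(r) → M followed by ε, and M is in add of I(q) alone; so y passes through
  -- maps I(r) → I(q), to which `claim2` applies.
  obtain ⟨M, ε, ⟨ι, hι, k, p, g, hk, hpg⟩, hME⟩ := hM q
  obtain ⟨f, rfl⟩ := hME _ y
  refine hx ?_
  rw [← hy, ← Category.comp_id f, ← hpg, Preadditive.comp_sum, Ext.mk₀_sum, Ext.sum_comp,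
    Ext.sum_comp]
  have key : ∀ c, c = q → ∀ (p : M ⟶ injModule.{u, v} K (e c)) (g : injModule.{u, v} K (e c) ⟶ M),
      ((Ext.mk₀ (f ≫ p ≫ g)).comp ε (zero_add _)).comp
        (Ext.mk₀ (H.top (ψ q)).shortComplexKer.g) (add_zero _) = 0 := by
    rintro _ rfl p g
    rw [Ext.comp_assoc_of_third_deg_zero, ← Category.assoc, ← Ext.mk₀_comp_mk₀,
      Ext.comp_assoc_of_second_deg_zero]
    exact claim2 _ r hrq (f ≫ p) _
  exact Finset.sum_eq_zero fun t _ => key (k t) (hk t) (p t) (g t)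

end AR

end QuiverAlg

namespace QuiverAlg

open MulOpposite Abelian

/-! ### From the Auslander condition to the grade condition. -/

section Grade

variable {K : Type u} [Field K] {A : Type (max u v)} [Ring A] [Algebra K A] {V : Type*} [Fintype V]
  {e : V → A}

/-- The Auslander condition on an injective coresolution implies the grade condition. -/
theorem IsTriangular.gradeCondition (H : IsTriangular K e)
    (J : InjectiveResolution (ModuleCat.of Aᵐᵒᵖ A))
    (hJ : ∀ i : ℕ, HasProjectiveDimensionLE (J.cocomplex.X i) i) : H.GradeCondition := by
  intro k i x hx
  obtain ⟨f, hf, rfl⟩ := J.extMk_surjective x (i + 1) rfl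
  have hf0 : f ≠ 0 := by
    rintro rfl
    exact hx (J.extMk_zero _ _)
  have : Injective (J.cocomplex.X i) := J.injective i
  have := injective_injModule.{u, v} (K := K) (H.idem k)
  have hm : Mono (ModuleCat.ofHom (H.socle k)) :=
    (ModuleCat.mono_iff_injective _).2 (H.simpleHom_injective (H.socle_ne_zero k))
  -- The nonzero cocycle f : S(k) → Jⁱ extends to I(k). The extension is nonzero on the socle, hence
  -- injective, hence split, and I(k) inherits the bound on pdim Jⁱ.
  have hg := Injective.comp_factorThru f (ModuleCat.ofHom (H.socle k))
  set g := Injective.factorThru f (ModuleCat.ofHom (H.socle k))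
  have hgi : Mono g := (ModuleCat.mono_iff_injective _).2 <| H.injective_of_comp_socle fun h =>
    hf0 (hg ▸ ModuleCat.hom_ext h)
  have hr : Retract (injModule.{u, v} K (e k)) (J.cocomplex.X i) :=
    ⟨g, Injective.factorThru (𝟙 _) g, Injective.comp_factorThru _ _⟩
  have := hJ i
  exact hr.hasProjectiveDimensionLT (i + 1)

end Grade

/-! ### Dimension vectors of projective and injective modules. -/

section DimVec

open scoped ModuleCat.Algebra

variable (K : Type*) [Field K] {A : Type u} [Ring A] [Algebra K A]

/-- The `K`-space `X f` for a right module `X` and an idempotent `f`. -/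
def cornerSpace (f : A) (X : ModuleCat.{u} Aᵐᵒᵖ) : Submodule K X where
  carrier := {x | op f • x = x}
  add_mem' {x y} hx hy := by
    change op f • (x + y) = x + y
    rw [smul_add, show op f • x = x from hx, show op f • y = y from hy]
  zero_mem' := smul_zero _
  smul_mem' c x hx := by
    change op f • c • x = c • x
    rw [smul_comm, show op f • x = x from hx]

theorem mem_cornerSpace {f : A} {X : ModuleCat.{u} Aᵐᵒᵖ} {x : X} :
    x ∈ cornerSpace K f X ↔ op f • x = x := Iff.rfl

theorem finite_of_finite_right [Module.Finite K A] (X : ModuleCat.{u} Aᵐᵒᵖ)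
    [Module.Finite Aᵐᵒᵖ X] : Module.Finite K X :=
  Module.Finite.trans Aᵐᵒᵖ X

/-- The map on corner spaces induced by a homomorphism. -/
def cornerMap (f : A) {X Y : ModuleCat.{u} Aᵐᵒᵖ} (g : X →ₗ[Aᵐᵒᵖ] Y) :
    cornerSpace K f X →ₗ[K] cornerSpace K f Y :=
  (g.restrictScalars K).restrict fun x hx => by
    rw [mem_cornerSpace] at hx ⊢
    change op f • g x = g x
    rw [← map_smul, hx]

theorem finrank_cornerSpace_add [Module.Finite K A] {f : A} (hf : f * f = f)
    {S : ShortComplex (ModuleCat.{u} Aᵐᵒᵖ)} (hS : S.ShortExact) [Module.Finite Aᵐᵒᵖ S.X₂] :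
    Module.finrank K (cornerSpace K f S.X₂) =
      Module.finrank K (cornerSpace K f S.X₁) + Module.finrank K (cornerSpace K f S.X₃) := by
  have := finite_of_finite_right K S.X₂
  have hex := (ShortComplex.ShortExact.moduleCat_exact_iff_function_exact S).1 hS.exact
  have hinj := hS.moduleCat_injective_f
  have h1 : Function.Surjective (cornerMap K f S.g.hom) := by
    rintro ⟨z, hz⟩
    obtain ⟨y, rfl⟩ := hS.moduleCat_surjective_g z
    refine ⟨⟨op f • y, ?_⟩, Subtype.ext ?_⟩
    · rw [mem_cornerSpace, ← mul_smul, ← op_mul, hf]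
    · change S.g.hom (op f • y) = S.g.hom y
      rw [map_smul]
      exact hz
  have h2 : Function.Injective (cornerMap K f S.f.hom) := fun x y hxy =>
    Subtype.ext (hinj (congrArg Subtype.val hxy))
  have h3 : LinearMap.ker (cornerMap K f S.g.hom) = LinearMap.range (cornerMap K f S.f.hom) := by
    ext ⟨y, hy⟩
    constructor
    · intro h
      obtain ⟨x, rfl⟩ := (hex y).1 (congrArg Subtype.val h)
      refine ⟨⟨x, hinj ?_⟩, rfl⟩
      change S.f.hom _ = S.f.hom x
      rw [map_smul]
      exact hy
    · rintro ⟨⟨x, hx⟩, h⟩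
      refine Subtype.ext ?_
      rw [← h]
      exact (hex _).2 ⟨x, rfl⟩
  rw [← LinearMap.finrank_range_add_finrank_ker (cornerMap K f S.g.hom), h3,
    LinearMap.finrank_range_of_inj h2, LinearMap.range_eq_top.2 h1, finrank_top, add_comm]

theorem finrank_cornerSpace_pi [Module.Finite K A] (f : A) {ι : Type} [Fintype ι]
    (X : ι → ModuleCat.{u} Aᵐᵒᵖ) [∀ t, Module.Finite Aᵐᵒᵖ (X t)] :
    Module.finrank K (cornerSpace K f (ModuleCat.of Aᵐᵒᵖ ((t : ι) → X t))) =
      ∑ t, Module.finrank K (cornerSpace K f (X t)) := by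
  have := fun t => finite_of_finite_right K (X t)
  rw [← Module.finrank_pi_fintype]
  refine LinearEquiv.finrank_eq
    { toFun := fun x t => ⟨x.1 t, congrFun x.2 t⟩
      map_add' := fun _ _ => rfl
      map_smul' := fun _ _ => rfl
      invFun := fun y => ⟨fun t => (y t).1, funext fun t => (y t).2⟩
      left_inv := fun _ => rfl
      right_inv := fun _ => rfl }

/-- For e = e b and f = e a this is the entry (a, b) of ω: the columns of ω are the dimension
vectors of the projectives. -/
theorem finrank_cornerSpace_projModule {e : A} (he : e * e = e) {f : A} (hf : f * f = f) :
    Module.finrank K (cornerSpace K f (projModule e)) =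
      Module.finrank K (LinearMap.range (LinearMap.mulLeftRight K (e, f))) := by
  refine LinearEquiv.finrank_eq
    { toFun := fun x => ⟨x.1.1, x.1.1, ?_⟩
      map_add' := fun _ _ => rfl
      map_smul' := fun c x => Subtype.ext ?_
      invFun := fun y => ⟨⟨y.1, ?_⟩, ?_⟩
      left_inv := fun _ => rfl
      right_inv := fun _ => rfl }
  · have h : x.1.1 * f = x.1.1 := congrArg Subtype.val x.2
    rw [LinearMap.mulLeftRight_apply, mul_projModule he, h]
  · change x.1.1 * algebraMap K A c = c • x.1.1
    rw [Algebra.smul_def, Algebra.commutes]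
  · obtain ⟨x, hx⟩ := y.2
    rw [LinearMap.mulLeftRight_apply] at hx
    rw [← hx, mul_assoc]
    exact Submodule.mem_span_singleton.2 ⟨op (x * f), rfl⟩
  · obtain ⟨x, hx⟩ := y.2
    rw [LinearMap.mulLeftRight_apply] at hx
    refine Subtype.ext ?_
    change y.1 * f = y.1
    rw [← hx, mul_assoc, hf]

end DimVec

end QuiverAlg

namespace QuiverAlg

open MulOpposite Abelian

section DimVecInj

open scoped ModuleCat.Algebra

variable (K : Type u) [Field K] {A : Type (max u v)} [Ring A] [Algebra K A]

/-- D(A e) f is the dual of f A e, so the columns of ωᵀ are the dimension vectors of the injectives.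
-/
theorem finrank_cornerSpace_injModule (e : A) {f : A} (hf : f * f = f) :
    Module.finrank K (cornerSpace K f (injModule.{u, v} K e)) =
      Module.finrank K (LinearMap.range (LinearMap.mulLeftRight K (f, e))) := by
  have h1 : ∀ y : LinearMap.range (LinearMap.mulLeftRight K (f, e)),
      y.1 ∈ Submodule.span A ({e} : Set A) := by
    rintro ⟨_, x, rfl⟩
    change f * x * e ∈ _
    exact Submodule.mem_span_singleton.2 ⟨f * x, rfl⟩
  have h2 : ∀ y : Submodule.span A ({e} : Set A),
      f * y.1 ∈ LinearMap.range (LinearMap.mulLeftRight K (f, e)) := by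
    rintro ⟨y, hy⟩
    obtain ⟨c, rfl⟩ := Submodule.mem_span_singleton.1 hy
    exact ⟨c, mul_assoc f c e⟩
  have h3 : ∀ y : LinearMap.range (LinearMap.mulLeftRight K (f, e)), f * y.1 = y.1 := by
    rintro ⟨_, x, rfl⟩
    change f * (f * x * e) = f * x * e
    rw [← mul_assoc, ← mul_assoc, hf]
  rw [← Subspace.dual_finrank_eq (V := LinearMap.range (LinearMap.mulLeftRight K (f, e)))]
  let toF : cornerSpace K f (injModule.{u, v} K e) →
      Module.Dual K (LinearMap.range (LinearMap.mulLeftRight K (f, e))) := fun x =>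
    { toFun := fun y => (show Submodule.span A ({e} : Set A) →ₗ[K] K from x.1) ⟨y.1, h1 y⟩
      map_add' := fun y z =>
        (show Submodule.span A ({e} : Set A) →ₗ[K] K from x.1).map_add ⟨y.1, h1 y⟩ ⟨z.1, h1 z⟩
      map_smul' := fun c y =>
        (show Submodule.span A ({e} : Set A) →ₗ[K] K from x.1).map_smul c ⟨y.1, h1 y⟩ }
  let invF : Module.Dual K (LinearMap.range (LinearMap.mulLeftRight K (f, e))) →
      injModule.{u, v} K e := fun ψ => (show Submodule.span A ({e} : Set A) →ₗ[K] K from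
    { toFun := fun y => ψ ⟨f * y.1, h2 y⟩
      map_add' := fun y z => by
        rw [← map_add]
        exact congrArg ψ (Subtype.ext (mul_add f y.1 z.1))
      map_smul' := fun c y => by
        rw [RingHom.id_apply, ← map_smul]
        exact congrArg ψ (Subtype.ext (mul_smul_comm c f y.1)) })
  refine LinearEquiv.finrank_eq
    { toFun := toF
      map_add' := fun _ _ => rfl
      map_smul' := fun c x => LinearMap.ext fun y => ?_
      invFun := fun ψ => ⟨invF ψ, ?_⟩
      left_inv := fun x => Subtype.ext ?_
      right_inv := fun ψ => LinearMap.ext fun y => ?_ }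
  · change (show Submodule.span A ({e} : Set A) →ₗ[K] K from x.1) (algebraMap K A c • ⟨y.1, h1 y⟩) =
      c • (show Submodule.span A ({e} : Set A) →ₗ[K] K from x.1) ⟨y.1, h1 y⟩
    rw [algebraMap_smul, map_smul]
  · refine LinearMap.ext (M := Submodule.span A ({e} : Set A)) fun y => ?_
    refine congrArg ψ (Subtype.ext ?_)
    change f * (f * y.1) = f * y.1
    rw [← mul_assoc, hf]
  · refine LinearMap.ext (M := Submodule.span A ({e} : Set A)) fun y => ?_
    exact congrArg (fun z : injModule.{u, v} K e =>
      (show Submodule.span A ({e} : Set A) →ₗ[K] K from z) y) x.2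
  · exact congrArg ψ (Subtype.ext (h3 y))

end DimVecInj

section Span

open scoped ModuleCat.Algebra

/-- The dimension vector of a right module. -/
noncomputable def dimVec (K : Type*) [Field K] {A : Type u} [Ring A] [Algebra K A] {V : Type*}
    (e : V → A) (X : ModuleCat.{u} Aᵐᵒᵖ) (c : V) : ℝ :=
  Module.finrank K (cornerSpace K (e c) X)

theorem hom_eq_zero_of_ext {C : Type*} [Category.{v} C] [Abelian C] [HasExt.{w} C] {X Y : C}
    (h : ∀ x : Ext X Y 0, x = 0) (f : X ⟶ Y) : f = 0 :=
  (Ext.mk₀_bijective X Y).1 ((h _).trans (h _).symm)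

variable {K : Type u} [Field K] {A : Type (max u v)} [Ring A] [Algebra K A] {V : Type*} [Fintype V]
  {e : V → A}

/-- Dimension shift for projective covers. -/
theorem ext_simple_ker_eq_zero (H : IsTriangular K e) {Q X : ModuleCat.{max u v} Aᵐᵒᵖ}
    [Projective Q] {π : Q →ₗ[Aᵐᵒᵖ] X} (hπ : Function.Surjective π) {b : V}
    (hfac : ∀ g : Q →ₗ[Aᵐᵒᵖ] H.simple b, ∃ f : X →ₗ[Aᵐᵒᵖ] H.simple b, g = f ∘ₗ π) {i : ℕ}
    (h : ∀ x : Ext X (H.simple b) (i + 1), x = 0)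
    (x : Ext (ModuleCat.of Aᵐᵒᵖ (LinearMap.ker π)) (H.simple b) i) : x = 0 := by
  have hS := LinearMap.shortExact_shortComplexKer hπ
  obtain ⟨y, rfl⟩ := Ext.contravariant_sequence_exact₁ hS (H.simple b) x (add_comm 1 i) (h _)
  rcases Nat.eq_zero_or_pos i with rfl | hi
  -- In degree 0 minimality of the cover is what counts: every map from Q to a simple factors
  -- through π and so vanishes on the kernel.
  · obtain ⟨g, rfl⟩ := (Ext.mk₀_bijective _ _).2 y
    obtain ⟨f, hf⟩ := hfac g.hom
    rw [Ext.mk₀_comp_mk₀, show π.shortComplexKer.f ≫ g = 0 from ?_, Ext.mk₀_zero]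
    refine ModuleCat.hom_ext (LinearMap.ext fun z => ?_)
    change g.hom z.1 = 0
    rw [hf, LinearMap.comp_apply, show π z.1 = 0 from z.2, map_zero]
  · have : Projective π.shortComplexKer.X₂ := inferInstanceAs (Projective Q)
    rw [y.eq_zero_of_hasProjectiveDimensionLT 1 hi, Ext.comp_zero]

theorem IsTriangular.exists_cover_dimVec (H : IsTriangular K e) (X : ModuleCat.{max u v} Aᵐᵒᵖ)
    [Module.Finite Aᵐᵒᵖ X] : ∃ (Q : ModuleCat.{max u v} Aᵐᵒᵖ) (π : Q →ₗ[Aᵐᵒᵖ] X),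
      Module.Finite Aᵐᵒᵖ Q ∧ Projective Q ∧ Function.Surjective π ∧
      (∀ (a : V) (g : Q →ₗ[Aᵐᵒᵖ] H.simple a), ∃ f : X →ₗ[Aᵐᵒᵖ] H.simple a, g = f ∘ₗ π) ∧
      ∃ (ι : Type) (_ : Fintype ι) (k : ι → V), (∀ t, ∃ f : X ⟶ H.simple (k t), f ≠ 0) ∧
        dimVec K e Q = ∑ t, dimVec K e (projModule (e (k t))) := by
  have hfd := H.finite
  obtain ⟨ι, hι, k, F, hF, hk, hfac⟩ := H.exists_cover (X := X)
  refine ⟨ModuleCat.of Aᵐᵒᵖ ((t : ι) → projModule (e (k t))), F,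
    inferInstanceAs (Module.Finite Aᵐᵒᵖ ((t : ι) → projModule (e (k t)))),
    (inAdd_pi (fun k => projModule (e k)) (fun _ => True) k
      fun _ => trivial).projective fun k _ => projective_projModule (H.idem k),
    hF, hfac, ι, hι, k, fun t => ?_, funext fun c => ?_⟩
  · obtain ⟨f, hf⟩ := hk t
    exact ⟨ModuleCat.ofHom f, fun h => hf (congrArg ModuleCat.Hom.hom h)⟩
  · rw [Finset.sum_apply]
    exact (congrArg Nat.cast
      (finrank_cornerSpace_pi K (e c) fun t => projModule (e (k t)))).trans (Nat.cast_sum _ _)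

theorem IsTriangular.exists_syzygy_dimVec (H : IsTriangular K e) (X : ModuleCat.{max u v} Aᵐᵒᵖ)
    [Module.Finite Aᵐᵒᵖ X] : ∃ L : ModuleCat.{max u v} Aᵐᵒᵖ, Module.Finite Aᵐᵒᵖ L ∧
      (∀ b i, (∀ x : Ext X (H.simple b) (i + 1), x = 0) → ∀ x : Ext L (H.simple b) i, x = 0) ∧
      ∃ (ι : Type) (_ : Fintype ι) (k : ι → V), (∀ t, ∃ f : X ⟶ H.simple (k t), f ≠ 0) ∧
        dimVec K e X = ∑ t, dimVec K e (projModule (e (k t))) - dimVec K e L := by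
  have hfd := H.finite
  obtain ⟨Q, π, hQf, hQp, hπ, hfac, ι, _, k, hk, hQ⟩ := H.exists_cover_dimVec X
  have hS := LinearMap.shortExact_shortComplexKer hπ
  refine ⟨ModuleCat.of Aᵐᵒᵖ (LinearMap.ker π), H.finite_ker π, fun b i h x =>
    ext_simple_ker_eq_zero H hπ (hfac b) h x, ι, inferInstance, k, hk, ?_⟩
  rw [← hQ]
  funext c
  have : Module.Finite Aᵐᵒᵖ π.shortComplexKer.X₂ := hQf
  have h2 := finrank_cornerSpace_add K (H.idem c) hS
  simp only [Pi.sub_apply, dimVec]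
  rw [eq_sub_iff_add_eq', ← Nat.cast_add]
  exact congrArg Nat.cast h2.symm

/-- Euler characteristic of a minimal projective resolution: dim X is the dimension vector of the
cover minus that of the syzygy. P(b) enters the i-th term only if Extⁱ(X, S(b)) ≠ 0, so vertices in
T never appear. -/
theorem IsTriangular.dimVec_mem_span (H : IsTriangular K e) (T : Set V) (m : ℕ) :
    ∀ (X : ModuleCat.{max u v} Aᵐᵒᵖ), Module.Finite Aᵐᵒᵖ X →
      (∀ b i, m ≤ i → ∀ x : Ext X (H.simple b) i, x = 0) →
      (∀ b ∈ T, ∀ i, ∀ x : Ext X (H.simple b) i, x = 0) →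
      dimVec K e X ∈ Submodule.span ℝ ((fun b => dimVec K e (projModule (e b))) '' Tᶜ) := by
  induction m with
  | zero =>
    intro X _ h0 _
    have : Subsingleton X := by
      by_contra hX
      rw [not_subsingleton_iff_nontrivial] at hX
      obtain ⟨a, f, hf⟩ := H.exists_hom_simple_ne_zero (X := X)
      exact hf (congrArg ModuleCat.Hom.hom
        (hom_eq_zero_of_ext (h0 a 0 le_rfl) (ModuleCat.ofHom f)))
    have h : dimVec K e X = 0 := funext fun c => by
      have : Subsingleton (cornerSpace K (e c) X) :=
        ⟨fun x y => Subtype.ext (Subsingleton.elim (α := X) _ _)⟩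
      exact Nat.cast_eq_zero.2 (Module.finrank_zero_of_subsingleton (R := K))
    rw [h]
    exact zero_mem _
  | succ m ih =>
    intro X _ h0 hT
    obtain ⟨L, hL, hext, ι, _, k, hk, hX⟩ := H.exists_syzygy_dimVec X
    rw [hX]
    refine sub_mem (sum_mem fun t _ => Submodule.subset_span ⟨k t, fun ht => ?_, rfl⟩) <|
      ih L hL (fun b i hi => hext b i (h0 b _ (by omega))) fun b hb i => hext b i (hT b hb _)
    obtain ⟨f, hf⟩ := hk t
    exact hf (hom_eq_zero_of_ext (hT _ ht 0) f)

end Span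

end QuiverAlg

namespace QuiverAlg

/-! ### Bruhat decompositions. -/

section Bruhat

open scoped Matrix

variable {n : ℕ}

theorem perm_eq_one_of_le (σ : Equiv.Perm (Fin n)) (h : ∀ j, σ j ≤ j) : σ = 1 := by
  have h1 : ∑ j, ((σ j : Fin n) : ℕ) = ∑ j : Fin n, (j : ℕ) := Equiv.sum_comp σ fun j => (j : ℕ)
  have h2 := (Finset.sum_eq_sum_iff_of_le fun j _ => Fin.le_def.1 (h j)).1 h1
  exact Equiv.ext fun j => Fin.ext (h2 j (Finset.mem_univ j))

/-- The permutation in a Bruhat decomposition of an invertible matrix is unique. -/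
theorem IsBruhatPermutation.unique {M : Matrix (Fin n) (Fin n) ℝ} (hM : M.det ≠ 0)
    {p q : Equiv.Perm (Fin n)} (hp : IsBruhatPermutation M p) (hq : IsBruhatPermutation M q) :
    p = q := by
  obtain ⟨U₁, U₂, hU₁, hU₂, h⟩ := hp
  obtain ⟨W₁, W₂, hW₁, hW₂, h'⟩ := hq
  set P : Matrix (Fin n) (Fin n) ℝ := Matrix.of fun i j => if i = p j then (1 : ℝ) else 0 with hP
  set Q : Matrix (Fin n) (Fin n) ℝ := Matrix.of fun i j => if i = q j then (1 : ℝ) else 0 with hQ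
  have hd := hM
  have hd' := hM
  rw [h, Matrix.det_mul, Matrix.det_mul] at hd
  rw [h', Matrix.det_mul, Matrix.det_mul] at hd'
  have u1 : IsUnit U₁.det := isUnit_iff_ne_zero.2 fun h0 => hd (by simp [h0])
  have u2 : IsUnit U₂.det := isUnit_iff_ne_zero.2 fun h0 => hd (by simp [h0])
  have w1 : IsUnit W₁.det := isUnit_iff_ne_zero.2 fun h0 => hd' (by simp [h0])
  have i2 : Invertible U₂ := U₂.invertibleOfIsUnitDet u2
  have j1 : Invertible W₁ := W₁.invertibleOfIsUnitDet w1
  have hU : (W₁⁻¹ * U₁).BlockTriangular id :=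
    (Matrix.blockTriangular_inv_of_blockTriangular hW₁).mul hU₁
  have hW : (W₂ * U₂⁻¹).BlockTriangular id :=
    hW₂.mul (Matrix.blockTriangular_inv_of_blockTriangular hU₂)
  have key : W₁⁻¹ * U₁ * P = Q * (W₂ * U₂⁻¹) := by
    have h3 : U₁ * P * U₂ = W₁ * Q * W₂ := h.symm.trans h'
    calc W₁⁻¹ * U₁ * P = W₁⁻¹ * (U₁ * P * U₂) * U₂⁻¹ := by
          simp only [Matrix.mul_assoc, Matrix.mul_nonsing_inv U₂ u2, Matrix.mul_one]
      _ = Q * (W₂ * U₂⁻¹) := by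
          rw [h3]
          simp only [← Matrix.mul_assoc, Matrix.nonsing_inv_mul W₁ w1, Matrix.one_mul]
  have hdet : (W₁⁻¹ * U₁).det ≠ 0 := by
    rw [Matrix.det_mul]
    exact mul_ne_zero ((Matrix.isUnit_nonsing_inv_det_iff.2 w1).ne_zero) u1.ne_zero
  rw [Matrix.det_of_isUpperTriangular hU, Finset.prod_ne_zero_iff] at hdet
  generalize W₁⁻¹ * U₁ = U at key hU hdet
  generalize W₂ * U₂⁻¹ = W at key hW
  -- Compare entries at (p j, j): the left side is a nonzero diagonal entry of U, the right side is
  -- the entry (q⁻¹(p j), j) of the upper triangular W.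
  have hle : ∀ j, (p.trans q.symm) j ≤ j := by
    intro j
    by_contra! hlt
    have h1 := congrFun (congrFun key (p j)) j
    rw [Matrix.mul_apply, Finset.sum_eq_single (p j), Matrix.mul_apply,
      Finset.sum_eq_single (q.symm (p j))] at h1
    · simp only [hP, hQ, Matrix.of_apply, Equiv.apply_symm_apply, if_true, mul_one, one_mul] at h1
      exact hdet (p j) (Finset.mem_univ _) (h1.trans (hW hlt))
    · intro k _ hk
      rw [hQ, Matrix.of_apply, if_neg, zero_mul]
      exact fun h => hk (by rw [h, Equiv.symm_apply_apply])
    · simp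
    · intro k _ hk
      rw [hP, Matrix.of_apply, if_neg hk, mul_zero]
    · simp
  have := perm_eq_one_of_le _ hle
  ext j
  have := congrArg q (Equiv.congr_fun this j)
  simp at this
  rw [this]

/-- With P the matrix of p, -ωᵀω⁻¹ = -(ωᵀ N P⁻¹) · P · (ωᵀ)⁻¹. The support condition on N says
exactly that N P⁻¹ is upper triangular. -/
theorem isBruhatPermutation_of_transpose_eq {ω N : Matrix (Fin n) (Fin n) ℝ}
    (hω : ωᵀ.BlockTriangular id) (hdet : IsUnit ω.det) {p : Equiv.Perm (Fin n)} (h : ωᵀ = ω * N)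
    (hN : ∀ b r, N b r ≠ 0 → b ≤ p r) : IsBruhatPermutation (-(ωᵀ * ω⁻¹)) p := by
  have hdet' : IsUnit ωᵀ.det := by rwa [Matrix.det_transpose]
  have : Invertible ωᵀ := ωᵀ.invertibleOfIsUnitDet hdet'
  refine ⟨-(ωᵀ * Matrix.of fun b s => N b (p.symm s)), ωᵀ⁻¹, ?_,
    Matrix.blockTriangular_inv_of_blockTriangular hω, ?_⟩
  · refine (hω.mul fun b s hbs => ?_).neg
    by_contra h0
    have := hN _ _ h0
    rw [Equiv.apply_symm_apply] at this
    exact absurd hbs (not_lt.2 this)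
  · have h1 : (Matrix.of fun b s => N b (p.symm s)) *
        (Matrix.of fun i j => if i = p j then (1 : ℝ) else 0) = N := by
      ext i j
      rw [Matrix.mul_apply, Finset.sum_eq_single (p j)]
      · simp
      · intro k _ hk
        rw [Matrix.of_apply, Matrix.of_apply, if_neg hk, mul_zero]
      · simp
    have h2 : ω⁻¹ = N * ωᵀ⁻¹ := by
      have h3 : ω⁻¹ * (ω * N) * ωᵀ⁻¹ = N * ωᵀ⁻¹ := by
        rw [← Matrix.mul_assoc, Matrix.nonsing_inv_mul ω hdet, Matrix.one_mul]
      rw [← h3, ← h, Matrix.mul_assoc, Matrix.mul_nonsing_inv _ hdet', Matrix.mul_one]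
    rw [neg_mul, neg_mul, Matrix.mul_assoc ωᵀ, h1, Matrix.mul_assoc, ← h2]

end Bruhat

end QuiverAlg

namespace QuiverAlg

open MulOpposite Abelian

/-! ### The Cartan matrix and the Coxeter permutation. -/

section Cartan

open scoped Matrix

variable {K : Type*} [Field K] {A : Type*} [Ring A] [Algebra K A] {V : Type*}
  {e : V → A}

theorem cartanMatrix_transpose_blockTriangular (K : Type*) [Field K] [Algebra K A] {n : ℕ}
    (l : V ≃ Fin n) (hl : IsHeight e fun a => (l a : ℕ)) :
    (cartanMatrix K fun i => e (l.symm i))ᵀ.BlockTriangular id := by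
  intro i j hij
  have h : LinearMap.mulLeftRight K (e (l.symm i), e (l.symm j)) = 0 := by
    refine LinearMap.ext fun x => ?_
    rw [LinearMap.mulLeftRight_apply]
    by_contra h0
    rcases hl _ _ _ h0 with h1 | h1
    · rw [l.symm.injective h1] at hij
      exact lt_irrefl _ hij
    · simp only [l.apply_symm_apply] at h1
      exact absurd hij (not_lt.2 (Fin.le_def.2 h1.le))
  change ((Module.finrank K (LinearMap.range (LinearMap.mulLeftRight K
    (e (l.symm i), e (l.symm j)))) : ℕ) : ℝ) = 0
  rw [h, LinearMap.range_zero, finrank_bot, Nat.cast_zero]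

theorem IsTriangular.finrank_corner [Fintype V] (H : IsTriangular K e) (a : V) :
    Module.finrank K (LinearMap.range (LinearMap.mulLeftRight K (e a, e a))) = 1 := by
  have h : LinearMap.range (LinearMap.mulLeftRight K (e a, e a)) = Submodule.span K {e a} := by
    apply le_antisymm
    · rintro _ ⟨x, rfl⟩
      obtain ⟨c, hc⟩ := H.corner a x
      rw [LinearMap.mulLeftRight_apply, hc]
      exact Submodule.smul_mem _ _ (Submodule.mem_span_singleton_self _)
    · rw [Submodule.span_singleton_le_iff_mem]
      refine ⟨1, ?_⟩
      rw [LinearMap.mulLeftRight_apply, mul_one, H.idem]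
  rw [h, finrank_span_singleton (H.ne_zero a)]

theorem IsTriangular.det_cartanMatrix [Fintype V] (H : IsTriangular K e) {n : ℕ}
    (l : V ≃ Fin n) (hl : IsHeight e fun a => (l a : ℕ)) :
    (cartanMatrix K fun i => e (l.symm i)).det = 1 := by
  rw [← Matrix.det_transpose,
    Matrix.det_of_isUpperTriangular (cartanMatrix_transpose_blockTriangular K l hl)]
  refine Finset.prod_eq_one fun i _ => ?_
  rw [Matrix.transpose_apply, cartanMatrix, Matrix.of_apply, H.finrank_corner, Nat.cast_one]

end Cartan

section Coxeter

open scoped Matrix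

variable {K : Type u} [Field K] {A : Type (max u v)} [Ring A] [Algebra K A] {V : Type*} [Fintype V]
  {e : V → A}

/-- The coefficients c form the column r of the matrix N with ωᵀ = ωN; T will be the set of vertices
labelled after ψ(r). -/
theorem IsTriangular.dimVec_injModule_eq_sum (H : IsTriangular K e) {m : ℕ} (T : Set V) (r : V)
    (hpd : HasProjectiveDimensionLE (injModule.{u, v} K (e r)) m)
    (hT : ∀ b ∈ T, ∀ i, ∀ x : Ext (injModule.{u, v} K (e r)) (H.simple b) i, x = 0) :
    ∃ c : V → ℝ, (∀ b, c b ≠ 0 → b ∉ T) ∧ ∀ a,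
      (Module.finrank K (LinearMap.range (LinearMap.mulLeftRight K (e a, e r))) : ℝ) =
        ∑ b, Module.finrank K (LinearMap.range (LinearMap.mulLeftRight K (e b, e a))) * c b := by
  have hfd := H.finite
  have h := H.dimVec_mem_span T (m + 1) (injModule.{u, v} K (e r)) inferInstance
    (fun b i hi x => x.eq_zero_of_hasProjectiveDimensionLT (m + 1) hi) hT
  obtain ⟨c, hc, hsum⟩ := (Finsupp.mem_span_image_iff_linearCombination ℝ).1 h
  refine ⟨c, fun b hb => hc (Finsupp.mem_support_iff.2 hb), fun a => ?_⟩
  have h1 := congrFun hsum a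
  rw [Finsupp.linearCombination_apply, Finsupp.sum_fintype _ _ (by simp), Finset.sum_apply] at h1
  rw [← finrank_cornerSpace_injModule.{u, v} K (e r) (H.idem a)]
  refine h1.symm.trans (Finset.sum_congr rfl fun b _ => ?_)
  rw [← finrank_cornerSpace_projModule K (H.idem b) (H.idem a), mul_comm]
  rfl

/-- The Coxeter permutation, with respect to any labelling for which the Cartan matrix is
triangular. -/
theorem IsTriangular.isBruhatPermutation_coxeterMatrix_iff (H : IsTriangular K e)
    (ψ : Equiv.Perm V) (hpd : ∀ r, ∃ m, HasProjectiveDimensionLE (injModule.{u, v} K (e r)) m)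
    {n : ℕ} (l : V ≃ Fin n) (hl : IsHeight e fun a => (l a : ℕ))
    (hle : ∀ (r b : V) (i : ℕ) (x : Ext (injModule.{u, v} K (e r)) (H.simple b) i), x ≠ 0 →
      (l b : ℕ) ≤ l (ψ r)) (p : Equiv.Perm (Fin n)) :
    IsBruhatPermutation (coxeterMatrix K fun i => e (l.symm i)) p ↔ l.symm.permCongr p = ψ := by
  set ω := cartanMatrix K fun i => e (l.symm i) with hω
  have hdet : IsUnit ω.det := by rw [hω, H.det_cartanMatrix l hl]; exact isUnit_one
  have hc : ∀ r, ∃ c : V → ℝ, (∀ b, c b ≠ 0 → b ∉ {b | l (ψ r) < l b}) ∧ ∀ a,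
      (Module.finrank K (LinearMap.range (LinearMap.mulLeftRight K (e a, e r))) : ℝ) =
        ∑ b, Module.finrank K (LinearMap.range (LinearMap.mulLeftRight K (e b, e a))) * c b := by
    intro r
    obtain ⟨m, hm⟩ := hpd r
    refine H.dimVec_injModule_eq_sum _ r hm fun b hb i x => ?_
    by_contra hx
    exact absurd hb (not_lt.2 (Fin.le_def.2 (hle r b i x hx)))
  choose c hc hsum using hc
  have hex : IsBruhatPermutation (-(ωᵀ * ω⁻¹)) (l.permCongr ψ) := by
    refine isBruhatPermutation_of_transpose_eq
      (N := Matrix.of fun b r => c (l.symm r) (l.symm b))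
      (cartanMatrix_transpose_blockTriangular K l hl) hdet ?_ fun b r hbr => ?_
    · ext i r
      rw [Matrix.mul_apply]
      refine (hsum (l.symm r) (l.symm i)).trans ?_
      exact (Equiv.sum_comp l.symm fun b => (Module.finrank K (LinearMap.range
        (LinearMap.mulLeftRight K (e b, e (l.symm i)))) : ℝ) * c (l.symm r) b).symm
    · have := hc _ _ hbr
      exact (l.apply_symm_apply b).ge.trans (not_lt.1 this)
  have hM : (-(ωᵀ * ω⁻¹)).det ≠ 0 := by
    rw [Matrix.det_neg, Matrix.det_mul, Matrix.det_transpose]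
    exact mul_ne_zero (pow_ne_zero _ (by norm_num))
      (mul_ne_zero hdet.ne_zero (Matrix.isUnit_nonsing_inv_det_iff.2 hdet).ne_zero)
  have h2 : l.symm.permCongr p = ψ ↔ p = l.permCongr ψ := by
    rw [← Equiv.permCongr_symm, Equiv.symm_apply_eq]
  rw [h2]
  exact ⟨fun h => IsBruhatPermutation.unique hM h hex, fun h => h ▸ hex⟩

end Coxeter

end QuiverAlg

namespace QuiverAlg

open MulOpposite Abelian

/-! ### Syzygies and the Auslander–Reiten map. -/

section Syzygy

variable {K : Type*} [Field K] {A : Type u} [Ring A] [Algebra K A] {V : Type*} [Fintype V]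
  {e : V → A}

theorem IsSyzygy.of_iso {R : Type u} [Ring R] {N N' : ModuleCat.{u} R} (α : N ≅ N') {n : ℕ} :
    ∀ {M : ModuleCat.{u} R}, IsSyzygy n M N → IsSyzygy n M N' := by
  induction n with
  | zero => exact fun ⟨β⟩ => ⟨β ≪≫ α⟩
  | succ n ih => exact fun ⟨P, f, hP, hf, hs, h⟩ => ⟨P, f, hP, hf, hs, ih h⟩

theorem IsSyzygy.projective {R : Type u} [Ring R] {N : ModuleCat.{u} R} {n : ℕ} :
    ∀ {M : ModuleCat.{u} R}, IsSyzygy n M N → HasProjectiveDimensionLE M n → Projective N := by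
  induction n with
  | zero =>
    intro M ⟨α⟩ hM
    have := hasProjectiveDimensionLT_of_iso α 1
    exact (projective_iff_hasProjectiveDimensionLE_zero N).2 this
  | succ n ih =>
    intro M ⟨P, f, hP, hf, _, h⟩ hM
    exact ih h (((LinearMap.shortExact_shortComplexKer hf).hasProjectiveDimensionLT_X₃_iff n hP).1
      hM)

/-- The kernel of a nonzero map to a one-dimensional module is maximal; if it missed part of N, it
would together with N give all of P. -/
theorem IsTriangular.simple_eq_zero_of_isSuperfluous (H : IsTriangular K e)
    {P : ModuleCat.{u} Aᵐᵒᵖ} {N : Submodule Aᵐᵒᵖ P} (hN : IsSuperfluous N) {b : V}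
    (g : P →ₗ[Aᵐᵒᵖ] H.simple b) {x : P} (hx : x ∈ N) : g x = 0 := by
  by_contra h0
  have h : N ⊔ LinearMap.ker g = ⊤ := by
    refine eq_top_iff.2 fun y _ => ?_
    obtain ⟨c, hc⟩ := H.exists_smul_simpleGen (g x)
    obtain ⟨d, hd⟩ := H.exists_smul_simpleGen (g y)
    have hc0 : c ≠ 0 := by
      rintro rfl
      exact h0 (by rw [hc, map_zero, op_zero, zero_smul])
    have hy : g y = op (algebraMap K A (c⁻¹ * d)) • g x := by
      rw [hd, hc, ← mul_smul, ← op_mul, ← map_mul, mul_inv_cancel_left₀ hc0]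
    rw [← add_sub_cancel (op (algebraMap K A (c⁻¹ * d)) • x) y]
    refine add_mem (Submodule.mem_sup_left (N.smul_mem _ hx)) (Submodule.mem_sup_right ?_)
    rw [LinearMap.mem_ker, map_sub, map_smul, hy, sub_self]
  have h1 := hN _ h
  have h2 : x ∈ LinearMap.ker g := h1 ▸ Submodule.mem_top
  exact h0 h2

/-- The universal extension that belongs to a syzygy. -/
theorem IsTriangular.exists_ext_of_isSyzygy (H : IsTriangular K e) {N : ModuleCat.{u} Aᵐᵒᵖ}
    {n : ℕ} : ∀ {M : ModuleCat.{u} Aᵐᵒᵖ}, IsSyzygy n M N → ∃ η : Ext M N n,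
      (∀ (b : V) (h : N ⟶ H.simple b), η.comp (Ext.mk₀ h) (add_zero n) = 0 → h = 0) ∧
      ∀ (Y : ModuleCat.{u} Aᵐᵒᵖ) (y : Ext M Y n),
        ∃ h : N ⟶ Y, y = η.comp (Ext.mk₀ h) (add_zero n) := by
  induction n with
  | zero =>
    intro M ⟨α⟩
    refine ⟨Ext.mk₀ α.hom, fun b h hh => ?_, fun Y y => ?_⟩
    · rw [Ext.mk₀_comp_mk₀, Ext.mk₀_eq_zero_iff] at hh
      rw [← Category.id_comp h, ← α.inv_hom_id, Category.assoc, hh, Limits.comp_zero]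
    · obtain ⟨h, rfl⟩ := (Ext.mk₀_bijective _ _).2 y
      exact ⟨α.inv ≫ h, by rw [Ext.mk₀_comp_mk₀, Iso.hom_inv_id_assoc]⟩
  | succ n ih =>
    intro M ⟨P, f, hP, hf, hs, h⟩
    have hS := LinearMap.shortExact_shortComplexKer hf
    have hP' : Projective f.hom.shortComplexKer.X₂ := hP
    obtain ⟨η, h1, h2⟩ := ih h
    refine ⟨hS.extClass.comp η (add_comm 1 n), fun b g hg => h1 b g ?_, fun Y y => ?_⟩
    · rw [Ext.comp_assoc_of_third_deg_zero] at hg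
      obtain ⟨z, hz⟩ := Ext.contravariant_sequence_exact₁ hS _ _ (add_comm 1 n) hg
      rw [← hz]
      -- For n = 0 the restriction of q to the superfluous kernel vanishes; for n ≥ 1 projectivity
      -- of P kills z.
      rcases Nat.eq_zero_or_pos n with rfl | hn
      · obtain ⟨q, rfl⟩ := (Ext.mk₀_bijective _ _).2 z
        rw [Ext.mk₀_comp_mk₀, show f.hom.shortComplexKer.f ≫ q = 0 from ?_, Ext.mk₀_zero]
        exact ModuleCat.hom_ext (LinearMap.ext fun x =>
          H.simple_eq_zero_of_isSuperfluous hs q.hom x.2)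
      · rw [z.eq_zero_of_hasProjectiveDimensionLT 1 hn, Ext.comp_zero]
    · obtain ⟨y', rfl⟩ := Ext.contravariant_sequence_exact₃ hS Y y
        (Ext.eq_zero_of_hasProjectiveDimensionLT _ 1 (by omega)) (add_comm 1 n)
      obtain ⟨g, rfl⟩ := h2 Y y'
      exact ⟨g, (Ext.comp_assoc_of_third_deg_zero _ _ _ _).symm⟩

end Syzygy

section AuslanderReiten

variable {K : Type u} [Field K] {A : Type (max u v)} [Ring A] [Algebra K A] {V : Type*} [Fintype V]
  {e : V → A}

theorem IsTriangular.exists_isSyzygy (H : IsTriangular K e) (n : ℕ) :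
    ∀ (M : ModuleCat.{max u v} Aᵐᵒᵖ), Module.Finite Aᵐᵒᵖ M →
      ∃ N : ModuleCat.{max u v} Aᵐᵒᵖ, Module.Finite Aᵐᵒᵖ N ∧ IsSyzygy n M N := by
  induction n with
  | zero => exact fun M hM => ⟨M, hM, ⟨Iso.refl M⟩⟩
  | succ n ih =>
    intro M _
    obtain ⟨Q, π, hQ, hπ, hadd, hfac⟩ := H.exists_cover' M
    obtain ⟨N, hN, h⟩ := ih (ModuleCat.of Aᵐᵒᵖ (LinearMap.ker π.hom)) (H.finite_ker π.hom)
    refine ⟨N, hN, Q, π, hadd.projective fun k _ => projective_projModule (H.idem k), hπ,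
      fun L hL => ?_, h⟩
    -- A proper L would yield a nonzero map Q → S(a) vanishing on L. It factors through π, so it
    -- also vanishes on the kernel, hence everywhere.
    by_contra hne
    have : Nontrivial (Q ⧸ L) := Submodule.Quotient.nontrivial_iff.2 hne
    obtain ⟨a, g, hg⟩ := H.exists_hom_simple_ne_zero (X := Q ⧸ L)
    obtain ⟨f, hf⟩ := hfac a (ModuleCat.ofHom (g ∘ₗ L.mkQ))
    have h1 : LinearMap.ker (g ∘ₗ L.mkQ) = ⊤ := by
      rw [eq_top_iff, ← hL, sup_le_iff]
      constructor
      · intro x hx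
        have h2 := LinearMap.congr_fun (congrArg ModuleCat.Hom.hom hf) x
        refine h2.trans ?_
        change f.hom (π.hom x) = 0
        rw [show π.hom x = 0 from hx, map_zero]
      · intro x hx
        change g (L.mkQ x) = 0
        rw [show L.mkQ x = 0 from (Submodule.Quotient.mk_eq_zero L).2 hx, map_zero]
    refine hg (LinearMap.ext fun x => ?_)
    obtain ⟨x, rfl⟩ := L.mkQ_surjective x
    exact LinearMap.mem_ker.1 (h1 ▸ Submodule.mem_top : x ∈ LinearMap.ker (g ∘ₗ L.mkQ))

/-- The syzygy N and P(a) both carry a generator of Extⁿ(I(k), -), which gives f : P(a) → N. It is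
onto because the class of N is not killed by any nonzero map to a simple. It splits as N is
projective, and since End P(a) = K it is also injective. -/
theorem IsTriangular.IsARPair.isSyzygy {H : IsTriangular K e} {k a : V} {n : ℕ}
    (h : H.IsARPair k a n) : IsSyzygy n (injModule.{u, v} K (e k)) (projModule (e a)) := by
  have := H.finite
  obtain ⟨N, hN, hsyz⟩ := H.exists_isSyzygy n (injModule.{u, v} K (e k)) inferInstance
  have hNp := hsyz.projective h.pd
  obtain ⟨η, h1, h2⟩ := H.exists_ext_of_isSyzygy hsyz
  obtain ⟨ε, hε, h3⟩ := h.generator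
  obtain ⟨f, hf⟩ := h3 N η
  have hsurj : Function.Surjective f.hom := by
    rw [← LinearMap.range_eq_top]
    by_contra hne
    have : Nontrivial (N ⧸ LinearMap.range f.hom) := Submodule.Quotient.nontrivial_iff.2 hne
    obtain ⟨b, g, hg⟩ := H.exists_hom_simple_ne_zero (X := N ⧸ LinearMap.range f.hom)
    have h4 := h1 b (ModuleCat.ofHom (g ∘ₗ (LinearMap.range f.hom).mkQ)) <| by
      rw [hf, Ext.comp_assoc_of_third_deg_zero, Ext.mk₀_comp_mk₀, show
        f ≫ ModuleCat.ofHom (g ∘ₗ (LinearMap.range f.hom).mkQ) = 0 from ?_, Ext.mk₀_zero,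
        Ext.comp_zero]
      refine ModuleCat.hom_ext (LinearMap.ext fun x => ?_)
      change g ((LinearMap.range f.hom).mkQ (f.hom x)) = 0
      rw [show (LinearMap.range f.hom).mkQ (f.hom x) = 0 from
        (Submodule.Quotient.mk_eq_zero _).2 (LinearMap.mem_range_self _ x), map_zero]
    refine hg (LinearMap.ext fun x => ?_)
    obtain ⟨x, rfl⟩ := (LinearMap.range f.hom).mkQ_surjective x
    exact LinearMap.congr_fun (congrArg ModuleCat.Hom.hom h4) x
  have hepi : Epi f := (ModuleCat.epi_iff_surjective f).2 hsurj
  let s : N ⟶ projModule (e a) := Projective.factorThru (𝟙 N) f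
  have hs : s ≫ f = 𝟙 N := Projective.factorThru_comp _ _
  have hf0 : f ≠ 0 := by
    rintro rfl
    obtain ⟨g, hg⟩ := h2 _ ε
    rw [hf, Ext.mk₀_zero, Ext.comp_zero, Ext.zero_comp] at hg
    exact hε hg
  have hinj : Function.Injective f.hom := by
    -- f followed by its section s is an endomorphism of P(a), hence a scalar c, and c ≠ 0 because f
    -- ≠ 0.
    set x := (f ≫ s).hom (projGen (e a)) with hx
    have hx1 : op (e a) • x = x := op_smul_map_projGen (H.idem a) _
    obtain ⟨c, hc⟩ := H.corner a x.1
    have hxc : x = op (algebraMap K A c) • projGen (e a) := by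
      refine Subtype.ext ?_
      have hx2 : x.1 * e a = x.1 := congrArg Subtype.val hx1
      rw [mul_projModule (H.idem a), hx2] at hc
      rw [hc, Algebra.smul_def, Algebra.commutes]
      rfl
    have hall : ∀ y, (f ≫ s).hom y = op (algebraMap K A c) • y := by
      intro y
      rw [projHom_apply (H.idem a) (f ≫ s).hom y, ← hx, hxc, IsTriangular.op_algebraMap_comm,
        op_smul_projGen (H.idem a)]
    have hc0 : c ≠ 0 := by
      rintro rfl
      refine hf0 ?_
      rw [← Category.comp_id f, ← hs, ← Category.assoc, show f ≫ s = 0 from ?_, Limits.zero_comp]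
      refine ModuleCat.hom_ext (LinearMap.ext fun y => ?_)
      rw [hall, map_zero, op_zero, zero_smul]
      rfl
    refine (injective_iff_map_eq_zero f.hom).2 fun y hy => ?_
    have h5 := hall y
    rw [show (f ≫ s).hom y = s.hom (f.hom y) from rfl, hy, map_zero] at h5
    have h6 : op (algebraMap K A c⁻¹) • op (algebraMap K A c) • y = y := by
      rw [← mul_smul, ← op_mul, ← map_mul, mul_inv_cancel₀ hc0, map_one, op_one, one_smul]
    rw [← h6, ← h5, smul_zero]
  exact hsyz.of_iso (LinearEquiv.ofBijective f.hom ⟨hinj, hsurj⟩).toModuleIso.symm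

theorem IsTriangular.IsARPair.projectiveDimension_eq {H : IsTriangular K e} {k a : V} {n : ℕ}
    (h : H.IsARPair k a n) : projectiveDimension (injModule.{u, v} K (e k)) = n := by
  refine le_antisymm ((projectiveDimension_le_iff _ _).2 h.pd)
    ((projectiveDimension_ge_iff _ _).2 fun hlt => ?_)
  obtain ⟨ε, hε, -⟩ := h.generator
  exact hε (ε.eq_zero_of_hasProjectiveDimensionLT n le_rfl)

/-- For uniqueness, the class belonging to the syzygy P(φ k) survives along the top P(φ k) → S(φ k),
while Ext in that degree to S(b) vanishes for b ≠ ψ k. -/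
theorem IsTriangular.isAuslanderReitenMap_iff (H : IsTriangular K e) {ψ : V → V} {n : V → ℕ}
    (hψ : ∀ k, H.IsARPair k (ψ k) (n k)) (φ : V → V) :
    IsAuslanderReitenMap.{u, v} K e φ ↔ φ = ψ := by
  constructor
  · intro h
    funext k
    obtain ⟨d, hd, hs⟩ := h k
    rw [(hψ k).projectiveDimension_eq] at hd
    obtain rfl : n k = d := by exact_mod_cast hd
    obtain ⟨η, h1, -⟩ := H.exists_ext_of_isSyzygy hs
    by_contra hne
    refine H.top_ne_zero (φ k) (congrArg ModuleCat.Hom.hom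
      (h1 (φ k) (ModuleCat.ofHom (H.top (φ k))) ((hψ k).ext_simple_of_ne hne _)))
  · rintro rfl k
    exact ⟨n k, (hψ k).projectiveDimension_eq, (hψ k).isSyzygy⟩

end AuslanderReiten

end QuiverAlg

namespace QuiverAlg

/-! ### Bound quiver algebras of acyclic quivers are triangular. -/

section PathHeight

variable {V : Type v} [Quiver.{w} V] [Fintype V]

open Classical in
/-- The number of vertices from which there is a path to `a`. -/
noncomputable def pathHeight (a : V) : ℕ :=
  (Finset.univ.filter fun c => Nonempty (Quiver.Path c a)).card

theorem pathHeight_lt (hQ : IsAcyclic V) {a b : V} (hab : a ≠ b) (p : Quiver.Path a b) :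
    pathHeight a < pathHeight b := by
  classical
  refine Finset.card_lt_card ((Finset.ssubset_iff_of_subset fun c hc => ?_).2
    ⟨b, Finset.mem_filter.2 ⟨Finset.mem_univ _, ⟨Quiver.Path.nil⟩⟩, fun hb => ?_⟩)
  · obtain ⟨-, ⟨q⟩⟩ := Finset.mem_filter.1 hc
    exact Finset.mem_filter.2 ⟨Finset.mem_univ _, ⟨q.comp p⟩⟩
  · obtain ⟨-, ⟨q⟩⟩ := Finset.mem_filter.1 hb
    have h := hQ a (p.comp q)
    rw [Quiver.Path.length_comp] at h
    exact hab (Quiver.Path.eq_of_length_zero p (by omega))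

/-- Each arrow strictly increases the number of predecessors, so path lengths are bounded and there
are finitely many paths. -/
theorem length_add_pathHeight_le (hQ : IsAcyclic V) {a b : V} (p : Quiver.Path a b) :
    p.length + pathHeight a ≤ pathHeight b := by
  induction p with
  | nil => simp
  | @cons c d p f ih =>
    have hcd : c ≠ d := by
      rintro rfl
      have := hQ c f.toPath
      simp at this
    have := pathHeight_lt hQ hcd f.toPath
    rw [Quiver.Path.length_cons]
    omega

theorem finite_paths_of_length [∀ a b : V, Finite (a ⟶ b)] (n : ℕ) (a b : V) :
    {p : Quiver.Path a b | p.length = n}.Finite := by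
  induction n generalizing b with
  | zero =>
    refine Set.Subsingleton.finite fun p hp q hq => ?_
    obtain rfl := Quiver.Path.eq_of_length_zero p hp
    rw [Quiver.Path.eq_nil_of_length_zero p hp, Quiver.Path.eq_nil_of_length_zero q hq]
  | succ n ih =>
    have h : (⋃ c : V, ⋃ f : c ⟶ b,
        (fun p : Quiver.Path a c => p.cons f) '' {p | p.length = n}).Finite :=
      Set.finite_iUnion fun c => Set.finite_iUnion fun f => (ih c).image _
    refine h.subset fun p hp => ?_
    cases p with
    | nil => simp at hp
    | @cons c _ p f =>
      exact Set.mem_iUnion.2 ⟨c, Set.mem_iUnion.2 ⟨f, p, Nat.succ.inj hp, rfl⟩⟩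

theorem finite_allPaths [∀ a b : V, Finite (a ⟶ b)] (hQ : IsAcyclic V) :
    Finite (AllPaths V) := by
  have : ∀ a b : V, Finite (Quiver.Path a b) := fun a b => by
    rw [← Set.finite_univ_iff]
    refine (Set.finite_iUnion fun i : Fin (pathHeight b + 1) =>
      finite_paths_of_length (i : ℕ) a b).subset fun p _ => ?_
    have := length_add_pathHeight_le hQ p
    exact Set.mem_iUnion.2 ⟨⟨p.length, by omega⟩, rfl⟩
  infer_instance

end PathHeight

section Triangular

variable {K : Type u} [Field K] {V : Type v} [Fintype V] [Quiver.{w} V]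

/-- Products of two paths of positive length have coefficient zero at a trivial path. As I lies in
the square of the arrow ideal, the vertex idempotents stay nonzero in the quotient. -/
theorem ofPath_nil_notMem_sq (a : V) :
    ofPath K ⟨a, a, Quiver.Path.nil⟩ ∉ arrowIdeal K V ^ 2 := by
  let φ : PathAlgebra K V →ₗ[K] K := Finsupp.lapply ⟨a, a, Quiver.Path.nil⟩
  have h : arrowIdeal K V ^ 2 ≤ LinearMap.ker φ := by
    rw [pow_two, arrowIdeal, Submodule.span_mul_span, Submodule.span_le]
    rintro _ ⟨_, ⟨⟨b, c, p⟩, hp, rfl⟩, _, ⟨⟨c', d, q⟩, hq, rfl⟩, rfl⟩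
    by_cases hc : c = c'
    · subst hc
      change φ (ofPath K ⟨b, c, p⟩ * ofPath K ⟨c, d, q⟩) = 0
      rw [ofPath_mul_ofPath]
      refine Finsupp.single_eq_of_ne fun h => ?_
      have h1 : (⟨a, a, Quiver.Path.nil⟩ : AllPaths V).2.2.length =
        (⟨b, d, p.comp q⟩ : AllPaths V).2.2.length := by rw [h]
      simp only [Quiver.Path.length_nil, Quiver.Path.length_comp] at h1 hp
      omega
    · change φ (ofPath K ⟨b, c, p⟩ * ofPath K ⟨c', d, q⟩) = 0
      rw [ofPath_mul_ofPath_of_ne hc, map_zero]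
  intro ha
  have h1 : φ (ofPath K ⟨a, a, Quiver.Path.nil⟩) = 1 := Finsupp.single_eq_same
  rw [LinearMap.mem_ker.1 (h ha)] at h1
  exact zero_ne_one h1

variable (I : Ideal (PathAlgebra K V)) [I.IsTwoSided]

theorem vertexIdem_mul_mk_mul (a b : V) (p : AllPaths V) :
    (∃ q : Quiver.Path a b, p = ⟨a, b, q⟩) ∨
      vertexIdem I a * Ideal.Quotient.mk I (ofPath K p) * vertexIdem I b = 0 := by
  obtain ⟨a', b', q⟩ := p
  by_cases ha : a = a'
  · subst ha
    by_cases hb : b' = b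
    · subst hb
      exact Or.inl ⟨q, rfl⟩
    · right
      rw [vertexIdem, vertexIdem, mul_assoc, ← map_mul (Ideal.Quotient.mk I) (ofPath K ⟨a, b', q⟩),
        ofPath_mul_ofPath_of_ne hb, map_zero, mul_zero]
  · right
    rw [vertexIdem, vertexIdem, ← map_mul, ofPath_mul_ofPath_of_ne ha, map_zero, zero_mul]

theorem nonempty_path_of_ne_zero {a b : V} {x : PathAlgebra K V ⧸ I}
    (hx : vertexIdem I a * x * vertexIdem I b ≠ 0) : Nonempty (Quiver.Path a b) := by
  by_contra hne
  refine hx ?_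
  obtain ⟨x, rfl⟩ := Ideal.Quotient.mk_surjective x
  refine induction_on x ?_ ?_ ?_
  · rw [map_zero, mul_zero, zero_mul]
  · intro x y hx hy
    rw [map_add, mul_add, add_mul, hx, hy, add_zero]
  · intro k p
    have h : Ideal.Quotient.mk I (k • ofPath K p) = k • Ideal.Quotient.mk I (ofPath K p) := rfl
    rw [h, mul_smul_comm, smul_mul_assoc]
    rcases vertexIdem_mul_mk_mul I a b p with ⟨q, -⟩ | h0
    · exact absurd ⟨q⟩ hne
    · rw [h0, smul_zero]

theorem vertexIdem_mul_self (a : V) : vertexIdem I a * vertexIdem I a = vertexIdem I a := by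
  rw [vertexIdem, ← map_mul, ofPath_mul_ofPath, Quiver.Path.comp_nil]

theorem vertexIdem_corner (hQ : IsAcyclic V) (a : V) (x : PathAlgebra K V ⧸ I) :
    ∃ c : K, vertexIdem I a * x * vertexIdem I a = c • vertexIdem I a := by
  obtain ⟨x, rfl⟩ := Ideal.Quotient.mk_surjective x
  refine induction_on x ?_ ?_ ?_
  · exact ⟨0, by rw [map_zero, mul_zero, zero_mul, zero_smul]⟩
  · rintro x y ⟨c, hc⟩ ⟨d, hd⟩
    exact ⟨c + d, by rw [map_add, mul_add, add_mul, hc, hd, add_smul]⟩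
  · intro k p
    have h : Ideal.Quotient.mk I (k • ofPath K p) = k • Ideal.Quotient.mk I (ofPath K p) := rfl
    rw [h, mul_smul_comm, smul_mul_assoc]
    rcases vertexIdem_mul_mk_mul I a a p with ⟨q, rfl⟩ | h0
    · refine ⟨k, ?_⟩
      rw [Quiver.Path.eq_nil_of_length_zero q (hQ a q)]
      change k • (vertexIdem I a * vertexIdem I a * vertexIdem I a) = _
      rw [vertexIdem_mul_self, vertexIdem_mul_self]
    · exact ⟨0, by rw [h0, smul_zero, zero_smul]⟩

/-- A bound quiver algebra of a finite acyclic quiver is triangular. -/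
theorem isTriangular_vertexIdem [∀ a b : V, Finite (a ⟶ b)] (hQ : IsAcyclic V)
    (hI : IsAdmissible I) : IsTriangular K (vertexIdem I) where
  finite := by
    have := finite_allPaths hQ
    have : Module.Finite K (PathAlgebra K V) := inferInstanceAs (Module.Finite K (AllPaths V →₀ K))
    exact Module.Finite.of_surjective (Ideal.Quotient.mkₐ K I).toLinearMap
      Ideal.Quotient.mk_surjective
  ne_zero a h := ofPath_nil_notMem_sq a (hI.2 (Ideal.Quotient.eq_zero_iff_mem.1 h))
  idem := vertexIdem_mul_self I
  orth a b hab := by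
    rw [vertexIdem, vertexIdem, ← map_mul, ofPath_mul_ofPath_of_ne hab, map_zero]
  sum_eq_one := by
    rw [← map_one (Ideal.Quotient.mk I), one_eq_sum, map_sum]
    rfl
  corner := vertexIdem_corner I hQ
  exists_height := ⟨pathHeight, fun a b x hx => by
    obtain ⟨p⟩ := nonempty_path_of_ne_zero I hx
    by_cases hab : a = b
    · exact Or.inl hab
    · exact Or.inr (pathHeight_lt hQ hab p)⟩

theorem IsNaturalLabelling.isHeight {l : V ≃ Fin (Fintype.card V)} (hl : IsNaturalLabelling l) :
    IsHeight (vertexIdem I) fun a => (l a : ℕ) := fun a b x hx => by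
  by_cases hab : a = b
  · exact Or.inl hab
  · exact Or.inr (hl a b hab (nonempty_path_of_ne_zero I hx))

end Triangular

end QuiverAlg

namespace QuiverAlg

/-! ### Conclusion. -/

section Main

variable {K : Type u} [Field K] {A : Type (max u v)} [Ring A] [Algebra K A] {V : Type*} [Fintype V]
  {e : V → A}

/-- The Auslander–Reiten permutation of an Auslander regular triangular algebra is its Coxeter
permutation. -/
theorem IsTriangular.exists_auslanderReiten_perm (H : IsTriangular K e)
    (hA : IsAuslanderGorenstein A) :
    ∃ ψ : Equiv.Perm V, (∀ φ : V → V, IsAuslanderReitenMap.{u, v} K e φ ↔ φ = ψ) ∧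
      ∀ (n : ℕ) (l : V ≃ Fin n), IsHeight e (fun a => (l a : ℕ)) → ∀ p : Equiv.Perm (Fin n),
        IsBruhatPermutation (coxeterMatrix K fun i => e (l.symm i)) p ↔
          l.symm.permCongr p = ψ := by
  obtain ⟨⟨d, hd⟩, J, -, hJ⟩ := hA
  have hgr := H.gradeCondition J hJ
  obtain ⟨ψ, n, hψ, hn, hM⟩ := H.exists_bijection hgr hd
  exact ⟨ψ, H.isAuslanderReitenMap_iff hψ, fun m l hl =>
    H.isBruhatPermutation_coxeterMatrix_iff ψ (fun r => ⟨n r, (hψ r).pd⟩) l hl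
      fun r b i x hx => H.height_le_of_ext_ne_zero hgr hψ hn hM hl r b i x hx⟩

end Main

end QuiverAlg

theorem mainTheorem4 {K : Type u} [Field K] {V : Type v} [Fintype V] [Quiver.{w} V]
    [∀ a b : V, Finite (a ⟶ b)] (hQ : QuiverAlg.IsAcyclic V)
    (I : Ideal (QuiverAlg.PathAlgebra K V)) [I.IsTwoSided] (hI : QuiverAlg.IsAdmissible I)
    (hA : QuiverAlg.IsAuslanderRegular (QuiverAlg.PathAlgebra K V ⧸ I)) :
    QuiverAlg.IsCoxeterIndependent K (QuiverAlg.vertexIdem I) ∧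
    ∃ ψ : Equiv.Perm V,
      (∀ φ : V → V,
        QuiverAlg.IsAuslanderReitenMap.{u, max v w} K (QuiverAlg.vertexIdem I) φ ↔ φ = ψ) ∧
      ∀ l : V ≃ Fin (Fintype.card V), QuiverAlg.IsNaturalLabelling l →
        ∀ p : Equiv.Perm (Fin (Fintype.card V)),
          QuiverAlg.IsCoxeterPermutation K (QuiverAlg.vertexIdem I) l p ↔
            l.symm.permCongr p = ψ := by
  have H := QuiverAlg.isTriangular_vertexIdem I hQ hI
  obtain ⟨ψ, h1, h2⟩ :=
    QuiverAlg.IsTriangular.exists_auslanderReiten_perm.{u, max v w} H hA.1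
  have h3 : ∀ l : V ≃ Fin (Fintype.card V), QuiverAlg.IsNaturalLabelling l →
      ∀ p : Equiv.Perm (Fin (Fintype.card V)),
        QuiverAlg.IsCoxeterPermutation K (QuiverAlg.vertexIdem I) l p ↔
          l.symm.permCongr p = ψ := fun l hl p => h2 _ l (hl.isHeight I) p
  exact ⟨⟨ψ, h3⟩, ψ, h1, h3⟩
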